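/- Let $d\ge 1$, let $D\subset\mathbb{R}^d$ be open and bounded, and consider $\mathcal{L}u=-\nabla\cdot(a\nabla u)+cu$ with homogeneous Dirichlet boundary condition, where $a$ is a measurable field of symmetric $d\times d$ matrices and $c$ a measurable function on $D$ with $$a_{\min}I_d\preceq a(x)\preceq a_{\max}I_d,\qquad 0\le c(x)\le c_{\max}\qquad\text{for a.e. }x\in D,\qquad 0<a_{\min}\le a_{\max}<\infty .$$ For measurable $S\subset D$ write $\|\psi\|_{H(S)}^2=\int_S(\nabla\psi\cdot a\nabla\psi+c\psi^2)$. Let $\tau_1,\dots,\tau_m\subset D$ be nonempty, pairwise disjoint, open convex sets that cover $D$ up to a null set, let $h=\max_j\operatorname{diam}\tau_j$, and suppose that for some $\delta>0$ every $\tau_j$ contains a ball of diameter $\delta\operatorname{diam}\tau_j$. For $1\le i\le m$ let $\psi_i$ be the minimizer of $\|\psi\|_{H(D)}^2$ over all $\psi\in H_0^1(D)$ with $\int_{\tau_j}\psi=\delta_{i,j}$ (Kronecker delta) for $j=1,\dots,m$, and let $x_i\in\tau_i$ be any point. (i) If $c_{\max}>0$ and $h\le\pi\sqrt{a_{\max}/(2c_{\max})}$,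 then for all $r>0$ $$\|\psi_i\|_{H(D\setminus B(x_i,r))}^2\le\exp\Bigl(1-\frac{r}{lh}\Bigr)\|\psi_i\|_{H(D)}^2,\qquad l=\frac{e-1}{\pi}\,(1+C(d,\delta))\sqrt{\frac{a_{\max}}{a_{\min}}},$$ with $C(d,\delta)=\sqrt{8d(d+2)}\,\delta^{-1-d/2}$. (ii) If $c=0$ a.e. on $D$, then the same inequality holds for all $r>0$ without any restriction on $h$, with the same formula for $l$ and $C(d,\delta)=\sqrt{4d(d+2)}\,\delta^{-1-d/2}$. -/

import Mathlib

open MeasureTheory Set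
open scoped ContDiff ENNReal Matrix

/-- The Euclidean space `ℝ^d`. -/
abbrev Rd (d : ℕ) : Type := EuclideanSpace ℝ (Fin d)

/-- Test functions on `D`: smooth functions with compact support contained in `D`. -/
structure IsTestFun {d : ℕ} (D : Set (Rd d)) (φ : Rd d → ℝ) : Prop where
  smooth : ContDiff ℝ ∞ φ
  compact : HasCompactSupport φ
  support : tsupport φ ⊆ D

/-- `G` is the weak gradient of `u` on `D`, by integration against test functions
(an identity between vectors of `ℝ^d`). -/
def HasWeakGradient {d : ℕ} (D : Set (Rd d)) (u : Rd d → ℝ) (G : Rd d → Rd d) : Prop :=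
  ∀ φ : Rd d → ℝ, IsTestFun D φ →
    ∫ x in D, u x • gradient φ x = - ∫ x in D, φ x • G x

/-- `u` belongs to the Sobolev space `H_0^1(D)` and has weak gradient `G`:
`u` and `G` are square integrable on `D`, `G` is the weak gradient of `u`, and `u` is a limit of
test functions in the norm of `H^1(D)`. -/
structure MemH10 {d : ℕ} (D : Set (Rd d)) (u : Rd d → ℝ) (G : Rd d → Rd d) : Prop where
  memLp : MemLp u 2 (volume.restrict D)
  memLp_grad : MemLp G 2 (volume.restrict D)
  weakGrad : HasWeakGradient D u G
  approx : ∀ ε : ℝ≥0∞, 0 < ε → ∃ φ : Rd d → ℝ, IsTestFun D φ ∧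
    eLpNorm (fun x => u x - φ x) 2 (volume.restrict D) ≤ ε ∧
    eLpNorm (fun x => G x - gradient φ x) 2 (volume.restrict D) ≤ ε

/-- Coefficients of `u ↦ -∇·(a ∇u) + c u` on `D`: `a` is measurable, symmetric and satisfies
`amin I ≼ a ≼ amax I`, and `c` is measurable with `0 ≤ c ≤ cmax`, almost everywhere on `D`. -/
structure IsEllipticCoeff {d : ℕ} (D : Set (Rd d)) (a : Rd d → Matrix (Fin d) (Fin d) ℝ)
    (c : Rd d → ℝ) (amin amax cmax : ℝ) : Prop where
  measurable_a : ∀ p q, AEMeasurable (fun x => a x p q) (volume.restrict D)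
  measurable_c : AEMeasurable c (volume.restrict D)
  symm : ∀ᵐ x ∂(volume.restrict D), (a x).IsSymm
  lower : ∀ᵐ x ∂(volume.restrict D), ∀ ξ : Fin d → ℝ, amin * (ξ ⬝ᵥ ξ) ≤ ξ ⬝ᵥ (a x *ᵥ ξ)
  upper : ∀ᵐ x ∂(volume.restrict D), ∀ ξ : Fin d → ℝ, ξ ⬝ᵥ (a x *ᵥ ξ) ≤ amax * (ξ ⬝ᵥ ξ)
  bound_c : ∀ᵐ x ∂(volume.restrict D), 0 ≤ c x ∧ c x ≤ cmax

/-- The squared local energy norm `‖u‖²_{H(S)} = ∫_S (∇u · a ∇u + c u²)`, where `G = ∇u`. -/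
noncomputable def energySq {d : ℕ} (a : Rd d → Matrix (Fin d) (Fin d) ℝ) (c : Rd d → ℝ)
    (S : Set (Rd d)) (u : Rd d → ℝ) (G : Rd d → Rd d) : ℝ :=
  ∫ x in S, ((G x).ofLp ⬝ᵥ (a x *ᵥ (G x).ofLp) + c x * u x ^ 2)

/-- A partition of `D` into finitely many open convex elements `τ j`, up to a null set, each of
which contains a ball of diameter `δ` times the diameter of the element. -/
structure IsRegularPartition {d m : ℕ} (D : Set (Rd d)) (τ : Fin m → Set (Rd d)) (δ : ℝ) :
    Prop where
  isOpen : ∀ j, IsOpen (τ j)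
  convex : ∀ j, Convex ℝ (τ j)
  nonempty : ∀ j, (τ j).Nonempty
  subset : ∀ j, τ j ⊆ D
  disjoint : Pairwise fun j k => Disjoint (τ j) (τ k)
  cover : volume (D \ ⋃ j, τ j) = 0
  inscribed : ∀ j, ∃ y, Metric.ball y (δ * Metric.diam (τ j) / 2) ⊆ τ j

/-- The mesh size: the maximum diameter of the elements. -/
noncomputable def meshSize {d m : ℕ} (τ : Fin m → Set (Rd d)) : ℝ :=
  ⨆ j, Metric.diam (τ j)

/-- `ψ ∈ H_0^1(D)`, with gradient `G`, satisfies `(ψ, φ_j)_{L²(D)} = δ_{ij}` for all `j`. -/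
def IsAdmissible {d m : ℕ} (D : Set (Rd d)) (φ : Fin m → Rd d → ℝ) (i : Fin m)
    (ψ : Rd d → ℝ) (G : Rd d → Rd d) : Prop :=
  MemH10 D ψ G ∧ ∀ j, ∫ x in D, ψ x * φ j x = if i = j then 1 else 0

/-- `ψ`, with gradient `G`, is the energy-minimizing basis function with index `i` for the
measurement functions `φ`: it minimizes `‖·‖²_{H(D)}` over `H_0^1(D)` subject to
`(ψ, φ_j)_{L²(D)} = δ_{ij}` for all `j`. -/
def IsEnergyMinimizer {d m : ℕ} (D : Set (Rd d)) (a : Rd d → Matrix (Fin d) (Fin d) ℝ)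
    (c : Rd d → ℝ) (φ : Fin m → Rd d → ℝ) (i : Fin m) (ψ : Rd d → ℝ) (G : Rd d → Rd d) : Prop :=
  IsAdmissible D φ i ψ G ∧
    ∀ (v : Rd d → ℝ) (Gv : Rd d → Rd d), IsAdmissible D φ i v Gv →
      energySq a c D ψ G ≤ energySq a c D v Gv

/-- The basis of the space of piecewise constants: `φ_j` is the indicator function of `τ j`. -/
noncomputable def piecewiseConst {d m : ℕ} (τ : Fin m → Set (Rd d)) (j : Fin m) : Rd d → ℝ :=
  (τ j).indicator fun _ => 1

/-- The decay length `(e - 1)/π * (1 + C) * √(amax/amin)` in units of the mesh size. -/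
noncomputable def decayLength (C amin amax : ℝ) : ℝ :=
  (Real.exp 1 - 1) / Real.pi * (1 + C) * √(amax / amin)

/-! Minimality gives one multiplier `b j` per element: the energy form of ψ against any v in
`H_0^1(D)` is the sum of `b j * ∫_{τ_j} v` (`exists_multipliers`). This is tested with v = ηψ, where
η is a smooth form of the positive part of min(W, T) - 1, with W(y) = exp(α(|y - x|/h - 1)) and T =
exp(α(r/h - 2)). The energy weighted by η is then a sum over elements of two errors, ∫ ψ ∇ψ·a∇η and
`b j * ∫ ηψ`.

On τ_i both vanish because η = 0 there. On every other element ψ has mean zero, so a Poincaré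
inequality bounds ψ by the diameter times ∇ψ, and η may be replaced by its deviation from a
constant. With a bound on `b j`, the errors on τ_j are at most sup|∇η| · diam τ_j · A times the
energy on τ_j (`element_error_le`). Since |∇η| ≤ (α/h) W, and W varies by at most a factor exp α on
an element, the condition α A exp α ≤ 1 makes them at most the energy weighted by min(W, T).
Moreover ∇η = 0 where W ≥ T, so only elements inside B(x, r) contribute. Subtracting leaves T times
the energy outside the ball, bounded by the total energy (`energySq_decay`).

The bound on `b j` tests with v = ρ² - (ρ - g)², where g is the distance to the boundary of τ_j
capped at the radius ρ of the inscribed ball. Convexity makes the set where g is small have small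
volume, which bounds ∫ v from below and the energy of v from above (`sq_multiplier_le`).

The Poincaré constant is √(e/2) times the radius of an enclosing ball. It comes from
Prékopa–Leindler applied to a Gaussian restricted to the convex set, expanded to second order. It is
weaker than the sharp diam/π, but C is about 2sδ^{-1-d/2} where only s/δ is needed, and this slack
suffices (`decayLength_bounds`). -/

/-! ### The Prékopa–Leindler inequality. -/

/-- Brunn–Minkowski on the line, for compact sets. -/
theorem volume_add_volume_le_of_isCompact {K L C : Set ℝ} (hK : IsCompact K) (hL : IsCompact L)
    (hK0 : K.Nonempty) (hL0 : L.Nonempty) (h : ∀ a ∈ K, ∀ b ∈ L, a + b ∈ C) :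
    volume K + volume L ≤ volume C := by
  obtain ⟨M, hM, hMax⟩ := hK.exists_isGreatest hK0
  obtain ⟨m, hm, hmin⟩ := hL.exists_isLeast hL0
  have h1 : volume ((fun z => z + -m) ⁻¹' K) = volume K := measure_preimage_add_right _ _ _
  have h2 : volume ((fun z => z + -M) ⁻¹' L) = volume L := measure_preimage_add_right _ _ _
  rw [← h1, ← h2, ← measure_union₀]
  · refine measure_mono ?_
    rintro z (hz | hz)
    · simpa using h _ hz _ hm
    · simpa using h _ hM _ hz
  · exact ((hL.measurableSet).preimage (measurable_id.add_const _)).nullMeasurableSet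
  -- The translate K + m lies to the left of M + m and L + M to the right, so they share at most
  -- that point.
  · have : (fun z => z + -m) ⁻¹' K ∩ (fun z => z + -M) ⁻¹' L ⊆ {M + m} := by
      rintro z ⟨hz1, hz2⟩
      have a1 := hMax hz1
      have a2 := hmin hz2
      simp only [mem_singleton_iff]
      linarith
    exact measure_mono_null this (by simp)

/-- Brunn–Minkowski on the line, for midpoints of measurable sets. -/
theorem volume_add_volume_le_two_mul {A B C : Set ℝ} (hA : MeasurableSet A) (hB : MeasurableSet B)
    (hA0 : A.Nonempty) (hB0 : B.Nonempty) (h : ∀ a ∈ A, ∀ b ∈ B, (a + b) / 2 ∈ C) :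
    volume A + volume B ≤ 2 * volume C := by
  obtain ⟨a, ha⟩ := hA0
  obtain ⟨b, hb⟩ := hB0
  have hC : volume ((fun z : ℝ => (1 / 2 : ℝ) * z) ⁻¹' C) = 2 * volume C := by
    rw [Real.volume_preimage_mul_left (by norm_num)]
    norm_num
  rw [← hC, hA.measure_eq_iSup_isCompact, hB.measure_eq_iSup_isCompact]
  simp only [iSup_and']
  refine ENNReal.biSup_add_biSup_le' ⟨∅, by simp⟩ ⟨∅, by simp⟩ ?_
  rintro K ⟨hKA, hK⟩ L ⟨hLB, hL⟩
  -- The compact sets of the inner approximation may be empty; adding `a` and `b` makes them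
  -- nonempty without leaving A and B.
  calc volume K + volume L ≤ volume (insert a K) + volume (insert b L) :=
        add_le_add (measure_mono (subset_insert _ _)) (measure_mono (subset_insert _ _))
    _ ≤ _ := by
      refine volume_add_volume_le_of_isCompact (hK.insert a) (hL.insert b) (insert_nonempty _ _)
        (insert_nonempty _ _) ?_
      intro x hx y hy
      have := h x (insert_subset ha hKA hx) y (insert_subset hb hLB hy)
      simp only [mem_preimage]
      convert this using 1
      ring

/-- Layer cake formula: levels t ≥ 1 contribute nothing. Restricting to t < 1 matters because
Brunn–Minkowski needs both superlevel sets nonempty. -/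
theorem lintegral_ofReal_le_setLIntegral_Ioo {f : ℝ → ℝ} (hf : Measurable f) (h0 : ∀ x, 0 ≤ f x)
    (h1 : ∀ x, f x ≤ 1) :
    ∫⁻ x, ENNReal.ofReal (f x) ≤ ∫⁻ t in Ioo (0 : ℝ) 1, volume {x | t < f x} := by
  rw [lintegral_eq_lintegral_meas_lt _ (Filter.Eventually.of_forall h0) hf.aemeasurable,
    ← Ioo_union_Ici_eq_Ioi (zero_lt_one' ℝ)]
  refine (lintegral_union_le _ _ _).trans ?_
  rw [setLIntegral_eq_zero measurableSet_Ici, add_zero]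
  intro t ht
  have : {x | t < f x} = ∅ := by
    ext x
    simpa using (h1 x).trans ht
  simp [this]

/-- Prékopa–Leindler on the line, additive form for functions normalized by their suprema. -/
theorem lintegral_add_lintegral_le_of_normalized {f g h : ℝ → ℝ} (hf : Measurable f)
    (hg : Measurable g) (hh : Measurable h) (f0 : ∀ x, 0 ≤ f x) (f1 : ∀ x, f x ≤ 1)
    (g0 : ∀ x, 0 ≤ g x) (g1 : ∀ x, g x ≤ 1) (h0 : ∀ x, 0 ≤ h x)
    (fs : ∀ t < 1, ∃ x, t < f x) (gs : ∀ t < 1, ∃ x, t < g x)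
    (H : ∀ x y, f x * g y ≤ h ((x + y) / 2) ^ 2) :
    (∫⁻ x, ENNReal.ofReal (f x)) + ∫⁻ x, ENNReal.ofReal (g x)
      ≤ 2 * ∫⁻ x, ENNReal.ofReal (h x) := by
  refine (add_le_add (lintegral_ofReal_le_setLIntegral_Ioo hf f0 f1)
    (lintegral_ofReal_le_setLIntegral_Ioo hg g0 g1)).trans ?_
  rw [lintegral_eq_lintegral_meas_lt _ (Filter.Eventually.of_forall h0) hh.aemeasurable,
    ← lintegral_add_left]
  · rw [← lintegral_const_mul']
    · refine le_trans (setLIntegral_mono' measurableSet_Ioo ?_)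
        (lintegral_mono_set fun t (ht : t ∈ Ioo (0 : ℝ) 1) => ht.1)
      rintro t ⟨ht0, ht1⟩
      refine volume_add_volume_le_two_mul (measurableSet_lt measurable_const hf)
        (measurableSet_lt measurable_const hg) (fs t ht1) (gs t ht1) ?_
      intro x hx y hy
      have hx' : t < f x := hx
      have hy' : t < g y := hy
      have := H x y
      refine lt_of_pow_lt_pow_left₀ 2 (h0 _) (lt_of_lt_of_le ?_ this)
      nlinarith
    · norm_num
  · have : Antitone fun t : ℝ => volume {x | t < f x} := fun s t hst =>
      measure_mono fun x (hx : t < f x) => lt_of_le_of_lt hst hx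
    exact this.measurable

/-- The arithmetic-geometric mean inequality, which turns the additive normalized form of
Prékopa–Leindler into the multiplicative one. -/
theorem ENNReal.mul_self_le_of_add_le {a b c : ℝ≥0∞} (h : a + b ≤ 2 * c) : a * b ≤ c ^ 2 := by
  rcases eq_or_ne c ⊤ with rfl | hc
  · simp
  have h2 : 2 * c ≠ ⊤ := ENNReal.mul_ne_top (by norm_num) hc
  have ha : a ≠ ⊤ := ne_top_of_le_ne_top h2 (le_self_add.trans h)
  have hb : b ≠ ⊤ := ne_top_of_le_ne_top h2 (le_add_self.trans h)
  lift a to NNReal using ha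
  lift b to NNReal using hb
  lift c to NNReal using hc
  norm_cast at h ⊢
  have h' : (a : ℝ) + b ≤ 2 * c := by exact_mod_cast h
  have : (a : ℝ) * b ≤ c ^ 2 := by nlinarith [sq_nonneg ((a : ℝ) - b), a.2, b.2, c.2]
  exact_mod_cast this

/-- Prékopa–Leindler on the line, for bounded real functions. -/
theorem prekopa_leindler_real_of_bounded {f g h : ℝ → ℝ} (hf : Measurable f)
    (hg : Measurable g) (hh : Measurable h) (f0 : ∀ x, 0 ≤ f x) (g0 : ∀ x, 0 ≤ g x)
    (h0 : ∀ x, 0 ≤ h x) (fb : BddAbove (range f)) (gb : BddAbove (range g))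
    (H : ∀ x y, f x * g y ≤ h ((x + y) / 2) ^ 2) :
    (∫⁻ x, ENNReal.ofReal (f x)) * ∫⁻ x, ENNReal.ofReal (g x)
      ≤ (∫⁻ x, ENNReal.ofReal (h x)) ^ 2 := by
  by_cases hfz : ∀ x, f x = 0
  · simp [hfz]
  by_cases hgz : ∀ x, g x = 0
  · simp [hgz]
  push Not at hfz hgz
  obtain ⟨x0, hx0⟩ := hfz
  obtain ⟨y0, hy0⟩ := hgz
  set a := ⨆ x, f x
  set b := ⨆ x, g x
  have fa : ∀ x, f x ≤ a := fun x => le_ciSup fb x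
  have gb' : ∀ x, g x ≤ b := fun x => le_ciSup gb x
  have ha : 0 < a := lt_of_lt_of_le (lt_of_le_of_ne (f0 x0) hx0.symm) (fa x0)
  have hb : 0 < b := lt_of_lt_of_le (lt_of_le_of_ne (g0 y0) hy0.symm) (gb' y0)
  -- Dividing f, g, h by a, b and √(ab) preserves the hypothesis and gives f and g supremum 1; the
  -- factors cancel in the product form.
  set s := √(a * b)
  have hs : 0 < s := Real.sqrt_pos.2 (mul_pos ha hb)
  have hs2 : s ^ 2 = a * b := Real.sq_sqrt (mul_pos ha hb).le
  have key := lintegral_add_lintegral_le_of_normalized (f := fun x => a⁻¹ * f x)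
    (g := fun x => b⁻¹ * g x) (h := fun x => s⁻¹ * h x) (hf.const_mul _) (hg.const_mul _)
    (hh.const_mul _) (fun x => mul_nonneg (inv_nonneg.2 ha.le) (f0 x))
    (fun x => by rw [inv_mul_le_iff₀ ha]; simpa using fa x)
    (fun x => mul_nonneg (inv_nonneg.2 hb.le) (g0 x))
    (fun x => by rw [inv_mul_le_iff₀ hb]; simpa using gb' x)
    (fun x => mul_nonneg (inv_nonneg.2 hs.le) (h0 x))
    (fun t ht => by
      obtain ⟨x, hx⟩ := exists_lt_of_lt_ciSup (show a * t < ⨆ x, f x by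
        change a * t < a; nlinarith)
      exact ⟨x, by rw [lt_inv_mul_iff₀ ha]; exact hx⟩)
    (fun t ht => by
      obtain ⟨x, hx⟩ := exists_lt_of_lt_ciSup (show b * t < ⨆ x, g x by
        change b * t < b; nlinarith)
      exact ⟨x, by rw [lt_inv_mul_iff₀ hb]; exact hx⟩)
    (fun x y => by
      have := H x y
      rw [mul_pow, inv_pow, hs2, mul_inv]
      calc a⁻¹ * f x * (b⁻¹ * g y) = a⁻¹ * b⁻¹ * (f x * g y) := by ring
        _ ≤ _ := mul_le_mul_of_nonneg_left this (by positivity))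
  have key2 := ENNReal.mul_self_le_of_add_le key
  have scale : ∀ (r : ℝ) (k : ℝ → ℝ), 0 < r → ∫⁻ x, ENNReal.ofReal (r⁻¹ * k x)
      = ENNReal.ofReal r⁻¹ * ∫⁻ x, ENNReal.ofReal (k x) := by
    intro r k hr
    rw [← lintegral_const_mul' _ _ ENNReal.ofReal_ne_top]
    simp_rw [ENNReal.ofReal_mul (inv_nonneg.2 hr.le)]
  rw [scale a f ha, scale b g hb, scale s h hs, mul_pow, ← ENNReal.ofReal_pow (by positivity),
    inv_pow, hs2, mul_inv, ENNReal.ofReal_mul (by positivity)] at key2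
  have hne : ENNReal.ofReal a⁻¹ * ENNReal.ofReal b⁻¹ ≠ 0 := by
    simp [ha, hb]
  have hnt : ENNReal.ofReal a⁻¹ * ENNReal.ofReal b⁻¹ ≠ ⊤ :=
    ENNReal.mul_ne_top ENNReal.ofReal_ne_top ENNReal.ofReal_ne_top
  rw [show ∀ p q r t : ℝ≥0∞, p * q * (r * t) = p * r * (q * t) from fun p q r t => by ring] at key2
  exact (ENNReal.mul_le_mul_iff_right hne hnt).1 key2

/-- Prékopa–Leindler on the line. -/
theorem prekopa_leindler_real {f g h : ℝ → ℝ≥0∞} (hf : Measurable f) (hg : Measurable g)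
    (hh : Measurable h) (H : ∀ x y, f x * g y ≤ h ((x + y) / 2) ^ 2) :
    (∫⁻ x, f x) * ∫⁻ x, g x ≤ (∫⁻ x, h x) ^ 2 := by
  -- The normalization needs finite suprema. Capping all three functions at n preserves the
  -- hypothesis, and n then tends to infinity.
  have trunc : ∀ k : ℝ → ℝ≥0∞, Measurable k →
      ∫⁻ x, k x = ⨆ n : ℕ, ∫⁻ x, min (k x) n := by
    intro k hk
    rw [← lintegral_iSup (fun n => hk.min measurable_const)
      (fun m n hmn x => min_le_min le_rfl (by exact_mod_cast hmn))]
    congr 1 with x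
    simp [← inf_iSup_eq, ENNReal.iSup_natCast]
  have nt : ∀ (k : ℝ → ℝ≥0∞) (n : ℕ) x, min (k x) n ≠ ⊤ := fun k n x =>
    ne_top_of_le_ne_top (ENNReal.natCast_ne_top n) (min_le_right _ _)
  rw [trunc f hf, trunc g hg, ENNReal.iSup_mul]
  simp_rw [ENNReal.mul_iSup]
  have mono : ∀ (k : ℝ → ℝ≥0∞) {m n : ℕ}, m ≤ n →
      ∫⁻ x, min (k x) m ≤ ∫⁻ x, min (k x) n := fun k m n hmn =>
    lintegral_mono fun x => min_le_min le_rfl (by exact_mod_cast hmn)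
  have diag : ∀ n : ℕ, (∫⁻ x, min (f x) n) * ∫⁻ x, min (g x) n ≤ (∫⁻ x, h x) ^ 2 := by
    intro n
    have bd : ∀ k : ℝ → ℝ≥0∞, BddAbove (range fun x => (min (k x) (n : ℝ≥0∞)).toReal) := by
      intro k
      refine ⟨n, ?_⟩
      rintro _ ⟨x, rfl⟩
      exact ENNReal.toReal_le_of_le_ofReal (by positivity) (by simp)
    have key := prekopa_leindler_real_of_bounded
      (f := fun x => (min (f x) (n : ℝ≥0∞)).toReal)
      (g := fun x => (min (g x) (n : ℝ≥0∞)).toReal)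
      (h := fun x => (min (h x) (n : ℝ≥0∞)).toReal)
      (hf.min measurable_const).ennreal_toReal (hg.min measurable_const).ennreal_toReal
      (hh.min measurable_const).ennreal_toReal (fun x => ENNReal.toReal_nonneg)
      (fun x => ENNReal.toReal_nonneg) (fun x => ENNReal.toReal_nonneg) (bd f) (bd g) (by
        intro x y
        rw [← ENNReal.toReal_mul, ← ENNReal.toReal_pow]
        refine ENNReal.toReal_mono (ENNReal.pow_ne_top (nt h n _)) ?_
        rcases le_total (h ((x + y) / 2)) n with hc | hc
        · rw [min_eq_left hc]
          exact (mul_le_mul' (min_le_left _ _) (min_le_left _ _)).trans (H x y)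
        · rw [min_eq_right hc, sq]
          exact mul_le_mul' (min_le_right _ _) (min_le_right _ _))
    simp only [ENNReal.ofReal_toReal (nt _ n _)] at key
    refine key.trans ?_
    gcongr
    exact min_le_left _ _
  exact iSup_le fun m => iSup_le fun n => (mul_le_mul' (mono f (le_max_left m n))
    (mono g (le_max_right m n))).trans (diag (max m n))

/-- Prékopa–Leindler in `ℝ^d`, for midpoints. -/
theorem prekopa_leindler_pi {d : ℕ} {f g h : (Fin d → ℝ) → ℝ≥0∞} (hf : Measurable f)
    (hg : Measurable g) (hh : Measurable h)
    (H : ∀ x y, f x * g y ≤ h ((2⁻¹ : ℝ) • (x + y)) ^ 2) :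
    (∫⁻ x, f x) * ∫⁻ x, g x ≤ (∫⁻ x, h x) ^ 2 := by
  induction d with
  | zero =>
    have hv : (volume : Measure (Fin 0 → ℝ)) univ = 1 := by simp [volume_pi]
    simp only [lintegral_unique, hv, mul_one]
    convert H default default
  | succ d ih =>
    let e := (MeasurableEquiv.piFinSuccAbove (fun _ : Fin (d + 1) => ℝ) 0).symm
    have he : MeasurePreserving e := (volume_preserving_piFinSuccAbove (fun _ => ℝ) 0).symm _
    have split : ∀ k : (Fin (d + 1) → ℝ) → ℝ≥0∞, Measurable k →
        ∫⁻ x, k x = ∫⁻ s, ∫⁻ z, k (e (s, z)) := by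
      intro k hk
      rw [← he.lintegral_comp hk, Measure.volume_eq_prod,
        lintegral_prod (fun z => k (e z)) (hk.comp he.measurable).aemeasurable]
    rw [split f hf, split g hg, split h hh]
    have meas : ∀ k : (Fin (d + 1) → ℝ) → ℝ≥0∞, Measurable k →
        Measurable fun s => ∫⁻ z, k (e (s, z)) := fun k hk =>
      Measurable.lintegral_prod_right' (hk.comp he.measurable)
    -- The integrals over the slices satisfy the one-dimensional hypothesis by induction.
    refine prekopa_leindler_real (meas f hf) (meas g hg) (meas h hh) fun s t => ?_
    refine ih (hf.comp (he.measurable.comp measurable_prodMk_left))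
      (hg.comp (he.measurable.comp measurable_prodMk_left))
      (hh.comp (he.measurable.comp measurable_prodMk_left)) fun x y => ?_
    convert H (e (s, x)) (e (t, y)) using 3
    ext i
    refine Fin.cases ?_ (fun j => ?_) i
    · simp [e, MeasurableEquiv.piFinSuccAbove]
      ring
    · simp [e, MeasurableEquiv.piFinSuccAbove]
      ring

/-- Prékopa–Leindler in Euclidean space, for midpoints. -/
theorem prekopa_leindler_euclidean {d : ℕ} {f g h : Rd d → ℝ≥0∞} (hf : Measurable f)
    (hg : Measurable g) (hh : Measurable h)
    (H : ∀ x y, f x * g y ≤ h ((2⁻¹ : ℝ) • (x + y)) ^ 2) :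
    (∫⁻ x, f x) * ∫⁻ x, g x ≤ (∫⁻ x, h x) ^ 2 := by
  have he : MeasurePreserving (WithLp.toLp 2 : (Fin d → ℝ) → Rd d) :=
    PiLp.volume_preserving_toLp (Fin d)
  rw [← he.lintegral_comp hf, ← he.lintegral_comp hg, ← he.lintegral_comp hh]
  exact prekopa_leindler_pi (hf.comp he.measurable) (hg.comp he.measurable)
    (hh.comp he.measurable) fun x y => H _ _

/-! ### Gaussian property (τ) and the Poincaré inequality on convex sets. -/

theorem one_add_add_sq_sub_le_exp {s : ℝ} (hs : |s| ≤ 1) : 1 + s + s ^ 2 / 2 - |s| ^ 3 ≤ Real.exp s := by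
  have h := (abs_le.1 (Real.exp_bound hs (n := 3) (by norm_num))).1
  simp only [Finset.sum_range_succ, Finset.sum_range_zero, Nat.factorial] at h
  norm_num at h
  nlinarith [pow_nonneg (abs_nonneg s) 3]

/-- The second-order expansion of a property `(τ)` inequality is a Poincaré inequality. -/
theorem integral_sq_le_of_exp_mul_exp_le {Ω : Type*} [MeasurableSpace Ω] (μ : Measure Ω)
    [IsFiniteMeasure μ] {u p : Ω → ℝ} (hu : Measurable u) (hp : Measurable p) {U P c : ℝ}
    (hU : ∀ x, |u x| ≤ U) (hp0 : ∀ x, 0 ≤ p x) (hP : ∀ x, p x ≤ P) (hmean : ∫ x, u x ∂μ = 0)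
    (H : ∀ ε > 0, c * ε < 1 → (∫ x, Real.exp (ε * u x - ε ^ 2 * (1 - c * ε)⁻¹ * p x) ∂μ) *
      (∫ x, Real.exp (-(ε * u x)) ∂μ) ≤ μ.real univ ^ 2) :
    ∫ x, u x ^ 2 ∂μ ≤ ∫ x, p x ∂μ := by
  rcases eq_or_ne μ 0 with rfl | hμ
  · simp
  set m := μ.real univ with hm_def
  have hm : 0 < m := by
    rw [hm_def, measureReal_def]
    exact ENNReal.toReal_pos (by simpa using hμ) (measure_ne_top _ _)
  have : Nonempty Ω := by
    by_contra hne
    rw [not_nonempty_iff] at hne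
    exact hμ (Measure.eq_zero_of_isEmpty μ)
  have hU0 : 0 ≤ U := (abs_nonneg _).trans (hU (Classical.arbitrary Ω))
  have hP0 : 0 ≤ P := (hp0 _).trans (hP (Classical.arbitrary Ω))
  have bdd : ∀ (f : Ω → ℝ) (C : ℝ), Measurable f → (∀ x, |f x| ≤ C) → Integrable f μ :=
    fun f C hf hC => Integrable.of_bound hf.aestronglyMeasurable C (.of_forall hC)
  have iu : Integrable u μ := bdd u U hu hU
  have iu2 : Integrable (fun x => u x ^ 2) μ := bdd _ (U ^ 2) (hu.pow_const 2) fun x => by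
    rw [abs_pow]; exact pow_le_pow_left₀ (abs_nonneg _) (hU x) 2
  have ip : Integrable p μ := bdd p P hp fun x => by rw [abs_of_nonneg (hp0 x)]; exact hP x
  set V := ∫ x, u x ^ 2 ∂μ
  set Q := ∫ x, p x ∂μ
  -- By Taylor expansion the two integrals are at least m + ε²A and m + ε²B; the linear terms drop
  -- out because u has mean zero. The product bound m² gives m(A + B) + ε²AB ≤ 0, whose limit is m(V
  -- - Q) ≤ 0.
  set A : ℝ → ℝ := fun ε => V / 2 - ε * U ^ 3 * m - (1 - c * ε)⁻¹ * Real.exp (ε * U) * Q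
  set B : ℝ → ℝ := fun ε => V / 2 - ε * U ^ 3 * m
  have contA : Filter.Tendsto A (nhdsWithin 0 (Ioi 0)) (nhds (V / 2 - Q)) := by
    have : ContinuousAt A 0 := by
      have : (1 - c * 0 : ℝ) ≠ 0 := by norm_num
      fun_prop (disch := assumption)
    have h := this.tendsto.mono_left (nhdsWithin_le_nhds (s := Ioi 0))
    simpa [A] using h
  have contB : Filter.Tendsto B (nhdsWithin 0 (Ioi 0)) (nhds (V / 2)) := by
    have : ContinuousAt B 0 := by fun_prop
    have h := this.tendsto.mono_left (nhdsWithin_le_nhds (s := Ioi 0))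
    simpa [B] using h
  have contE : Filter.Tendsto (fun ε : ℝ => ε ^ 2) (nhdsWithin 0 (Ioi 0)) (nhds 0) := by
    have : ContinuousAt (fun ε : ℝ => ε ^ 2) 0 := by fun_prop
    have h := this.tendsto.mono_left (nhdsWithin_le_nhds (s := Ioi 0))
    simpa using h
  have small : ∀ a b : ℝ, 0 < b → ∀ᶠ ε in nhdsWithin (0 : ℝ) (Ioi 0), a * ε < b := by
    intro a b hb
    have : ContinuousAt (fun ε : ℝ => a * ε) 0 := by fun_prop
    have h := this.tendsto.mono_left (nhdsWithin_le_nhds (s := Ioi 0))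
    simp only [mul_zero] at h
    exact h.eventually (gt_mem_nhds hb)
  have posA : ∀ᶠ ε in nhdsWithin (0 : ℝ) (Ioi 0), 0 < m + ε ^ 2 * A ε := by
    have h := (contE.mul contA).const_add m
    simp only [zero_mul, add_zero] at h
    exact h.eventually (lt_mem_nhds hm)
  have posB : ∀ᶠ ε in nhdsWithin (0 : ℝ) (Ioi 0), 0 < m + ε ^ 2 * B ε := by
    have h := (contE.mul contB).const_add m
    simp only [zero_mul, add_zero] at h
    exact h.eventually (lt_mem_nhds hm)
  have key : ∀ᶠ ε in nhdsWithin (0 : ℝ) (Ioi 0), m * (A ε + B ε) + ε ^ 2 * A ε * B ε ≤ 0 := by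
    filter_upwards [posA, posB, small c 1 one_pos, small U 1 one_pos, self_mem_nhdsWithin]
      with ε hA hB hc hUε hε
    have hε : 0 < ε := hε
    have hk : 0 < (1 - c * ε)⁻¹ := inv_pos.2 (by linarith)
    set k := (1 - c * ε)⁻¹
    have hs : ∀ x, |ε * u x| ≤ ε * U := fun x => by
      rw [abs_mul, abs_of_pos hε]; exact mul_le_mul_of_nonneg_left (hU x) hε.le
    have hs1 : ∀ x, |ε * u x| ≤ 1 := fun x => (hs x).trans (by linarith)
    have hs3 : ∀ x, |ε * u x| ^ 3 ≤ ε ^ 3 * U ^ 3 := fun x => by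
      rw [← mul_pow]; exact pow_le_pow_left₀ (abs_nonneg _) (hs x) 3
    have e1 : m + ε ^ 2 * A ε ≤ ∫ x, Real.exp (ε * u x - ε ^ 2 * k * p x) ∂μ := by
      have : m + ε ^ 2 * A ε = ∫ x, ((1 - ε ^ 3 * U ^ 3) + ε * u x + ε ^ 2 / 2 * u x ^ 2
          - ε ^ 2 * k * Real.exp (ε * U) * p x) ∂μ := by
        rw [integral_sub, integral_add, integral_add, integral_const_mul, integral_const_mul,
          integral_const_mul, hmean, integral_const]
        · simp only [A, smul_eq_mul]
          ring
        all_goals fun_prop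
      rw [this]
      refine integral_mono (by fun_prop) (bdd _ (Real.exp 1) (by fun_prop) fun x => ?_) fun x => ?_
      · rw [abs_of_pos (Real.exp_pos _), Real.exp_le_exp]
        have := (abs_le.1 (hs1 x)).2
        have : 0 ≤ ε ^ 2 * k * p x := mul_nonneg (by positivity) (hp0 x)
        linarith
      · have h1 := one_add_add_sq_sub_le_exp (hs1 x)
        have h2 := hs3 x
        have h3 : Real.exp (ε * u x) ≤ Real.exp (ε * U) :=
          Real.exp_le_exp.2 ((le_abs_self _).trans (hs x))
        have h4 := Real.add_one_le_exp (-(ε ^ 2 * k * p x))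
        have h5 : 0 ≤ ε ^ 2 * k * p x := mul_nonneg (by positivity) (hp0 x)
        have h8 : Real.exp (ε * u x - ε ^ 2 * k * p x) =
            Real.exp (ε * u x) * Real.exp (-(ε ^ 2 * k * p x)) := by
          rw [sub_eq_add_neg, Real.exp_add]
        have h6 := mul_le_mul_of_nonneg_left h4 (Real.exp_pos (ε * u x)).le
        have h7 := mul_le_mul_of_nonneg_right h3 h5
        simp only [h8]
        nlinarith
    have e2 : m + ε ^ 2 * B ε ≤ ∫ x, Real.exp (-(ε * u x)) ∂μ := by
      have : m + ε ^ 2 * B ε = ∫ x, ((1 - ε ^ 3 * U ^ 3) - ε * u x + ε ^ 2 / 2 * u x ^ 2) ∂μ := by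
        rw [integral_add, integral_sub, integral_const_mul, integral_const_mul, hmean,
          integral_const]
        · simp only [B, smul_eq_mul]
          ring
        all_goals fun_prop
      rw [this]
      refine integral_mono (by fun_prop) (bdd _ (Real.exp 1) (by fun_prop) fun x => ?_) fun x => ?_
      · rw [abs_of_pos (Real.exp_pos _), Real.exp_le_exp]
        exact (neg_le_abs _).trans (hs1 x)
      · have h1 := one_add_add_sq_sub_le_exp (s := -(ε * u x)) (by rw [abs_neg]; exact hs1 x)
        rw [abs_neg] at h1
        have h2 := hs3 x
        simp only
        nlinarith
    have h := H ε hε hc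
    have h' : (m + ε ^ 2 * A ε) * (m + ε ^ 2 * B ε) ≤ m ^ 2 :=
      (mul_le_mul e1 e2 hB.le (hA.le.trans e1)).trans h
    have : ε ^ 2 * (m * (A ε + B ε) + ε ^ 2 * A ε * B ε) ≤ 0 := by nlinarith
    by_contra! hcon
    have := mul_pos (pow_pos hε 2) hcon
    linarith
  have lim := ((contA.add contB).const_mul m).add ((contE.mul contA).mul contB)
  have := le_of_tendsto lim key
  have h2 : m * (V / 2 - Q + V / 2) ≤ 0 := by simpa using this
  have h3 : V / 2 - Q + V / 2 ≤ 0 := by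
    by_contra! hcon
    have := mul_pos hm hcon
    linarith
  linarith

/-- A compactly supported smooth function satisfies a global second-order Taylor bound. -/
theorem exists_taylor_bound {d : ℕ} {u : Rd d → ℝ} (hu : ContDiff ℝ ∞ u) (hc : HasCompactSupport u) :
    ∃ M : ℝ, 0 ≤ M ∧ ∀ x y, |u y - u x - inner ℝ (gradient u x) (y - x)| ≤ M * ‖y - x‖ ^ 2 := by
  obtain ⟨K, hK⟩ : ∃ K, LipschitzWith K (fderiv ℝ u) :=
    ContDiff.lipschitzWith_of_hasCompactSupport (hc.fderiv (𝕜 := ℝ))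
      (hu.fderiv_right (m := 1) (by norm_cast)) one_ne_zero
  refine ⟨K, K.2, fun x y => ?_⟩
  have h := (convex_segment x y).norm_image_sub_le_of_norm_fderiv_le' (𝕜 := ℝ) (f := u)
    (φ := fderiv ℝ u x) (C := K * ‖y - x‖) (x := x) (y := y)
    (fun z _ => (hu.differentiable (by norm_cast)).differentiableAt) (fun z hz => ?_)
    (left_mem_segment _ _ _) (right_mem_segment _ _ _)
  · rw [inner_gradient_left, ← Real.norm_eq_abs]
    calc _ ≤ _ := h
      _ = _ := by ring
  · refine (hK.norm_sub_le z x).trans ?_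
    gcongr
    obtain ⟨t, ht, rfl⟩ := (segment_eq_image' ℝ x y ▸ hz : z ∈ _)
    simp only [add_sub_cancel_left, norm_smul, Real.norm_eq_abs, abs_of_nonneg ht.1]
    exact mul_le_of_le_one_left (norm_nonneg _) ht.2

theorem continuous_gradient {d : ℕ} {u : Rd d → ℝ} (hu : ContDiff ℝ ∞ u) :
    Continuous (gradient u) :=
  (InnerProductSpace.toDual ℝ (Rd d)).symm.continuous.comp (hu.continuous_fderiv (by norm_cast))

theorem hasCompactSupport_gradient {d : ℕ} {u : Rd d → ℝ} (hc : HasCompactSupport u) :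
    HasCompactSupport (gradient u) :=
  (hc.fderiv (𝕜 := ℝ)).comp_left (g := (InnerProductSpace.toDual ℝ (Rd d)).symm) (map_zero _)

/-- The Gaussian density of variance `S` about `y₀`, without normalization. -/
noncomputable def gaussWeight {d : ℕ} (y₀ : Rd d) (S : ℝ) (x : Rd d) : ℝ :=
  Real.exp (-(‖x - y₀‖ ^ 2 / (2 * S)))

/-- Lebesgue measure on `K` with a Gaussian density. -/
noncomputable def gaussOn {d : ℕ} (K : Set (Rd d)) (y₀ : Rd d) (S : ℝ) : Measure (Rd d) :=
  (volume.restrict K).withDensity fun x => ENNReal.ofReal (gaussWeight y₀ S x)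

theorem continuous_gaussWeight {d : ℕ} (y₀ : Rd d) (S : ℝ) : Continuous (gaussWeight y₀ S) := by
  unfold gaussWeight
  fun_prop

theorem gaussOn_le {d : ℕ} (K : Set (Rd d)) (y₀ : Rd d) {S : ℝ} (hS : 0 < S) :
    gaussOn K y₀ S ≤ volume.restrict K := by
  refine (withDensity_mono (ae_of_all _ fun x => ?_)).trans_eq withDensity_one
  simp only [Pi.one_apply, ENNReal.ofReal_le_one, gaussWeight, Real.exp_le_one_iff,
    Left.neg_nonpos_iff]
  positivity

/-- Together with `gaussOn_le`, this passes between Gaussian and Lebesgue integrals on K at the cost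
of a single exponential factor. -/
theorem smul_le_gaussOn {d : ℕ} {K : Set (Rd d)} (hK : MeasurableSet K) {y₀ : Rd d} {S R : ℝ}
    (hS : 0 < S) (hKR : K ⊆ Metric.closedBall y₀ R) :
    ENNReal.ofReal (Real.exp (-(R ^ 2 / (2 * S)))) • volume.restrict K ≤ gaussOn K y₀ S := by
  rw [← withDensity_const]
  refine withDensity_mono ((ae_restrict_mem hK).mono fun x hx => ?_)
  refine ENNReal.ofReal_le_ofReal (Real.exp_le_exp.2 (neg_le_neg ?_))
  have : ‖x - y₀‖ ≤ R := mem_closedBall_iff_norm.1 (hKR hx)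
  gcongr

/-- The property `(τ)` of Gaussian measures restricted to convex sets. -/
theorem lintegral_exp_mul_lintegral_exp_le {d : ℕ} {K : Set (Rd d)} (hK : MeasurableSet K)
    (hconv : Convex ℝ K) (y₀ : Rd d) {S : ℝ} (hS : 0 < S) {u : Rd d → ℝ} (hu : ContDiff ℝ ∞ u)
    {M : ℝ} (hM : ∀ x y, |u y - u x - inner ℝ (gradient u x) (y - x)| ≤ M * ‖y - x‖ ^ 2)
    {ε : ℝ} (hε : 0 < ε) (hε' : 4 * S * M * ε < 1) :
    (∫⁻ x, ENNReal.ofReal (Real.exp (ε * u x - ε ^ 2 * (1 - 4 * S * M * ε)⁻¹ *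
        (S * ‖gradient u x‖ ^ 2))) ∂gaussOn K y₀ S) *
      (∫⁻ x, ENNReal.ofReal (Real.exp (-(ε * u x))) ∂gaussOn K y₀ S) ≤ gaussOn K y₀ S univ ^ 2 := by
  have mw : Measurable fun x => ENNReal.ofReal (gaussWeight y₀ S x) :=
    (continuous_gaussWeight y₀ S).measurable.ennreal_ofReal
  have cg := continuous_gradient hu
  have cu := hu.continuous
  set F : Rd d → ℝ≥0∞ := fun x => ENNReal.ofReal (Real.exp (ε * u x -
    ε ^ 2 * (1 - 4 * S * M * ε)⁻¹ * (S * ‖gradient u x‖ ^ 2)))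
  set G : Rd d → ℝ≥0∞ := fun x => ENNReal.ofReal (Real.exp (-(ε * u x)))
  have mF : Measurable F := by
    have : Continuous fun x => Real.exp (ε * u x -
      ε ^ 2 * (1 - 4 * S * M * ε)⁻¹ * (S * ‖gradient u x‖ ^ 2)) := by fun_prop
    exact this.measurable.ennreal_ofReal
  have mG : Measurable G := by
    have : Continuous fun x => Real.exp (-(ε * u x)) := by fun_prop
    exact this.measurable.ennreal_ofReal
  have conv : ∀ k : Rd d → ℝ≥0∞, Measurable k → ∫⁻ x, k x ∂gaussOn K y₀ S =
      ∫⁻ x, K.indicator (fun x => ENNReal.ofReal (gaussWeight y₀ S x) * k x) x := by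
    intro k hk
    rw [gaussOn, lintegral_withDensity_eq_lintegral_mul _ mw hk, lintegral_indicator hK]
    rfl
  have h1 : gaussOn K y₀ S univ = ∫⁻ x, K.indicator
      (fun x => ENNReal.ofReal (gaussWeight y₀ S x) * 1) x := by
    rw [← conv _ measurable_const, lintegral_one]
  rw [conv F mF, conv G mG, h1]
  refine prekopa_leindler_euclidean ((mw.mul mF).indicator hK) ((mw.mul mG).indicator hK)
    ((mw.mul measurable_const).indicator hK) fun x y => ?_
  by_cases hx : x ∈ K
  swap
  · simp [hx]
  by_cases hy : y ∈ K
  swap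
  · simp [hy]
  have hxy : (2⁻¹ : ℝ) • (x + y) ∈ K := by
    rw [smul_add]
    exact hconv hx hy (by norm_num) (by norm_num) (by norm_num)
  simp only [indicator_of_mem hx, indicator_of_mem hy, indicator_of_mem hxy, F, G, gaussWeight,
    mul_one]
  rw [← ENNReal.ofReal_mul (Real.exp_pos _).le, ← ENNReal.ofReal_mul (Real.exp_pos _).le,
    ← ENNReal.ofReal_mul (mul_nonneg (Real.exp_pos _).le (Real.exp_pos _).le),
    ← ENNReal.ofReal_pow (Real.exp_pos _).le, ← Real.exp_add, ← Real.exp_add, ← Real.exp_add,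
    ← Real.exp_nat_mul]
  refine ENNReal.ofReal_le_ofReal (Real.exp_le_exp.2 ?_)
  set p := ‖gradient u x‖
  set q := ‖y - x‖
  -- The squared Gaussian density at the midpoint exceeds the product of the densities at x and y by
  -- exp(q²/(4S)). This gain pays for the difference u x - u y.
  have hpar : ‖x - y₀‖ ^ 2 + ‖y - y₀‖ ^ 2 = 2 * ‖(2⁻¹ : ℝ) • (x + y) - y₀‖ ^ 2 + q ^ 2 / 2 := by
    have e1 : x - y₀ = ((2⁻¹ : ℝ) • (x + y) - y₀) - (2⁻¹ : ℝ) • (y - x) := by module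
    have e2 : y - y₀ = ((2⁻¹ : ℝ) • (x + y) - y₀) + (2⁻¹ : ℝ) • (y - x) := by module
    have := parallelogram_law_with_norm ℝ ((2⁻¹ : ℝ) • (x + y) - y₀) ((2⁻¹ : ℝ) • (y - x))
    have hhalf : ‖(2⁻¹ : ℝ) • (y - x)‖ = q / 2 := by
      rw [norm_smul, Real.norm_of_nonneg (by norm_num)]
      ring
    rw [← e1, ← e2, hhalf] at this
    linarith
  have hin : |inner ℝ (gradient u x) (y - x)| ≤ p * q := abs_real_inner_le_norm _ _
  have h2 := (abs_le.1 (hM x y)).1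
  have h3 := (abs_le.1 hin).1
  set k := 1 - 4 * S * M * ε
  have hk : 0 < k := by simp only [k]; linarith
  have hux : ε * (u x - u y) ≤ ε * (p * q + M * q ^ 2) :=
    mul_le_mul_of_nonneg_left (by linarith) hε.le
  -- Only the fraction k of the gain is spent here; the rest absorbs the Taylor remainder ε M q².
  -- Hence the factor (1 - 4SMε)⁻¹ in the statement.
  have amgm : ε * (p * q) ≤ ε ^ 2 * k⁻¹ * (S * p ^ 2) + k * q ^ 2 / (4 * S) := by
    have : ε ^ 2 * k⁻¹ * (S * p ^ 2) + k * q ^ 2 / (4 * S) - ε * (p * q)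
        = (2 * S * ε * p - k * q) ^ 2 / (4 * S * k) := by
      field_simp
      ring
    have h0 : 0 ≤ (2 * S * ε * p - k * q) ^ 2 / (4 * S * k) := by positivity
    linarith
  have hk2 : k * q ^ 2 / (4 * S) = q ^ 2 / (4 * S) - ε * (M * q ^ 2) := by
    simp only [k]
    field_simp
  have hpar2 : ‖x - y₀‖ ^ 2 / (2 * S) + ‖y - y₀‖ ^ 2 / (2 * S) =
      2 * (‖(2⁻¹ : ℝ) • (x + y) - y₀‖ ^ 2 / (2 * S)) + q ^ 2 / (4 * S) := by
    rw [← add_div, hpar]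
    field_simp
    ring
  push_cast
  linarith

/-- A dimension-free Poincaré inequality on bounded convex sets. -/
theorem exists_poincare_of_contDiff {d : ℕ} {K : Set (Rd d)} (hK : MeasurableSet K)
    (hconv : Convex ℝ K) {y₀ : Rd d} {R : ℝ} (hR : 0 < R) (hKR : K ⊆ Metric.closedBall y₀ R)
    {u : Rd d → ℝ} (hu : ContDiff ℝ ∞ u) (hc : HasCompactSupport u) :
    ∃ m : ℝ, ∫ x in K, (u x - m) ^ 2 ≤ Real.exp 1 / 2 * R ^ 2 * ∫ x in K, ‖gradient u x‖ ^ 2 := by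
  -- The Gaussian Poincaré constant is S and the density on K is at least exp(-R²/(2S)); this S
  -- minimizes S exp(R²/(2S)).
  set S := R ^ 2 / 2 with hS_def
  have hS : 0 < S := by positivity
  set μ := gaussOn K y₀ S
  have hfin : volume K < ⊤ := (measure_mono hKR).trans_lt measure_closedBall_lt_top
  have : IsFiniteMeasure (volume.restrict K) := ⟨by simpa using hfin⟩
  have : IsFiniteMeasure μ := ⟨(gaussOn_le K y₀ hS univ).trans_lt (measure_lt_top _ _)⟩
  obtain ⟨U, hU⟩ := hc.exists_bound_of_continuous hu.continuous
  obtain ⟨P, hP⟩ := (hasCompactSupport_gradient hc).exists_bound_of_continuous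
    (continuous_gradient hu)
  obtain ⟨M, hM0, hM⟩ := exists_taylor_bound hu hc
  have cg := continuous_gradient hu
  have cu := hu.continuous
  set m : ℝ := ⨍ x, u x ∂μ
  refine ⟨m, ?_⟩
  have iu : Integrable u μ := Integrable.of_bound cu.aestronglyMeasurable U (.of_forall hU)
  have key : ∫ x, (u x - m) ^ 2 ∂μ ≤ ∫ x, S * ‖gradient u x‖ ^ 2 ∂μ := by
    refine integral_sq_le_of_exp_mul_exp_le μ (U := U + |m|) (P := S * P ^ 2) (c := 4 * S * M)
      (by fun_prop) (by fun_prop) (fun x => ?_) (fun x => by positivity) (fun x => ?_)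
      (integral_sub_average μ u) fun ε hε hε' => ?_
    · exact (abs_sub _ _).trans (add_le_add_left (hU x) _)
    · have := hP x
      gcongr
    · have hg : ∀ x, gradient (fun x => u x - m) x = gradient u x := fun x => by
        simp [gradient, fderiv_sub_const]
      have h := lintegral_exp_mul_lintegral_exp_le hK hconv y₀ hS (u := fun x => u x - m) (M := M)
        (hu.sub contDiff_const) (by
          intro x y
          rw [hg]
          convert hM x y using 2
          ring) hε hε'
      simp only [hg] at h
      have h' := ENNReal.toReal_mono (by finiteness) h
      rw [ENNReal.toReal_mul, ENNReal.toReal_pow] at h'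
      rw [integral_eq_lintegral_of_nonneg_ae (.of_forall fun x => (Real.exp_pos _).le),
        integral_eq_lintegral_of_nonneg_ae (.of_forall fun x => (Real.exp_pos _).le)]
      · exact h'
      all_goals
        refine Continuous.aestronglyMeasurable ?_
        fun_prop
  have int2 : ∀ k : Rd d → ℝ, Continuous k → (∃ C, ∀ x, |k x| ≤ C) →
      Integrable k (volume.restrict K) := fun k hk ⟨C, hC⟩ =>
    Integrable.of_bound hk.aestronglyMeasurable C (.of_forall hC)
  have iu2 : Integrable (fun x => (u x - m) ^ 2) (volume.restrict K) := by
    refine int2 _ (by fun_prop) ⟨(U + |m|) ^ 2, fun x => ?_⟩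
    rw [abs_pow]
    exact pow_le_pow_left₀ (abs_nonneg _) ((abs_sub _ _).trans (add_le_add_left (hU x) _)) 2
  have ig : Integrable (fun x => S * ‖gradient u x‖ ^ 2) (volume.restrict K) := by
    refine int2 _ (by fun_prop) ⟨S * P ^ 2, fun x => ?_⟩
    rw [abs_of_nonneg (by positivity)]
    have := hP x
    gcongr
  have hle := gaussOn_le K y₀ hS
  have lower : Real.exp (-1) * ∫ x in K, (u x - m) ^ 2 ≤ ∫ x, (u x - m) ^ 2 ∂μ := by
    have h := integral_mono_measure (smul_le_gaussOn hK hS hKR)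
      (.of_forall fun x => sq_nonneg (u x - m)) (iu2.mono_measure hle)
    rw [integral_smul_measure, ENNReal.toReal_ofReal (Real.exp_pos _).le, smul_eq_mul,
      show R ^ 2 / (2 * S) = 1 by rw [hS_def]; field_simp] at h
    exact h
  have upper : ∫ x, S * ‖gradient u x‖ ^ 2 ∂μ ≤ ∫ x in K, S * ‖gradient u x‖ ^ 2 :=
    integral_mono_measure hle (.of_forall fun x => by positivity) ig
  rw [integral_const_mul] at upper key
  calc ∫ x in K, (u x - m) ^ 2
      = Real.exp 1 * (Real.exp (-1) * ∫ x in K, (u x - m) ^ 2) := by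
        rw [← mul_assoc, ← Real.exp_add]; norm_num
    _ ≤ Real.exp 1 * (S * ∫ x in K, ‖gradient u x‖ ^ 2) := by
        refine mul_le_mul_of_nonneg_left (lower.trans (key.trans ?_)) (Real.exp_pos _).le
        rwa [integral_const_mul] at upper
    _ = _ := by rw [hS_def]; ring

/-! ### Mollification of Lipschitz functions. -/

open Convolution in
/-- A Lipschitz function is uniformly close to a smooth one with the same Lipschitz constant. -/
theorem LipschitzWith.exists_contDiff_approx {E : Type*} [NormedAddCommGroup E]
    [InnerProductSpace ℝ E] [FiniteDimensional ℝ E] {f : E → ℝ} {K : NNReal}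
    (hf : LipschitzWith K f) {ε : ℝ} (hε : 0 < ε) :
    ∃ g : E → ℝ, ContDiff ℝ ∞ g ∧ LipschitzWith K g ∧ (∀ x, |g x - f x| ≤ K * ε) ∧
      ∀ x, (∀ y ∈ Metric.ball x ε, f y = f x) → g x = f x := by
  borelize E
  let μ : Measure E := Measure.addHaar
  let φ : ContDiffBump (0 : E) := ⟨ε / 2, ε, by positivity, by linarith⟩
  have loc : LocallyIntegrable f μ := hf.continuous.locallyIntegrable
  have hcs : HasCompactSupport (φ.normed μ) := φ.hasCompactSupport_normed
  have ex : ∀ x, Integrable (fun t => φ.normed μ t * f (x - t)) μ := fun x =>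
    hcs.convolutionExists_left (ContinuousLinearMap.lsmul ℝ ℝ)
      (φ.continuous_normed (μ := μ)) loc x
  have val : ∀ x, (φ.normed μ ⋆[ContinuousLinearMap.lsmul ℝ ℝ, μ] f) x =
      ∫ t, φ.normed μ t * f (x - t) ∂μ := fun x => rfl
  refine ⟨φ.normed μ ⋆[ContinuousLinearMap.lsmul ℝ ℝ, μ] f,
    hcs.contDiff_convolution_left _ φ.contDiff_normed loc, ?_, ?_, ?_⟩
  -- The convolution averages translates of f, all with the same Lipschitz constant, against a
  -- probability density.
  · refine LipschitzWith.of_dist_le_mul fun x y => ?_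
    rw [Real.dist_eq, val, val, ← integral_sub (ex x) (ex y)]
    calc |∫ t, (φ.normed μ t * f (x - t) - φ.normed μ t * f (y - t)) ∂μ|
        ≤ ∫ t, φ.normed μ t * (K * dist x y) ∂μ := by
          rw [← Real.norm_eq_abs]
          refine norm_integral_le_of_norm_le ((φ.integrable_normed (μ := μ)).mul_const _) (.of_forall fun t => ?_)
          rw [← mul_sub, norm_mul, Real.norm_of_nonneg (φ.nonneg_normed t)]
          refine mul_le_mul_of_nonneg_left ?_ (φ.nonneg_normed t)
          have := hf.dist_le_mul (x - t) (y - t)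
          rwa [dist_sub_right, Real.dist_eq] at this
      _ = K * dist x y := by rw [integral_mul_const, φ.integral_normed, one_mul]
  · intro x
    have := φ.dist_normed_convolution_le (μ := μ) (g := f) (x₀ := x) (ε := K * ε)
      hf.continuous.aestronglyMeasurable fun y hy => (hf.dist_le_mul y x).trans
        (mul_le_mul_of_nonneg_left (Metric.mem_ball.1 hy).le K.2)
    rwa [Real.dist_eq] at this
  · intro x hx
    exact φ.normed_convolution_eq_right (μ := μ) hx

theorem norm_gradient_le_of_lipschitzWith {d : ℕ} {f : Rd d → ℝ} {K : NNReal}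
    (hf : LipschitzWith K f) (x : Rd d) : ‖gradient f x‖ ≤ K := by
  rw [gradient, LinearIsometryEquiv.norm_map]
  exact norm_fderiv_le_of_lipschitz ℝ hf

/-! ### The distance to the boundary of a convex set. -/

/-- `Metric.infDist` to the empty set is 0 by convention, so the distance to the complement is
meaningful only when there is a complement. -/
theorem nonempty_compl_of_isBounded {d : ℕ} (hd : 0 < d) {s : Set (Rd d)}
    (hs : Bornology.IsBounded s) : sᶜ.Nonempty := by
  have : Nontrivial (Rd d) := by
    have : Nonempty (Fin d) := ⟨⟨0, hd⟩⟩
    infer_instance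
  rw [nonempty_compl]
  rintro rfl
  exact NoncompactSpace.noncompact_univ (X := Rd d)
    (Metric.isCompact_of_isClosed_isBounded isClosed_univ hs)

/-- Dilating a convex set towards the centre of an inscribed ball moves it away from the boundary. -/
theorem homothety_image_subset {d : ℕ} {τ : Set (Rd d)} (hconv : Convex ℝ τ) (hne : τᶜ.Nonempty)
    {y : Rd d} {ρ : ℝ} (hball : Metric.ball y ρ ⊆ τ) {t : ℝ} (ht0 : 0 ≤ t) (ht1 : t < 1) :
    AffineMap.homothety y t '' τ ⊆ {x | (1 - t) * ρ ≤ Metric.infDist x τᶜ} := by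
  rintro _ ⟨w, hw, rfl⟩
  refine (Metric.le_infDist hne).2 fun z hz => ?_
  by_contra! hlt
  refine hz ?_
  rw [AffineMap.homothety_apply, vsub_eq_sub, vadd_eq_add, dist_eq_norm] at hlt
  have h1 : 0 < 1 - t := by linarith
  -- This v writes z as the convex combination t • w + (1 - t) • (y + v); if z is too close to the
  -- dilated point, then y + v falls in the inscribed ball and z in τ.
  set v := (1 - t)⁻¹ • (z - (t • (w - y) + y))
  have hv : y + v ∈ Metric.ball y ρ := by
    rw [mem_ball_iff_norm, add_sub_cancel_left, norm_smul, Real.norm_of_nonneg (by positivity),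
      inv_mul_lt_iff₀ h1, norm_sub_rev]
    exact hlt
  have := hconv hw (hball hv) ht0 h1.le (by ring)
  convert this using 1
  simp only [v, smul_add, smul_smul, mul_inv_cancel₀ h1.ne']
  module

/-- The boundary layer misses the copy of τ shrunk by the factor t about y, which has volume t^d
times that of τ. -/
theorem volume_lt_infDist_le {d : ℕ} {τ : Set (Rd d)} (hopen : IsOpen τ) (hconv : Convex ℝ τ)
    (hb : Bornology.IsBounded τ) (hne : τᶜ.Nonempty) {y : Rd d} {ρ : ℝ} (hρ : 0 < ρ)
    (hball : Metric.ball y ρ ⊆ τ) {t : ℝ} (ht0 : 0 ≤ t) (ht1 : t < 1) :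
    volume.restrict τ {x | Metric.infDist x τᶜ < (1 - t) * ρ} ≤
      ENNReal.ofReal ((1 - t ^ d) * volume.real τ) := by
  have hfin : volume τ ≠ ⊤ := hb.measure_lt_top.ne
  set A := AffineMap.homothety y t '' τ
  have hA : volume A = ENNReal.ofReal (t ^ d * volume.real τ) := by
    rw [Measure.addHaar_image_homothety, abs_of_nonneg (pow_nonneg ht0 _), finrank_euclideanSpace,
      Fintype.card_fin, ENNReal.ofReal_mul (pow_nonneg ht0 _), ofReal_measureReal hfin]
  have hAτ : A ⊆ τ := by
    rintro _ ⟨w, hw, rfl⟩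
    have := hconv hw (hball (Metric.mem_ball_self hρ)) ht0 (sub_nonneg.2 ht1.le) (by ring)
    convert this using 1
    rw [AffineMap.homothety_apply, vsub_eq_sub, vadd_eq_add]
    module
  rw [Measure.restrict_apply' hopen.measurableSet]
  calc volume ({x | Metric.infDist x τᶜ < (1 - t) * ρ} ∩ τ) ≤ volume (τ \ A) := by
        refine measure_mono fun x ⟨hx, hxτ⟩ => ⟨hxτ, fun hxA => ?_⟩
        have h : (1 - t) * ρ ≤ _ := homothety_image_subset hconv hne hball ht0 ht1 hxA
        exact absurd h (not_le.2 hx)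
    _ = volume τ - volume A :=
        measure_sdiff hAτ ((hconv.affine_image _).nullMeasurableSet volume)
          (ne_top_of_le_ne_top hfin (measure_mono hAτ))
    _ = _ := by
        rw [hA, ← ofReal_measureReal hfin, ← ENNReal.ofReal_sub _ (by positivity)]
        congr 1
        ring

/-- The capped normalized distance to the boundary of a convex set is close to `1` in `L²`. -/
theorem integral_one_sub_infDist_sq_le {d : ℕ} {τ : Set (Rd d)} (hopen : IsOpen τ)
    (hconv : Convex ℝ τ) (hb : Bornology.IsBounded τ) (hne : τᶜ.Nonempty) {y : Rd d} {ρ : ℝ}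
    (hρ : 0 < ρ) (hball : Metric.ball y ρ ⊆ τ) :
    ∫ x in τ, (1 - min (Metric.infDist x τᶜ) ρ / ρ) ^ 2 ≤ d / (d + 2) * volume.real τ := by
  set V := volume.real τ
  have hV : 0 ≤ V := measureReal_nonneg
  set f : Rd d → ℝ := fun x => 1 - min (Metric.infDist x τᶜ) ρ / ρ
  have f0 : ∀ x, 0 ≤ f x := fun x => by
    simp only [f, sub_nonneg]
    exact (div_le_one hρ).2 (min_le_right _ _)
  have f1 : ∀ x, f x ≤ 1 := fun x => by
    simp only [f, sub_le_self_iff]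
    exact div_nonneg (le_min Metric.infDist_nonneg hρ.le) hρ.le
  have fc : Continuous f := by
    have := Metric.continuous_infDist_pt τᶜ
    fun_prop
  have level : ∀ t ∈ Ioo (0 : ℝ) 1, volume.restrict τ {x | t < f x} ≤
      ENNReal.ofReal ((1 - t ^ d) * V) := by
    rintro t ⟨ht0, ht1⟩
    refine le_trans (measure_mono fun x hx => ?_)
      (volume_lt_infDist_le hopen hconv hb hne hρ hball ht0.le ht1)
    have hx : t < 1 - min (Metric.infDist x τᶜ) ρ / ρ := hx
    rw [lt_sub_comm, div_lt_iff₀ hρ] at hx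
    rcases min_lt_iff.1 hx with h | h
    · exact h
    · nlinarith
  have hint : ∫⁻ x in τ, ENNReal.ofReal (f x ^ (2 : ℝ)) ≤ ENNReal.ofReal (d / (d + 2) * V) := by
    -- By the layer cake formula for squares, d/(d + 2) arises as the integral of 2t(1 - t^d) over
    -- (0, 1).
    rw [lintegral_rpow_eq_lintegral_meas_lt_mul _ (.of_forall f0) fc.aemeasurable two_pos,
      ← Ioo_union_Ici_eq_Ioi (zero_lt_one' ℝ)]
    have h2 : ∫⁻ t in Ici (1 : ℝ), (volume.restrict τ) {x | t < f x} *
        ENNReal.ofReal (t ^ ((2 : ℝ) - 1)) = 0 := by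
      refine setLIntegral_eq_zero measurableSet_Ici fun t ht => ?_
      have : {x | t < f x} = ∅ := by
        ext x
        simpa using (f1 x).trans ht
      simp [this]
    have h1 : ∫⁻ t in Ioo (0 : ℝ) 1, (volume.restrict τ) {x | t < f x} *
        ENNReal.ofReal (t ^ ((2 : ℝ) - 1)) ≤ ENNReal.ofReal (d / (d + 2) / 2 * V) := by
      calc _ ≤ ∫⁻ t in Ioo (0 : ℝ) 1, ENNReal.ofReal ((1 - t ^ d) * V * t) := by
            refine setLIntegral_mono' measurableSet_Ioo fun t ht => ?_
            rw [ENNReal.ofReal_mul (mul_nonneg (sub_nonneg.2 (pow_le_one₀ ht.1.le ht.2.le)) hV)]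
            refine mul_le_mul' (level t ht) ?_
            norm_num
        _ = ENNReal.ofReal (∫ t in Ioo (0 : ℝ) 1, (1 - t ^ d) * V * t) := by
            rw [ofReal_integral_eq_lintegral_ofReal]
            · refine Continuous.integrableOn_Ioc (a := (0 : ℝ)) (b := 1) ?_ |>.mono_set
                Ioo_subset_Ioc_self
              fun_prop
            · filter_upwards [ae_restrict_mem measurableSet_Ioo] with t ht
              exact mul_nonneg (mul_nonneg (sub_nonneg.2 (pow_le_one₀ ht.1.le ht.2.le)) hV) ht.1.le
        _ = ENNReal.ofReal (d / (d + 2) / 2 * V) := by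
            congr 1
            rw [← integral_Ioc_eq_integral_Ioo, ← intervalIntegral.integral_of_le zero_le_one]
            have : ∀ t : ℝ, (1 - t ^ d) * V * t = V * (t - t ^ (d + 1)) := fun t => by ring
            simp_rw [this]
            rw [intervalIntegral.integral_const_mul, intervalIntegral.integral_sub (by simp)
              (by simp), integral_id, integral_pow]
            push_cast
            field_simp
            ring
    calc _ ≤ ENNReal.ofReal 2 * (ENNReal.ofReal (d / (d + 2) / 2 * V) + 0) := by
          gcongr
          refine (lintegral_union_le _ _ _).trans ?_
          rw [h2]
          exact add_le_add h1 le_rfl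
      _ = _ := by
          rw [add_zero, ← ENNReal.ofReal_mul zero_le_two]
          congr 1
          ring
  rw [integral_eq_lintegral_of_nonneg_ae (.of_forall fun x => sq_nonneg _)
    (by fun_prop : Continuous fun x => f x ^ 2).aestronglyMeasurable]
  refine ENNReal.toReal_le_of_le_ofReal (by positivity) ?_
  simp only [Real.rpow_two] at hint
  exact hint

/-- The capped distance to the boundary is a uniform limit of `1`-Lipschitz test functions. -/
theorem exists_isTestFun_approx_infDist {d : ℕ} {τ : Set (Rd d)}
    (hb : Bornology.IsBounded τ) {ρ : ℝ} {ε : ℝ} (hε : 0 < ε) :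
    ∃ f : Rd d → ℝ, IsTestFun τ f ∧ (∀ x, ‖gradient f x‖ ≤ 1) ∧
      ∀ x, |f x - max (min (Metric.infDist x τᶜ) ρ) 0| ≤ 3 * ε := by
  set D : Rd d → ℝ := fun x => Metric.infDist x τᶜ
  have hD : LipschitzWith 1 D := Metric.lipschitz_infDist_pt _
  -- Lowering by 2ε before mollifying at scale ε keeps the support at distance ε from the
  -- complement. The total error is 2ε + ε.
  have hf0 : LipschitzWith 1 fun x => max (min (D x) ρ - 2 * ε) 0 := by
    refine LipschitzWith.max_const (LipschitzWith.of_dist_le_mul fun x y => ?_) 0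
    have := (hD.min_const ρ).dist_le_mul x y
    simpa [dist_sub_right] using this
  obtain ⟨f, fs, fL, fa, fz⟩ := hf0.exists_contDiff_approx hε
  have hsupp : tsupport f ⊆ {x | ε ≤ D x} := by
    refine closure_minimal (fun x hx => ?_) (isClosed_le continuous_const hD.continuous)
    by_contra hlt
    rw [mem_ofPred_eq, not_le] at hlt
    have hz : ∀ y ∈ Metric.ball x ε, max (min (D y) ρ - 2 * ε) 0 = 0 := by
      intro y hy
      have h1 := hD.dist_le_mul y x
      rw [NNReal.coe_one, one_mul, Real.dist_eq] at h1
      have h2 := (abs_le.1 h1).2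
      have h3 := Metric.mem_ball.1 hy
      have h4 := min_le_left (D y) ρ
      exact max_eq_right (by linarith)
    refine hx ?_
    have hxx := hz x (Metric.mem_ball_self hε)
    rw [fz x fun y hy => by rw [hz y hy, hxx], hxx]
  have hτ : {x | ε ≤ D x} ⊆ τ := fun x hx => by
    by_contra hxτ
    have : D x = 0 := Metric.infDist_zero_of_mem hxτ
    rw [mem_ofPred_eq, this] at hx
    linarith
  refine ⟨f, ⟨fs, ?_, hsupp.trans hτ⟩, fun x => by
    simpa using norm_gradient_le_of_lipschitzWith fL x, fun x => ?_⟩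
  · exact Metric.isCompact_of_isClosed_isBounded (isClosed_tsupport f)
      (hb.subset (hsupp.trans hτ))
  · have h1 := fa x
    rw [NNReal.coe_one, one_mul] at h1
    have h2 : |max (min (D x) ρ - 2 * ε) 0 - max (min (D x) ρ) 0| ≤ 2 * ε := by
      refine (abs_max_sub_max_le_max _ _ _ _).trans ?_
      simp only [sub_sub_cancel_left, sub_self, abs_zero, abs_neg]
      rw [abs_of_pos (by positivity)]
      exact max_le le_rfl (by positivity)
    calc _ ≤ _ := abs_sub_le _ (max (min (D x) ρ - 2 * ε) 0) _
      _ ≤ ε + 2 * ε := add_le_add h1 h2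
      _ = _ := by ring

/-! ### Test functions and closure properties of `H_0^1(D)`. -/

theorem gradient_mul_apply {d : ℕ} {u v : Rd d → ℝ} (hu : ContDiff ℝ ∞ u) (hv : ContDiff ℝ ∞ v)
    (x : Rd d) : gradient (fun y => u y * v y) x = u x • gradient v x + v x • gradient u x := by
  simp only [gradient]
  rw [fderiv_fun_mul (hu.differentiable (by norm_cast)).differentiableAt
    (hv.differentiable (by norm_cast)).differentiableAt, map_add, map_smul, map_smul]

theorem gradient_add_const_mul_apply {d : ℕ} {u v : Rd d → ℝ} (hu : ContDiff ℝ ∞ u)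
    (hv : ContDiff ℝ ∞ v) (s : ℝ) (x : Rd d) :
    gradient (fun y => u y + s * v y) x = gradient u x + s • gradient v x := by
  simp only [gradient]
  rw [fderiv_fun_add (hu.differentiable (by norm_cast)).differentiableAt
    ((hv.differentiable (by norm_cast)).differentiableAt.const_mul s), fderiv_const_mul
    (hv.differentiable (by norm_cast)).differentiableAt, map_add, map_smul]

namespace IsTestFun

variable {d : ℕ} {D : Set (Rd d)} {u v : Rd d → ℝ}

theorem mono {D' : Set (Rd d)} (hu : IsTestFun D u) (h : D ⊆ D') : IsTestFun D' u :=
  ⟨hu.smooth, hu.compact, hu.support.trans h⟩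

theorem add_const_mul (hu : IsTestFun D u) (hv : IsTestFun D v) (s : ℝ) :
    IsTestFun D fun x => u x + s * v x where
  smooth := hu.smooth.add (contDiff_const.mul hv.smooth)
  compact := hu.compact.add hv.compact.mul_left
  support := (tsupport_add u fun x => s * v x).trans (union_subset hu.support
    ((tsupport_mul_subset_right (f := fun _ => s) (g := v)).trans hv.support))

theorem smooth_mul (hu : IsTestFun D u) {η : Rd d → ℝ} (hη : ContDiff ℝ ∞ η) :
    IsTestFun D fun x => η x * u x where
  smooth := hη.mul hu.smooth
  compact := hu.compact.mul_left
  support := (tsupport_mul_subset_right (f := η) (g := u)).trans hu.support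

theorem eq_zero (hu : IsTestFun D u) {x : Rd d} (hx : x ∉ D) : u x = 0 :=
  image_eq_zero_of_notMem_tsupport fun h => hx (hu.support h)

theorem gradient_eq_zero (hu : IsTestFun D u) {x : Rd d} (hx : x ∉ D) : gradient u x = 0 := by
  have : fderiv ℝ u x = 0 :=
    image_eq_zero_of_notMem_tsupport fun h => hx (hu.support (tsupport_fderiv_subset ℝ h))
  rw [gradient, this, map_zero]

theorem memLp (hu : IsTestFun D u) (p : ℝ≥0∞) (μ : Measure (Rd d)) [IsFiniteMeasureOnCompacts μ] :
    MemLp u p μ := hu.smooth.continuous.memLp_of_hasCompactSupport hu.compact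

theorem memLp_gradient (hu : IsTestFun D u) (p : ℝ≥0∞) (μ : Measure (Rd d))
    [IsFiniteMeasureOnCompacts μ] : MemLp (gradient u) p μ :=
  (continuous_gradient hu.smooth).memLp_of_hasCompactSupport (hasCompactSupport_gradient hu.compact)

theorem hasWeakGradient (hu : IsTestFun D u) : HasWeakGradient D u (gradient u) := by
  intro φ hφ
  -- Both integrands vanish off D, so the integration by parts takes place on the whole space and
  -- needs no regularity of D.
  have e1 : ∀ x ∉ D, u x • gradient φ x = 0 := fun x hx => by rw [hu.eq_zero hx, zero_smul]
  have e2 : ∀ x ∉ D, φ x • gradient u x = 0 := fun x hx => by rw [hφ.eq_zero hx, zero_smul]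
  rw [setIntegral_eq_integral_of_forall_compl_eq_zero e1,
    setIntegral_eq_integral_of_forall_compl_eq_zero e2]
  have cu := hu.smooth.continuous
  have cφ := hφ.smooth.continuous
  have gu := continuous_gradient hu.smooth
  have gφ := continuous_gradient hφ.smooth
  have i1 : Integrable (fun x => u x • gradient φ x) :=
    (by fun_prop : Continuous fun x => u x • gradient φ x).integrable_of_hasCompactSupport
      hu.compact.smul_right
  have i2 : Integrable (fun x => φ x • gradient u x) :=
    (by fun_prop : Continuous fun x => φ x • gradient u x).integrable_of_hasCompactSupport
      hφ.compact.smul_right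
  refine ext_inner_left ℝ fun w => ?_
  rw [inner_neg_right, ← integral_inner i1, ← integral_inner i2]
  have j1 := i1.const_inner (𝕜 := ℝ) w
  have j2 := i2.const_inner (𝕜 := ℝ) w
  simp only [inner_smul_right, inner_gradient_right, conj_trivial] at j1 j2 ⊢
  rw [integral_mul_fderiv_eq_neg_fderiv_mul_of_integrable]
  · simp_rw [mul_comm]
  · simpa only [mul_comm] using j2
  · exact j1
  · exact (cu.mul cφ).integrable_of_hasCompactSupport hu.compact.mul_right
  · exact fun x _ => (hu.smooth.differentiable (by norm_cast)).differentiableAt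
  · exact fun x _ => (hφ.smooth.differentiable (by norm_cast)).differentiableAt

end IsTestFun

namespace MemH10

variable {d : ℕ} {D : Set (Rd d)} {u v : Rd d → ℝ} {G H : Rd d → Rd d}

theorem of_isTestFun (hu : IsTestFun D u) : MemH10 D u (gradient u) where
  memLp := hu.memLp _ _
  memLp_grad := hu.memLp_gradient _ _
  weakGrad := hu.hasWeakGradient
  approx ε _ := ⟨u, hu, by simp, by simp⟩

theorem exists_seq (hu : MemH10 D u G) : ∃ φ : ℕ → Rd d → ℝ, (∀ n, IsTestFun D (φ n)) ∧
    Filter.Tendsto (fun n => eLpNorm (fun x => u x - φ n x) 2 (volume.restrict D)) Filter.atTop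
      (nhds 0) ∧
    Filter.Tendsto (fun n => eLpNorm (fun x => G x - gradient (φ n) x) 2 (volume.restrict D))
      Filter.atTop (nhds 0) := by
  choose φ h1 h2 h3 using fun n : ℕ => hu.approx ((n : ℝ≥0∞)⁻¹) (by simp)
  exact ⟨φ, h1, tendsto_of_tendsto_of_tendsto_of_le_of_le tendsto_const_nhds
      ENNReal.tendsto_inv_nat_nhds_zero (fun _ => zero_le) h2,
    tendsto_of_tendsto_of_tendsto_of_le_of_le tendsto_const_nhds
      ENNReal.tendsto_inv_nat_nhds_zero (fun _ => zero_le) h3⟩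

theorem of_seq (hu : MemLp u 2 (volume.restrict D)) (hG : MemLp G 2 (volume.restrict D))
    (hw : HasWeakGradient D u G) {φ : ℕ → Rd d → ℝ} (hφ : ∀ n, IsTestFun D (φ n))
    (h1 : Filter.Tendsto (fun n => eLpNorm (fun x => u x - φ n x) 2 (volume.restrict D))
      Filter.atTop (nhds 0))
    (h2 : Filter.Tendsto (fun n => eLpNorm (fun x => G x - gradient (φ n) x) 2
      (volume.restrict D)) Filter.atTop (nhds 0)) : MemH10 D u G where
  memLp := hu
  memLp_grad := hG
  weakGrad := hw
  approx ε hε := by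
    obtain ⟨n, hn1, hn2⟩ := ((h1.eventually (ge_mem_nhds hε)).and
      (h2.eventually (ge_mem_nhds hε))).exists
    exact ⟨φ n, hφ n, hn1, hn2⟩

theorem integrable_smul_gradient (hu : MemLp u 2 (volume.restrict D)) {φ : Rd d → ℝ}
    (hφ : IsTestFun D φ) : Integrable (fun x => u x • gradient φ x) (volume.restrict D) := by
  have := MemLp.smul (r := 1) (hφ.memLp_gradient 2 (volume.restrict D)) hu
  exact memLp_one_iff_integrable.1 this

theorem integrable_test_smul (hG : MemLp G 2 (volume.restrict D)) {φ : Rd d → ℝ}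
    (hφ : IsTestFun D φ) : Integrable (fun x => φ x • G x) (volume.restrict D) := by
  have := MemLp.smul (r := 1) hG (hφ.memLp 2 (volume.restrict D))
  exact memLp_one_iff_integrable.1 this

theorem add_const_mul (hu : MemH10 D u G) (hv : MemH10 D v H) (s : ℝ) :
    MemH10 D (fun x => u x + s * v x) (fun x => G x + s • H x) := by
  obtain ⟨φ, h1, h2, h3⟩ := hu.exists_seq
  obtain ⟨χ, k1, k2, k3⟩ := hv.exists_seq
  refine of_seq (φ := fun n x => φ n x + s * χ n x) (hu.memLp.add (hv.memLp.const_mul s))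
    (hu.memLp_grad.add (hv.memLp_grad.const_smul s)) ?_ (fun n => (h1 n).add_const_mul (k1 n) s)
    ?_ ?_
  · intro ψ hψ
    have a1 := hu.weakGrad ψ hψ
    have a2 := hv.weakGrad ψ hψ
    simp only [add_smul, mul_smul, smul_add, smul_comm _ s]
    rw [integral_add (integrable_smul_gradient hu.memLp hψ)
      ((integrable_smul_gradient hv.memLp hψ).fun_smul s), integral_add
      (integrable_test_smul hu.memLp_grad hψ) ((integrable_test_smul hv.memLp_grad hψ).fun_smul s),
      integral_smul, integral_smul, a1, a2, smul_neg, neg_add]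
  · have lim := h2.add (ENNReal.Tendsto.const_mul k2 (.inr (enorm_ne_top (x := s))))
    simp only [mul_zero, add_zero] at lim
    refine tendsto_of_tendsto_of_tendsto_of_le_of_le tendsto_const_nhds lim (fun _ => zero_le)
      fun n => ?_
    have := eLpNorm_add_le (μ := volume.restrict D) (p := 2)
      (hu.memLp.1.sub ((h1 n).memLp 2 _).1)
      ((hv.memLp.1.sub ((k1 n).memLp 2 _).1).const_smul s) (by norm_num)
    rw [eLpNorm_const_smul] at this
    refine le_trans (le_of_eq ?_) this
    congr 1
    ext x
    simp
    ring
  · have lim := h3.add (ENNReal.Tendsto.const_mul k3 (.inr (enorm_ne_top (x := s))))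
    simp only [mul_zero, add_zero] at lim
    refine tendsto_of_tendsto_of_tendsto_of_le_of_le tendsto_const_nhds lim (fun _ => zero_le)
      fun n => ?_
    have := eLpNorm_add_le (μ := volume.restrict D) (p := 2)
      (hu.memLp_grad.1.sub ((h1 n).memLp_gradient 2 _).1)
      ((hv.memLp_grad.1.sub ((k1 n).memLp_gradient 2 _).1).const_smul s) (by norm_num)
    rw [eLpNorm_const_smul] at this
    refine le_trans (le_of_eq ?_) this
    congr 1
    ext1 x
    rw [gradient_add_const_mul_apply (h1 n).smooth (k1 n).smooth]
    simp only [Pi.add_apply, Pi.sub_apply, Pi.smul_apply]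
    module

theorem memLp_bdd_smul {F : Type*} [NormedAddCommGroup F] [NormedSpace ℝ F] {μ : Measure (Rd d)}
    {f : Rd d → F} (hf : MemLp f 2 μ) {η : Rd d → ℝ} (hη : Continuous η) {C : ℝ}
    (hC : ∀ᵐ x ∂μ, |η x| ≤ C) : MemLp (fun x => η x • f x) 2 μ :=
  hf.of_le_mul (hη.aestronglyMeasurable.smul hf.1) (hC.mono fun x hx => by
    rw [norm_smul]; exact mul_le_mul_of_nonneg_right hx (norm_nonneg _))

/-- Makes ηψ admissible in the variational identity. The factor η needs no compact support, because
it and its gradient are bounded on the compact closure of D. -/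
theorem smooth_mul (hD : MeasurableSet D) (hDb : Bornology.IsBounded D) (hu : MemH10 D u G)
    {η : Rd d → ℝ} (hη : ContDiff ℝ ∞ η) :
    MemH10 D (fun x => η x * u x) (fun x => η x • G x + u x • gradient η x) := by
  obtain ⟨C, hC⟩ := hDb.isCompact_closure.exists_bound_of_continuousOn hη.continuous.continuousOn
  obtain ⟨C', hC'⟩ := hDb.isCompact_closure.exists_bound_of_continuousOn
    (continuous_gradient hη).continuousOn
  have cη := hη.continuous
  have gη := continuous_gradient hη
  have bC : ∀ᵐ x ∂volume.restrict D, |η x| ≤ C :=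
    (ae_restrict_mem hD).mono fun x hx => hC x (subset_closure hx)
  have bC' : ∀ᵐ x ∂volume.restrict D, ‖gradient η x‖ ≤ C' :=
    (ae_restrict_mem hD).mono fun x hx => hC' x (subset_closure hx)
  have second : ∀ f : Rd d → ℝ, MemLp f 2 (volume.restrict D) →
      MemLp (fun x => f x • gradient η x) 2 (volume.restrict D) := fun f hf =>
    hf.of_le_mul (hf.1.smul gη.aestronglyMeasurable) (bC'.mono fun x hx => by
      rw [norm_smul, mul_comm]; exact mul_le_mul_of_nonneg_right hx (norm_nonneg _))
  have first := memLp_bdd_smul hu.memLp_grad cη bC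
  obtain ⟨φ, h1, h2, h3⟩ := hu.exists_seq
  refine of_seq (φ := fun n x => η x * φ n x) (memLp_bdd_smul hu.memLp cη bC)
    (first.add (second u hu.memLp)) ?_ (fun n => (h1 n).smooth_mul hη) ?_ ?_
  · intro ψ hψ
    -- The weak product rule follows by testing the weak gradient of u with ηψ.
    have a := hu.weakGrad _ (hψ.smooth_mul hη)
    simp only [gradient_mul_apply hη hψ.smooth, smul_add] at a
    have i1 : Integrable (fun x => u x • η x • gradient ψ x) (volume.restrict D) := by
      refine (integrable_smul_gradient (memLp_bdd_smul hu.memLp cη bC) hψ).congr (.of_forall ?_)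
      intro x
      simp only [smul_eq_mul]
      module
    have i2 : Integrable (fun x => u x • ψ x • gradient η x) (volume.restrict D) := by
      refine (integrable_test_smul (second u hu.memLp) hψ).congr (.of_forall ?_)
      intro x
      simp only
      module
    rw [integral_add i1 i2] at a
    have e : ∀ x, ψ x • (η x • G x + u x • gradient η x) =
        (η x * ψ x) • G x + u x • ψ x • gradient η x := fun x => by module
    have e' : ∀ x, (η x * u x) • gradient ψ x = u x • η x • gradient ψ x := fun x => by module
    simp only [e, e']
    rw [integral_add (integrable_test_smul hu.memLp_grad (hψ.smooth_mul hη)) i2, neg_add, ← a]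
    abel
  · have lim := ENNReal.Tendsto.const_mul (a := ENNReal.ofReal C) h2 (.inr ENNReal.ofReal_ne_top)
    rw [mul_zero] at lim
    refine tendsto_of_tendsto_of_tendsto_of_le_of_le tendsto_const_nhds lim (fun _ => zero_le)
      fun n => ?_
    refine eLpNorm_le_mul_eLpNorm_of_ae_le_mul (bC.mono fun x hx => ?_) 2
    rw [← mul_sub, norm_mul]
    exact mul_le_mul_of_nonneg_right hx (norm_nonneg _)
  · have lim := (ENNReal.Tendsto.const_mul (a := ENNReal.ofReal C) h3
      (.inr ENNReal.ofReal_ne_top)).add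
      (ENNReal.Tendsto.const_mul (a := ENNReal.ofReal C') h2 (.inr ENNReal.ofReal_ne_top))
    rw [mul_zero, mul_zero, add_zero] at lim
    refine tendsto_of_tendsto_of_tendsto_of_le_of_le tendsto_const_nhds lim (fun _ => zero_le)
      fun n => ?_
    have hv : MemLp (fun x => u x - φ n x) 2 (volume.restrict D) := hu.memLp.sub ((h1 n).memLp 2 _)
    have hg : MemLp (fun x => G x - gradient (φ n) x) 2 (volume.restrict D) :=
      hu.memLp_grad.sub ((h1 n).memLp_gradient 2 _)
    have := eLpNorm_add_le (μ := volume.restrict D) (p := 2)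
      (memLp_bdd_smul hg cη bC).1 (second _ hv).1 (by norm_num)
    refine le_trans (le_of_eq ?_) (this.trans (add_le_add ?_ ?_))
    · congr 1
      ext1 x
      rw [gradient_mul_apply hη (h1 n).smooth]
      simp only [Pi.add_apply]
      module
    · refine eLpNorm_le_mul_eLpNorm_of_ae_le_mul (bC.mono fun x hx => ?_) 2
      rw [norm_smul]
      exact mul_le_mul_of_nonneg_right hx (norm_nonneg _)
    · refine eLpNorm_le_mul_eLpNorm_of_ae_le_mul (bC'.mono fun x hx => ?_) 2
      rw [norm_smul, mul_comm]
      exact mul_le_mul_of_nonneg_right hx (norm_nonneg _)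

end MemH10

/-! ### The energy form. -/

/-- The density of the energy bilinear form. -/
noncomputable def energyDensity {d : ℕ} (a : Rd d → Matrix (Fin d) (Fin d) ℝ) (c : Rd d → ℝ)
    (u : Rd d → ℝ) (G : Rd d → Rd d) (v : Rd d → ℝ) (H : Rd d → Rd d) (x : Rd d) : ℝ :=
  (G x).ofLp ⬝ᵥ (a x *ᵥ (H x).ofLp) + c x * (u x * v x)

theorem dotProduct_ofLp_self {d : ℕ} (ξ : Rd d) : ξ.ofLp ⬝ᵥ ξ.ofLp = ‖ξ‖ ^ 2 := by
  rw [EuclideanSpace.real_norm_sq_eq, dotProduct]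
  simp [sq]

theorem energySq_eq_integral {d : ℕ} (a : Rd d → Matrix (Fin d) (Fin d) ℝ) (c : Rd d → ℝ)
    (S : Set (Rd d)) (u : Rd d → ℝ) (G : Rd d → Rd d) :
    energySq a c S u G = ∫ x in S, energyDensity a c u G u G x := by
  simp only [energySq, energyDensity, sq]

section Pointwise

variable {d : ℕ} {a : Rd d → Matrix (Fin d) (Fin d) ℝ} {c : Rd d → ℝ} {u v : Rd d → ℝ}
  {G H : Rd d → Rd d} {x : Rd d}

theorem dotProduct_mulVec_comm_of_isSymm {A : Matrix (Fin d) (Fin d) ℝ} (hA : A.IsSymm)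
    (ξ ζ : Fin d → ℝ) : ξ ⬝ᵥ (A *ᵥ ζ) = ζ ⬝ᵥ (A *ᵥ ξ) := by
  rw [Matrix.dotProduct_mulVec, ← Matrix.mulVec_transpose, hA.eq, dotProduct_comm]

theorem energyDensity_add_smul (hA : (a x).IsSymm) (s : ℝ) :
    energyDensity a c (fun x => u x + s * v x) (fun x => G x + s • H x)
      (fun x => u x + s * v x) (fun x => G x + s • H x) x =
    energyDensity a c u G u G x + 2 * s * energyDensity a c u G v H x
      + s ^ 2 * energyDensity a c v H v H x := by
  simp only [energyDensity, WithLp.ofLp_add, WithLp.ofLp_smul, Matrix.mulVec_add, Matrix.mulVec_smul,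
    dotProduct_add, add_dotProduct, dotProduct_smul, smul_dotProduct, smul_eq_mul]
  rw [dotProduct_mulVec_comm_of_isSymm hA (H x).ofLp (G x).ofLp]
  ring

/-- Nonnegativity of the form at ξ + ζ and ξ - ζ. It makes mixed energy densities integrable. -/
theorem abs_dotProduct_mulVec_le {A : Matrix (Fin d) (Fin d) ℝ} (hA : A.IsSymm)
    (hpos : ∀ ξ, 0 ≤ ξ ⬝ᵥ (A *ᵥ ξ)) (ξ ζ : Fin d → ℝ) :
    |ξ ⬝ᵥ (A *ᵥ ζ)| ≤ (ξ ⬝ᵥ (A *ᵥ ξ) + ζ ⬝ᵥ (A *ᵥ ζ)) / 2 := by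
  have h1 := hpos (ξ + ζ)
  have h2 := hpos (ξ - ζ)
  simp only [Matrix.mulVec_add, Matrix.mulVec_sub, dotProduct_add, add_dotProduct, dotProduct_sub,
    sub_dotProduct] at h1 h2
  rw [dotProduct_mulVec_comm_of_isSymm hA ζ ξ] at h1 h2
  exact abs_le.2 ⟨by linarith, by linarith⟩

end Pointwise

namespace IsEllipticCoeff

variable {d : ℕ} {D : Set (Rd d)} {a : Rd d → Matrix (Fin d) (Fin d) ℝ} {c : Rd d → ℝ}
  {amin amax cmax : ℝ}

theorem aemeasurable_energyDensity (h : IsEllipticCoeff D a c amin amax cmax) {u v : Rd d → ℝ}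
    {G H : Rd d → Rd d} (hu : MemLp u 2 (volume.restrict D)) (hv : MemLp v 2 (volume.restrict D))
    (hG : MemLp G 2 (volume.restrict D)) (hH : MemLp H 2 (volume.restrict D)) :
    AEMeasurable (energyDensity a c u G v H) (volume.restrict D) := by
  have coord : ∀ F : Rd d → Rd d, MemLp F 2 (volume.restrict D) → ∀ p,
      AEMeasurable (fun x => (F x).ofLp p) (volume.restrict D) := fun F hF p =>
    (by fun_prop : Continuous fun z : Rd d => z.ofLp p).measurable.comp_aemeasurable
      hF.1.aemeasurable
  unfold energyDensity
  refine AEMeasurable.add ?_ (h.measurable_c.mul (hu.1.aemeasurable.mul hv.1.aemeasurable))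
  simp only [dotProduct, Matrix.mulVec]
  exact Finset.aemeasurable_fun_sum _ fun p _ => (coord G hG p).mul
    (Finset.aemeasurable_fun_sum _ fun q _ => (h.measurable_a p q).mul (coord H hH q))

theorem integrable_energyDensity (h : IsEllipticCoeff D a c amin amax cmax) (hamin : 0 ≤ amin)
    {u v : Rd d → ℝ} {G H : Rd d → Rd d} (hu : MemLp u 2 (volume.restrict D))
    (hv : MemLp v 2 (volume.restrict D)) (hG : MemLp G 2 (volume.restrict D))
    (hH : MemLp H 2 (volume.restrict D)) :
    Integrable (energyDensity a c u G v H) (volume.restrict D) := by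
  have iG : Integrable (fun x => ‖G x‖ ^ 2) (volume.restrict D) :=
    MemLp.integrable_norm_pow (p := 2) (by exact_mod_cast hG) two_ne_zero
  have iH : Integrable (fun x => ‖H x‖ ^ 2) (volume.restrict D) :=
    MemLp.integrable_norm_pow (p := 2) (by exact_mod_cast hH) two_ne_zero
  refine Integrable.mono' (((iG.add iH).const_mul (amax / 2)).add
    ((hu.integrable_sq.add hv.integrable_sq).const_mul (cmax / 2)))
    (h.aemeasurable_energyDensity hu hv hG hH).aestronglyMeasurable ?_
  filter_upwards [h.symm, h.lower, h.upper, h.bound_c] with x h1 h2 h3 h4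
  have pos : ∀ ξ, 0 ≤ ξ ⬝ᵥ (a x *ᵥ ξ) := fun ξ =>
    (mul_nonneg hamin (Finset.sum_nonneg fun p _ => mul_self_nonneg (ξ p))).trans (h2 ξ)
  have k1 := abs_dotProduct_mulVec_le h1 pos (G x).ofLp (H x).ofLp
  have k2 := h3 (G x).ofLp
  have k3 := h3 (H x).ofLp
  rw [dotProduct_ofLp_self] at k2 k3
  have k4 : |c x * (u x * v x)| ≤ cmax / 2 * (u x ^ 2 + v x ^ 2) := by
    rw [abs_mul, abs_of_nonneg h4.1]
    have : |u x * v x| ≤ (u x ^ 2 + v x ^ 2) / 2 :=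
      abs_le.2 ⟨by nlinarith [sq_nonneg (u x + v x)], by nlinarith [sq_nonneg (u x - v x)]⟩
    have e : cmax / 2 * (u x ^ 2 + v x ^ 2) = cmax * ((u x ^ 2 + v x ^ 2) / 2) := by ring
    rw [e]
    exact mul_le_mul h4.2 this (abs_nonneg _) (h4.1.trans h4.2)
  refine (abs_add_le _ _).trans ?_
  simp only [Pi.add_apply]
  linarith

theorem energyDensity_self_ge (h : IsEllipticCoeff D a c amin amax cmax) (u : Rd d → ℝ)
    (G : Rd d → Rd d) :
    ∀ᵐ x ∂volume.restrict D, amin * ‖G x‖ ^ 2 ≤ energyDensity a c u G u G x := by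
  filter_upwards [h.lower, h.bound_c] with x h2 h4
  have k2 := h2 (G x).ofLp
  rw [dotProduct_ofLp_self] at k2
  have : 0 ≤ c x * (u x * u x) := mul_nonneg h4.1 (mul_self_nonneg _)
  rw [energyDensity]
  linarith

theorem energyDensity_self_le (h : IsEllipticCoeff D a c amin amax cmax) (u : Rd d → ℝ)
    (G : Rd d → Rd d) :
    ∀ᵐ x ∂volume.restrict D,
      energyDensity a c u G u G x ≤ amax * ‖G x‖ ^ 2 + cmax * u x ^ 2 := by
  filter_upwards [h.upper, h.bound_c] with x h2 h4
  have k2 := h2 (G x).ofLp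
  rw [dotProduct_ofLp_self] at k2
  have : c x * (u x * u x) ≤ cmax * (u x * u x) :=
    mul_le_mul_of_nonneg_right h4.2 (mul_self_nonneg _)
  rw [energyDensity]
  nlinarith

theorem energyDensity_self_nonneg (h : IsEllipticCoeff D a c amin amax cmax) (hamin : 0 ≤ amin)
    (u : Rd d → ℝ) (G : Rd d → Rd d) :
    ∀ᵐ x ∂volume.restrict D, 0 ≤ energyDensity a c u G u G x :=
  (h.energyDensity_self_ge u G).mono fun _ hx => (mul_nonneg hamin (sq_nonneg _)).trans hx

theorem energySq_nonneg (h : IsEllipticCoeff D a c amin amax cmax) (hamin : 0 ≤ amin)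
    {S : Set (Rd d)} (hS : S ⊆ D) (u : Rd d → ℝ) (G : Rd d → Rd d) : 0 ≤ energySq a c S u G := by
  rw [energySq_eq_integral]
  exact integral_nonneg_of_ae (ae_restrict_of_ae_restrict_of_subset hS
    (h.energyDensity_self_nonneg hamin u G))

theorem energySq_add_smul (h : IsEllipticCoeff D a c amin amax cmax) (hamin : 0 ≤ amin)
    {S : Set (Rd d)} (hS : S ⊆ D)
    {u v : Rd d → ℝ} {G H : Rd d → Rd d} (hu : MemLp u 2 (volume.restrict D))
    (hv : MemLp v 2 (volume.restrict D)) (hG : MemLp G 2 (volume.restrict D))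
    (hH : MemLp H 2 (volume.restrict D)) (s : ℝ) :
    energySq a c S (fun x => u x + s * v x) (fun x => G x + s • H x) =
      energySq a c S u G + 2 * s * (∫ x in S, energyDensity a c u G v H x)
        + s ^ 2 * energySq a c S v H := by
  have i1 := (h.integrable_energyDensity hamin hu hu hG hG).mono_measure (Measure.restrict_mono_set _ hS)
  have i2 := (h.integrable_energyDensity hamin hu hv hG hH).mono_measure (Measure.restrict_mono_set _ hS)
  have i3 := (h.integrable_energyDensity hamin hv hv hH hH).mono_measure (Measure.restrict_mono_set _ hS)
  simp only [energySq_eq_integral]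
  rw [integral_congr_ae (g := fun x => energyDensity a c u G u G x +
    2 * s * energyDensity a c u G v H x + s ^ 2 * energyDensity a c v H v H x)
    ((ae_restrict_of_ae_restrict_of_subset hS h.symm).mono fun x hx => energyDensity_add_smul hx s),
    integral_add (i1.fun_add (i2.const_mul _)) (i3.const_mul _), integral_add i1 (i2.const_mul _),
    integral_const_mul, integral_const_mul]

/-- Cauchy–Schwarz for the energy form. -/
theorem sq_integral_energyDensity_le (h : IsEllipticCoeff D a c amin amax cmax) (hamin : 0 ≤ amin)
    {S : Set (Rd d)} (hS : S ⊆ D)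
    {u v : Rd d → ℝ} {G H : Rd d → Rd d} (hu : MemLp u 2 (volume.restrict D))
    (hv : MemLp v 2 (volume.restrict D)) (hG : MemLp G 2 (volume.restrict D))
    (hH : MemLp H 2 (volume.restrict D)) :
    (∫ x in S, energyDensity a c u G v H x) ^ 2 ≤ energySq a c S u G * energySq a c S v H := by
  have := discrim_le_zero (a := energySq a c S v H)
    (b := 2 * ∫ x in S, energyDensity a c u G v H x) (c := energySq a c S u G) fun s => by
      have h1 := h.energySq_nonneg hamin hS (fun x => u x + s * v x) (fun x => G x + s • H x)
      rw [h.energySq_add_smul hamin hS hu hv hG hH s] at h1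
      linarith
  rw [discrim] at this
  linarith

end IsEllipticCoeff

/-! ### Lagrange multipliers of the minimizer. -/

/-- First-order optimality at s = 0; b becomes the energy pairing of the minimizer with an
admissible direction. -/
theorem eq_zero_of_forall_quadratic_nonneg {b e : ℝ} (h : ∀ s : ℝ, 0 ≤ 2 * s * b + s ^ 2 * e) :
    b = 0 := by
  have := discrim_le_zero (a := e) (b := 2 * b) (c := 0) fun s => by
    have := h s
    linarith
  rw [discrim] at this
  nlinarith [sq_nonneg b]

section Multipliers

variable {d m : ℕ} {D : Set (Rd d)} {τ : Fin m → Set (Rd d)} {δ : ℝ}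

namespace IsRegularPartition

theorem integral_mul_piecewiseConst (hτ : IsRegularPartition D τ δ) (u : Rd d → ℝ) (j : Fin m) :
    ∫ x in D, u x * piecewiseConst τ j x = ∫ x in τ j, u x := by
  have : ∀ x, u x * piecewiseConst τ j x = (τ j).indicator u x := fun x => by
    by_cases hx : x ∈ τ j <;> simp [piecewiseConst, hx]
  simp only [this]
  rw [setIntegral_indicator (hτ.isOpen j).measurableSet, inter_eq_self_of_subset_right (hτ.subset j)]

theorem ae_eq_iUnion (hτ : IsRegularPartition D τ δ) : (⋃ j, τ j : Set (Rd d)) =ᵐ[volume] D :=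
  ((iUnion_subset hτ.subset).eventuallyLE).antisymm
    (ae_le_set.2 hτ.cover)

theorem integral_eq_sum (hτ : IsRegularPartition D τ δ) {f : Rd d → ℝ}
    (hf : IntegrableOn f D) : ∫ x in D, f x = ∑ j, ∫ x in τ j, f x := by
  rw [← setIntegral_congr_set hτ.ae_eq_iUnion,
    integral_iUnion_fintype (fun j => (hτ.isOpen j).measurableSet) hτ.disjoint
      fun j => hf.mono_set (hτ.subset j)]

/-- These functions are dual to the constraints: pairing the minimizer with them gives the
multipliers. -/
theorem exists_testFun (hτ : IsRegularPartition D τ δ) (j : Fin m) :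
    ∃ v : Rd d → ℝ, IsTestFun (τ j) v ∧ ∫ x in τ j, v x = 1 := by
  obtain ⟨y, hy⟩ := hτ.nonempty j
  obtain ⟨f, f1, f2, f3, f4, f5⟩ := exists_contDiff_tsupport_subset (n := ⊤)
    ((hτ.isOpen j).mem_nhds hy)
  have hf : IsTestFun (τ j) f := ⟨f3.of_le (by norm_cast), f2, f1⟩
  have f0 : ∀ x, 0 ≤ f x := fun x => (f4 (mem_range_self x)).1
  have hpos : 0 < ∫ x in τ j, f x := by
    rw [setIntegral_eq_integral_of_forall_compl_eq_zero fun x hx => hf.eq_zero hx]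
    refine (integral_pos_iff_support_of_nonneg f0 (memLp_one_iff_integrable.1 (hf.memLp 1 _))).2 ?_
    exact hf.smooth.continuous.isOpen_support.measure_pos _ ⟨y, by simp [f5]⟩
  set I := ∫ x in τ j, f x
  refine ⟨fun x => I⁻¹ * f x, hf.smooth_mul contDiff_const, ?_⟩
  rw [integral_const_mul]
  exact inv_mul_cancel₀ hpos.ne'

theorem integral_testFun_of_ne (hτ : IsRegularPartition D τ δ) {j k : Fin m} (hjk : j ≠ k)
    {v : Rd d → ℝ} (hv : IsTestFun (τ j) v) : ∫ x in τ k, v x = 0 :=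
  setIntegral_eq_zero_of_forall_eq_zero fun _ hx =>
    hv.eq_zero fun hxj => (Set.disjoint_left.1 (hτ.disjoint hjk)) hxj hx

end IsRegularPartition

variable {a : Rd d → Matrix (Fin d) (Fin d) ℝ} {c : Rd d → ℝ} {amin amax cmax : ℝ} {i : Fin m}
  {ψ : Rd d → ℝ} {G : Rd d → Rd d}

namespace IsEnergyMinimizer

theorem integral_self (hτ : IsRegularPartition D τ δ)
    (hψ : IsEnergyMinimizer D a c (piecewiseConst τ) i ψ G) (j : Fin m) :
    ∫ x in τ j, ψ x = if i = j then 1 else 0 := by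
  rw [← hτ.integral_mul_piecewiseConst]
  exact hψ.1.2 j

/-- The minimizer is orthogonal to the kernel of the constraints. -/
theorem integral_energyDensity_eq_zero (hcoeff : IsEllipticCoeff D a c amin amax cmax)
    (hamin : 0 ≤ amin) (hfin : volume D ≠ ⊤) (hτ : IsRegularPartition D τ δ)
    (hψ : IsEnergyMinimizer D a c (piecewiseConst τ) i ψ G) {v : Rd d → ℝ} {H : Rd d → Rd d}
    (hv : MemH10 D v H) (hv0 : ∀ j, ∫ x in τ j, v x = 0) :
    ∫ x in D, energyDensity a c ψ G v H x = 0 := by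
  have : IsFiniteMeasure (volume.restrict D) := ⟨by simpa using hfin.lt_top⟩
  have int : ∀ f : Rd d → ℝ, MemLp f 2 (volume.restrict D) → ∀ j, IntegrableOn f (τ j) :=
    fun f hf j => (hf.integrable (by norm_num)).mono_measure (Measure.restrict_mono_set _ (hτ.subset j))
  refine eq_zero_of_forall_quadratic_nonneg (e := energySq a c D v H) fun s => ?_
  have h1 := hψ.2 (fun x => ψ x + s * v x) (fun x => G x + s • H x)
    ⟨hψ.1.1.add_const_mul hv s, fun j => by
      rw [hτ.integral_mul_piecewiseConst, integral_add (int _ hψ.1.1.memLp j)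
        ((int _ hv.memLp j).const_mul s), integral_const_mul, hv0, hψ.integral_self hτ]
      simp⟩
  rw [hcoeff.energySq_add_smul hamin subset_rfl hψ.1.1.memLp hv.memLp hψ.1.1.memLp_grad
    hv.memLp_grad s] at h1
  linarith

/-- Lagrange multipliers for the minimizer. -/
theorem exists_multipliers (hcoeff : IsEllipticCoeff D a c amin amax cmax)
    (hamin : 0 ≤ amin) (hfin : volume D ≠ ⊤) (hτ : IsRegularPartition D τ δ)
    (hψ : IsEnergyMinimizer D a c (piecewiseConst τ) i ψ G) :
    ∃ b : Fin m → ℝ, ∀ (v : Rd d → ℝ) (H : Rd d → Rd d), MemH10 D v H →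
      ∫ x in D, energyDensity a c ψ G v H x = ∑ j, b j * ∫ x in τ j, v x := by
  have : IsFiniteMeasure (volume.restrict D) := ⟨by simpa using hfin.lt_top⟩
  have int : ∀ f : Rd d → ℝ, MemLp f 2 (volume.restrict D) → ∀ j, IntegrableOn f (τ j) :=
    fun f hf j => (hf.integrable (by norm_num)).mono_measure (Measure.restrict_mono_set _ (hτ.subset j))
  choose w hw hw1 using hτ.exists_testFun
  have wH : ∀ j, MemH10 D (w j) (gradient (w j)) := fun j =>
    MemH10.of_isTestFun ((hw j).mono (hτ.subset j))
  refine ⟨fun j => ∫ x in D, energyDensity a c ψ G (w j) (gradient (w j)) x, fun v H hv => ?_⟩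
  -- Subtracting (∫_{τ_k} v) w_k for one element at a time leaves the other constraints untouched.
  -- After all elements the remainder satisfies every homogeneous constraint, so its pairing with ψ
  -- vanishes.
  suffices key : ∀ s : Finset (Fin m), ∃ (v' : Rd d → ℝ) (H' : Rd d → Rd d), MemH10 D v' H' ∧
      (∀ j ∈ s, ∫ x in τ j, v' x = 0) ∧ (∀ j ∉ s, ∫ x in τ j, v' x = ∫ x in τ j, v x) ∧
      ∫ x in D, energyDensity a c ψ G v H x = (∫ x in D, energyDensity a c ψ G v' H' x) +
        ∑ j ∈ s, (∫ x in D, energyDensity a c ψ G (w j) (gradient (w j)) x) * ∫ x in τ j, v x by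
    obtain ⟨v', H', h1, h2, -, h4⟩ := key Finset.univ
    rw [h4, hψ.integral_energyDensity_eq_zero hcoeff hamin hfin hτ h1 fun j => h2 j (Finset.mem_univ _),
      zero_add]
  intro s
  induction s using Finset.induction_on with
  | empty => exact ⟨v, H, hv, by simp, by simp, by simp⟩
  | insert k s hk ih =>
    obtain ⟨v', H', h1, h2, h3, h4⟩ := ih
    set t : ℝ := ∫ x in τ k, v x
    have hint : ∀ j, ∫ x in τ j, (v' x + -t * w k x) =
        (∫ x in τ j, v' x) + -t * ∫ x in τ j, w k x := fun j => by
      rw [integral_add (int _ h1.memLp j) ((int _ (wH k).memLp j).const_mul _), integral_const_mul]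
    refine ⟨fun x => v' x + -t * w k x, fun x => H' x + -t • gradient (w k) x,
      h1.add_const_mul (wH k) (-t), fun j hj => ?_, fun j hj => ?_, ?_⟩
    · rw [hint]
      rcases Finset.mem_insert.1 hj with rfl | hj
      · rw [h3 _ hk, hw1]
        simp [t]
      · have hne : k ≠ j := fun h => hk (h ▸ hj)
        rw [h2 j hj, hτ.integral_testFun_of_ne hne (hw k)]
        simp
    · rw [Finset.mem_insert, not_or] at hj
      rw [hint, h3 j hj.2, hτ.integral_testFun_of_ne (Ne.symm hj.1) (hw k)]
      simp
    · have i1 := hcoeff.integrable_energyDensity hamin hψ.1.1.memLp h1.memLp hψ.1.1.memLp_grad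
        h1.memLp_grad
      have i2 := hcoeff.integrable_energyDensity hamin hψ.1.1.memLp (wH k).memLp hψ.1.1.memLp_grad
        (wH k).memLp_grad
      have e : ∀ x, energyDensity a c ψ G (fun x => v' x + -t * w k x)
          (fun x => H' x + -t • gradient (w k) x) x = energyDensity a c ψ G v' H' x +
          -t * energyDensity a c ψ G (w k) (gradient (w k)) x := fun x => by
        simp only [energyDensity, WithLp.ofLp_add, WithLp.ofLp_smul, Matrix.mulVec_add,
          Matrix.mulVec_smul, dotProduct_add, dotProduct_smul, smul_eq_mul]
        ring
      simp only [e]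
      rw [integral_add i1 (i2.const_mul _), integral_const_mul, h4, Finset.sum_insert hk]
      ring

end IsEnergyMinimizer
end Multipliers

/-! ### The Poincaré inequality in `H_0^1(D)`. -/

theorem integral_norm_sq_eq_toReal_eLpNorm_sq {Ω F : Type*} [MeasurableSpace Ω]
    [NormedAddCommGroup F] {μ : Measure Ω} {f : Ω → F} (hf : MemLp f 2 μ) :
    ∫ x, ‖f x‖ ^ 2 ∂μ = (eLpNorm f 2 μ).toReal ^ 2 := by
  have h0 : 0 ≤ ∫ x, ‖f x‖ ^ 2 ∂μ := integral_nonneg fun x => by positivity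
  rw [hf.eLpNorm_eq_integral_rpow_norm two_ne_zero (by norm_num)]
  simp only [ENNReal.toReal_ofNat, Real.rpow_two]
  rw [ENNReal.toReal_ofReal (by positivity), ← Real.rpow_natCast, ← Real.rpow_mul h0]
  norm_num

/-- The mean, here 0, is the constant closest to u in L². -/
theorem integral_sq_le_integral_sub_const_sq {Ω : Type*} [MeasurableSpace Ω] {μ : Measure Ω}
    [IsFiniteMeasure μ] {u : Ω → ℝ} (hu : MemLp u 2 μ) (h0 : ∫ x, u x ∂μ = 0) (m : ℝ) :
    ∫ x, u x ^ 2 ∂μ ≤ ∫ x, (u x - m) ^ 2 ∂μ := by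
  have i1 := hu.integrable_sq
  have i2 : Integrable u μ := hu.integrable (by norm_num)
  have : ∫ x, (u x - m) ^ 2 ∂μ = ∫ x, (u x ^ 2 + -2 * m * u x + m ^ 2) ∂μ := by
    congr 1 with x
    ring
  rw [this, integral_add (i1.fun_add (i2.const_mul _)) (integrable_const _),
    integral_add i1 (i2.const_mul _), integral_const_mul, h0, integral_const]
  have : 0 ≤ μ.real univ • m ^ 2 := by positivity
  linarith

/-- The Poincaré inequality on convex subsets for functions in `H_0^1(D)`. -/
theorem MemH10.poincare {d : ℕ} {D K : Set (Rd d)} {u : Rd d → ℝ} {G : Rd d → Rd d}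
    (hu : MemH10 D u G) (hKD : K ⊆ D) (hK : MeasurableSet K) (hconv : Convex ℝ K) {y₀ : Rd d}
    {R : ℝ} (hR : 0 < R) (hKR : K ⊆ Metric.closedBall y₀ R) (h0 : ∫ x in K, u x = 0) :
    ∫ x in K, u x ^ 2 ≤ Real.exp 1 / 2 * R ^ 2 * ∫ x in K, ‖G x‖ ^ 2 := by
  have hfin : volume K < ⊤ := (measure_mono hKR).trans_lt measure_closedBall_lt_top
  have : IsFiniteMeasure (volume.restrict K) := ⟨by simpa using hfin⟩
  set μ := volume.restrict K
  have hμ : μ ≤ volume.restrict D := Measure.restrict_mono_set _ hKD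
  have uL : MemLp u 2 μ := hu.memLp.mono_measure hμ
  have memG : MemLp G 2 μ := hu.memLp_grad.mono_measure hμ
  obtain ⟨φ, h1, h2, h3⟩ := hu.exists_seq
  set C := √(Real.exp 1 / 2) * R
  have hC : 0 ≤ C := by positivity
  have hC2 : C ^ 2 = Real.exp 1 / 2 * R ^ 2 := by
    rw [mul_pow, Real.sq_sqrt (by positivity)]
  have lim1 : Filter.Tendsto (fun n => (eLpNorm (fun x => u x - φ n x) 2 μ).toReal) Filter.atTop
      (nhds 0) := by
    refine (ENNReal.tendsto_toReal ENNReal.zero_ne_top).comp ?_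
    exact tendsto_of_tendsto_of_tendsto_of_le_of_le tendsto_const_nhds h2 (fun _ => zero_le)
      fun n => eLpNorm_mono_measure _ hμ
  have lim2 : Filter.Tendsto (fun n => (eLpNorm (fun x => G x - gradient (φ n) x) 2 μ).toReal)
      Filter.atTop (nhds 0) := by
    refine (ENNReal.tendsto_toReal ENNReal.zero_ne_top).comp ?_
    exact tendsto_of_tendsto_of_tendsto_of_le_of_le tendsto_const_nhds h3 (fun _ => zero_le)
      fun n => eLpNorm_mono_measure _ hμ
  have tri : ∀ {F : Type} [NormedAddCommGroup F] (f g : Rd d → F), MemLp f 2 μ → MemLp g 2 μ →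
      (eLpNorm (fun x => f x + g x) 2 μ).toReal ≤ (eLpNorm f 2 μ).toReal + (eLpNorm g 2 μ).toReal := by
    intro F _ f g hf hg
    rw [← ENNReal.toReal_add hf.2.ne hg.2.ne]
    exact ENNReal.toReal_mono (ENNReal.add_ne_top.2 ⟨hf.2.ne, hg.2.ne⟩)
      (eLpNorm_add_le hf.1 hg.1 (by norm_num))
  -- The approximants need not have mean zero on K. Their inequality is used with its own constant
  -- m, which is removed by the mean of u alone.
  have key : ∀ n, (eLpNorm u 2 μ).toReal ≤ (eLpNorm (fun x => u x - φ n x) 2 μ).toReal +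
      C * ((eLpNorm G 2 μ).toReal + (eLpNorm (fun x => G x - gradient (φ n) x) 2 μ).toReal) := by
    intro n
    obtain ⟨m, hm⟩ := exists_poincare_of_contDiff hK hconv hR hKR (h1 n).smooth (h1 n).compact
    have φL : MemLp (φ n) 2 μ := (h1 n).memLp 2 μ
    have gL : MemLp (gradient (φ n)) 2 μ := (h1 n).memLp_gradient 2 μ
    have mL : MemLp (fun _ : Rd d => m) 2 μ := memLp_const m
    have e1 : (eLpNorm u 2 μ).toReal ≤ (eLpNorm (fun x => u x - m) 2 μ).toReal := by
      refine le_of_sq_le_sq ?_ ENNReal.toReal_nonneg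
      rw [← integral_norm_sq_eq_toReal_eLpNorm_sq uL,
        ← integral_norm_sq_eq_toReal_eLpNorm_sq (f := fun x => u x - m) (uL.sub mL)]
      simpa only [Real.norm_eq_abs, sq_abs] using integral_sq_le_integral_sub_const_sq uL h0 m
    have e2 : (eLpNorm (fun x => u x - m) 2 μ).toReal ≤
        (eLpNorm (fun x => u x - φ n x) 2 μ).toReal + (eLpNorm (fun x => φ n x - m) 2 μ).toReal := by
      have := tri (fun x => u x - φ n x) (fun x => φ n x - m) (uL.sub φL) (φL.sub mL)
      simpa only [sub_add_sub_cancel] using this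
    have e3 : (eLpNorm (fun x => φ n x - m) 2 μ).toReal ≤
        C * (eLpNorm (gradient (φ n)) 2 μ).toReal := by
      refine le_of_sq_le_sq ?_ (by positivity)
      rw [mul_pow, hC2, ← integral_norm_sq_eq_toReal_eLpNorm_sq gL,
        ← integral_norm_sq_eq_toReal_eLpNorm_sq (f := fun x => φ n x - m) (φL.sub mL)]
      simpa only [Real.norm_eq_abs, sq_abs] using hm
    have e4 : (eLpNorm (gradient (φ n)) 2 μ).toReal ≤ (eLpNorm G 2 μ).toReal +
        (eLpNorm (fun x => G x - gradient (φ n) x) 2 μ).toReal := by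
      have := tri G (fun x => gradient (φ n) x - G x) memG (gL.sub memG)
      rw [show (fun x => gradient (φ n) x - G x) = -fun x => G x - gradient (φ n) x by
        ext1 x; simp, eLpNorm_neg] at this
      simpa using this
    have := mul_le_mul_of_nonneg_left e4 hC
    linarith
  have lim := lim1.add ((lim2.const_add (eLpNorm G 2 μ).toReal).const_mul C)
  have fin := ge_of_tendsto' lim key
  simp only [zero_add, add_zero] at fin
  have hsq := pow_le_pow_left₀ ENNReal.toReal_nonneg fin 2
  rw [mul_pow, hC2, ← integral_norm_sq_eq_toReal_eLpNorm_sq uL,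
    ← integral_norm_sq_eq_toReal_eLpNorm_sq memG] at hsq
  simpa only [Real.norm_eq_abs, sq_abs] using hsq

/-! ### The bound on the multipliers. -/

/-- The inverse estimate for the Lagrange multipliers. -/
theorem sq_multiplier_le {d : ℕ} {D τ : Set (Rd d)}
    {a : Rd d → Matrix (Fin d) (Fin d) ℝ} {c : Rd d → ℝ} {amin amax cmax : ℝ} {ψ : Rd d → ℝ}
    {G : Rd d → Rd d} (hcoeff : IsEllipticCoeff D a c amin amax cmax) (hamin : 0 ≤ amin)
    (hamax : 0 ≤ amax) (hcmax : 0 ≤ cmax) (hψ : MemH10 D ψ G)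
    (hmD : MeasurableSet D) (hτD : τ ⊆ D) (hopen : IsOpen τ) (hconv : Convex ℝ τ) (hb : Bornology.IsBounded τ)
    (hne : τᶜ.Nonempty) {y : Rd d} {ρ : ℝ} (hρ : 0 < ρ) (hball : Metric.ball y ρ ⊆ τ) {b : ℝ}
    (hmul : ∀ v : Rd d → ℝ, IsTestFun τ v →
      ∫ x in D, energyDensity a c ψ G v (gradient v) x = b * ∫ x in τ, v x) :
    b ^ 2 * volume.real τ * ρ ^ 2 ≤
      energySq a c τ ψ G * (amax * (d * (d + 2)) + cmax * ρ ^ 2 * (d + 2) ^ 2 / 4) := by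
  set V := volume.real τ
  set e := energySq a c τ ψ G
  have he : 0 ≤ e := hcoeff.energySq_nonneg hamin hτD ψ G
  have hfin : volume τ < ⊤ := hb.measure_lt_top
  have : IsFiniteMeasure (volume.restrict τ) := ⟨by simpa using hfin⟩
  have hV : 0 < V := by
    have : τ.Nonempty := ⟨y, hball (Metric.mem_ball_self hρ)⟩
    exact ENNReal.toReal_pos (hopen.measure_pos _ this).ne' hfin.ne
  set θ : ℝ := d / (d + 2)
  have hθ : 1 - θ = 2 / (d + 2) := by
    simp only [θ]
    field_simp
    ring
  have hθ0 : 0 < 1 - θ := by rw [hθ]; positivity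
  set g : Rd d → ℝ := fun x => min (Metric.infDist x τᶜ) ρ
  have gc : Continuous g := by
    have := Metric.continuous_infDist_pt τᶜ
    fun_prop
  have g0 : ∀ x, 0 ≤ g x := fun x => le_min Metric.infDist_nonneg hρ.le
  have g1 : ∀ x, g x ≤ ρ := fun x => min_le_right _ _
  have bddInt : ∀ f : Rd d → ℝ, Continuous f → (∃ C, ∀ x, |f x| ≤ C) → IntegrableOn f τ :=
    fun f hf ⟨C, hC⟩ => Integrable.of_bound hf.aestronglyMeasurable C (.of_forall hC)
  have ig : IntegrableOn (fun x => (ρ - g x) ^ 2) τ := by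
    refine bddInt _ (by fun_prop) ⟨ρ ^ 2, fun x => ?_⟩
    rw [abs_of_nonneg (sq_nonneg _)]
    exact pow_le_pow_left₀ (sub_nonneg.2 (g1 x)) (by linarith [g0 x]) 2
  have hQ : ∫ x in τ, (ρ - g x) ^ 2 ≤ ρ ^ 2 * V * θ := by
    have h := integral_one_sub_infDist_sq_le hopen hconv hb hne hρ hball
    have e1 : ∀ x, (ρ - g x) ^ 2 = ρ ^ 2 * (1 - g x / ρ) ^ 2 := fun x => by
      field_simp
    simp only [e1]
    rw [integral_const_mul]
    calc _ ≤ ρ ^ 2 * (θ * V) := mul_le_mul_of_nonneg_left h (by positivity)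
      _ = _ := by ring
  -- The smallness of ε keeps the lower bound for ∫ v positive, so that it may be squared.
  have key : ∀ ε : ℝ, 0 < ε → (2 * ρ * ε + ε ^ 2) * V < ρ ^ 2 * V * (1 - θ) →
      b ^ 2 * (ρ ^ 2 * V * (1 - θ) - (2 * ρ * ε + ε ^ 2) * V) ^ 2 ≤
      e * (4 * amax * (ρ ^ 2 * V * θ + (2 * ρ * ε + ε ^ 2) * V) + cmax * ((ρ + ε) ^ 4 * V)) := by
    intro ε hε hsmall
    obtain ⟨f, hf, hf1, hf2⟩ := exists_isTestFun_approx_infDist (τ := τ) hb (ρ := ρ)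
      (show 0 < ε / 3 by positivity)
    have hfg : ∀ x, |f x - g x| ≤ ε := fun x => by
      have := hf2 x
      rw [max_eq_left (g0 x)] at this
      linarith
    have fc := hf.smooth.continuous
    -- Since v = ρ² - (ρ - f)² and |∇v| ≤ 2|ρ - f|, the single integral q controls both the mass of
    -- v and its gradient energy. On a ball of radius ρ, with f the exact distance to the boundary,
    -- v is the paraboloid ρ² - |x - y|².
    set v : Rd d → ℝ := fun x => (2 * ρ - f x) * f x
    have hv : IsTestFun τ v := hf.smooth_mul (contDiff_const.sub hf.smooth)
    have vc := hv.smooth.continuous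
    have gv : ∀ x, ‖gradient v x‖ ^ 2 ≤ 4 * (ρ - f x) ^ 2 := by
      intro x
      have hgv : gradient v x = (2 * (ρ - f x)) • gradient f x := by
        have hsub : gradient (fun y => 2 * ρ - f y) x = -gradient f x := by
          simp [gradient, fderiv_const_sub]
        rw [gradient_mul_apply (contDiff_const.sub hf.smooth) hf.smooth, hsub]
        module
      rw [hgv, norm_smul, mul_pow, Real.norm_eq_abs, sq_abs]
      have := pow_le_pow_left₀ (norm_nonneg _) (hf1 x) 2
      nlinarith [sq_nonneg (ρ - f x)]
    have hfρ : ∀ x, |ρ - f x| ≤ ρ - g x + ε := fun x => by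
      have h1 := abs_le.1 (hfg x)
      exact abs_le.2 ⟨by linarith [g1 x], by linarith⟩
    have hw : ∀ x, (ρ - f x) ^ 2 ≤ (ρ - g x) ^ 2 + (2 * ρ * ε + ε ^ 2) := fun x => by
      rw [← sq_abs]
      have := pow_le_pow_left₀ (abs_nonneg _) (hfρ x) 2
      nlinarith [g0 x, g1 x]
    have hv2 : ∀ x, v x ^ 2 ≤ (ρ + ε) ^ 4 := fun x => by
      have h1 : (ρ - f x) ^ 2 ≤ (ρ + ε) ^ 2 := by
        rw [← sq_abs]
        exact pow_le_pow_left₀ (abs_nonneg _) ((hfρ x).trans (by linarith [g0 x])) 2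
      have h2 : v x = ρ ^ 2 - (ρ - f x) ^ 2 := by simp only [v]; ring
      have h3 : |v x| ≤ (ρ + ε) ^ 2 := by
        rw [h2]
        exact abs_le.2 ⟨by nlinarith, by nlinarith [sq_nonneg (ρ - f x)]⟩
      calc v x ^ 2 = |v x| ^ 2 := (sq_abs _).symm
        _ ≤ ((ρ + ε) ^ 2) ^ 2 := pow_le_pow_left₀ (abs_nonneg _) h3 2
        _ = _ := by ring
    have ifr : IntegrableOn (fun x => (ρ - f x) ^ 2) τ := by
      refine bddInt _ (by fun_prop) ⟨ρ ^ 2 + (2 * ρ * ε + ε ^ 2), fun x => ?_⟩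
      rw [abs_of_nonneg (sq_nonneg _)]
      refine (hw x).trans (add_le_add_left ?_ _)
      exact pow_le_pow_left₀ (sub_nonneg.2 (g1 x)) (by linarith [g0 x]) 2
    have iv2 : IntegrableOn (fun x => v x ^ 2) τ := by
      refine bddInt _ (by fun_prop) ⟨(ρ + ε) ^ 4, fun x => ?_⟩
      rw [abs_of_nonneg (sq_nonneg _)]
      exact hv2 x
    have igv : IntegrableOn (fun x => ‖gradient v x‖ ^ 2) τ := by
      have : MemLp (gradient v) ((2 : ℕ) : ℝ≥0∞) (volume.restrict τ) := hv.memLp_gradient _ _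
      exact this.integrable_norm_pow two_ne_zero
    set q := ∫ x in τ, (ρ - f x) ^ 2
    have hq : q ≤ ρ ^ 2 * V * θ + (2 * ρ * ε + ε ^ 2) * V := by
      calc q ≤ ∫ x in τ, ((ρ - g x) ^ 2 + (2 * ρ * ε + ε ^ 2)) :=
            integral_mono ifr (Integrable.fun_add ig (integrable_const _)) hw
        _ = (∫ x in τ, (ρ - g x) ^ 2) + (2 * ρ * ε + ε ^ 2) * V := by
            rw [integral_add ig (integrable_const _), setIntegral_const, smul_eq_mul]
            ring
        _ ≤ _ := by linarith
    have hvint : ∫ x in τ, v x = ρ ^ 2 * V - q := by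
      have : ∀ x, v x = ρ ^ 2 - (ρ - f x) ^ 2 := fun x => by simp only [v]; ring
      simp only [this]
      rw [integral_sub (integrable_const _) ifr, setIntegral_const, smul_eq_mul]
      ring
    have hEv : energySq a c τ v (gradient v) ≤ 4 * amax * q + cmax * ((ρ + ε) ^ 4 * V) := by
      rw [energySq_eq_integral]
      have hvH := MemH10.of_isTestFun (hv.mono hτD)
      calc _ ≤ ∫ x in τ, (amax * ‖gradient v x‖ ^ 2 + cmax * v x ^ 2) :=
            integral_mono_ae ((hcoeff.integrable_energyDensity hamin hvH.memLp hvH.memLp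
              hvH.memLp_grad hvH.memLp_grad).mono_measure (Measure.restrict_mono_set _ hτD))
              ((igv.const_mul _).add (iv2.const_mul _))
              (ae_restrict_of_ae_restrict_of_subset hτD (hcoeff.energyDensity_self_le v _))
        _ ≤ ∫ x in τ, (4 * amax * (ρ - f x) ^ 2 + cmax * (ρ + ε) ^ 4) := by
            refine integral_mono ((igv.const_mul _).add (iv2.const_mul _))
              ((ifr.const_mul _).add (integrable_const _)) fun x => ?_
            have h1 := mul_le_mul_of_nonneg_left (gv x) hamax
            have h2 := mul_le_mul_of_nonneg_left (hv2 x) hcmax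
            simp only
            linarith
        _ = _ := by
            rw [integral_add (ifr.const_mul _) (integrable_const _), integral_const_mul,
              setIntegral_const, smul_eq_mul]
            ring
    have hloc : ∫ x in D, energyDensity a c ψ G v (gradient v) x =
        ∫ x in τ, energyDensity a c ψ G v (gradient v) x := by
      refine (setIntegral_eq_of_subset_of_forall_sdiff_eq_zero hmD hτD fun x hx => ?_)
      simp [energyDensity, hv.eq_zero hx.2, hv.gradient_eq_zero hx.2]
    have hcs := hcoeff.sq_integral_energyDensity_le hamin hτD hψ.memLp
      (hv.memLp 2 (volume.restrict D)) hψ.memLp_grad (hv.memLp_gradient 2 (volume.restrict D))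
    rw [← hloc, hmul v hv, hvint, mul_pow] at hcs
    have hpos : 0 ≤ ρ ^ 2 * V * (1 - θ) - (2 * ρ * ε + ε ^ 2) * V := by linarith
    calc _ ≤ b ^ 2 * (ρ ^ 2 * V - q) ^ 2 := by
          refine mul_le_mul_of_nonneg_left (pow_le_pow_left₀ hpos ?_ 2) (sq_nonneg _)
          linarith
      _ ≤ _ := hcs
      _ ≤ e * (4 * amax * q + cmax * ((ρ + ε) ^ 4 * V)) := mul_le_mul_of_nonneg_left hEv he
      _ ≤ _ := by
          refine mul_le_mul_of_nonneg_left ?_ he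
          have := mul_le_mul_of_nonneg_left hq (by positivity : 0 ≤ 4 * amax)
          linarith
  have lim : b ^ 2 * (ρ ^ 2 * V * (1 - θ)) ^ 2 ≤
      e * (4 * amax * (ρ ^ 2 * V * θ) + cmax * (ρ ^ 4 * V)) := by
    have cl : ContinuousAt (fun ε : ℝ => b ^ 2 *
        (ρ ^ 2 * V * (1 - θ) - (2 * ρ * ε + ε ^ 2) * V) ^ 2) 0 := by fun_prop
    have cr : ContinuousAt (fun ε : ℝ => e * (4 * amax * (ρ ^ 2 * V * θ + (2 * ρ * ε + ε ^ 2) * V)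
      + cmax * ((ρ + ε) ^ 4 * V))) 0 := by fun_prop
    have cs : ContinuousAt (fun ε : ℝ => (2 * ρ * ε + ε ^ 2) * V) 0 := by fun_prop
    have hs := (cs.tendsto.mono_left (nhdsWithin_le_nhds (s := Ioi 0))).eventually
      (gt_mem_nhds (show (2 * ρ * 0 + 0 ^ 2) * V < ρ ^ 2 * V * (1 - θ) by
        simp only [mul_zero, ne_eq, OfNat.ofNat_ne_zero, not_false_eq_true, zero_pow, add_zero,
          zero_mul]
        positivity))
    have := le_of_tendsto_of_tendsto (cl.tendsto.mono_left (nhdsWithin_le_nhds (s := Ioi 0)))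
      (cr.tendsto.mono_left (nhdsWithin_le_nhds (s := Ioi 0)))
      (by filter_upwards [hs, self_mem_nhdsWithin] with ε h1 h2 using key ε h2 h1)
    simpa using this
  -- Because 1 - θ = 2/(d + 2), division by this factor turns 4θ/(1 - θ)² into d(d + 2) and 1/(1 -
  -- θ)² into (d + 2)²/4.
  have hcoef : 0 < ρ ^ 2 * V * (1 - θ) ^ 2 := by positivity
  refine le_of_mul_le_mul_left ?_ hcoef
  calc _ = b ^ 2 * (ρ ^ 2 * V * (1 - θ)) ^ 2 := by ring
    _ ≤ _ := lim
    _ = _ := by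
      rw [hθ]
      simp only [θ]
      field_simp
      ring

/-! ### The error on one element. -/

/-- A point farther away would lie more than a diameter from the opposite side of the inscribed
ball. With ρ = δL/2, where L is the diameter, the Poincaré radius improves from L to (1 - δ/2)L. -/
theorem subset_closedBall_of_inscribed {d : ℕ} {τ : Set (Rd d)} (hb : Bornology.IsBounded τ)
    {y : Rd d} {ρ : ℝ} (hρ : 0 < ρ) (hρd : ρ ≤ Metric.diam τ) (hball : Metric.ball y ρ ⊆ τ) :
    τ ⊆ Metric.closedBall y (Metric.diam τ - ρ) := by
  intro z hz
  rw [Metric.mem_closedBall, dist_eq_norm]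
  rcases eq_or_ne z y with rfl | hzy
  · simpa using hρd
  have hn : 0 < ‖z - y‖ := norm_pos_iff.2 (sub_ne_zero.2 hzy)
  by_contra! hlt
  have hzd : ‖z - y‖ ≤ Metric.diam τ := by
    rw [← dist_eq_norm]
    exact Metric.dist_le_diam_of_mem hb hz (hball (Metric.mem_ball_self hρ))
  -- The midpoint between diam τ - ‖z - y‖ and ρ: the opposite point w at distance t from y is still
  -- in the ball, yet too far from z.
  set t := (ρ + Metric.diam τ - ‖z - y‖) / 2 with ht_def
  have ht0 : 0 ≤ t := by rw [ht_def]; linarith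
  have htρ : t < ρ := by rw [ht_def]; linarith
  set w := y - (t / ‖z - y‖) • (z - y) with hw_def
  have hw : w ∈ τ := hball (by
    rw [mem_ball_iff_norm, hw_def, sub_sub_cancel_left, norm_neg, norm_smul,
      Real.norm_of_nonneg (by positivity), div_mul_cancel₀ _ hn.ne']
    exact htρ)
  have hd := Metric.dist_le_diam_of_mem hb hz hw
  have e : z - w = (1 + t / ‖z - y‖) • (z - y) := by
    rw [hw_def]
    module
  rw [dist_eq_norm, e, norm_smul, Real.norm_of_nonneg (by positivity), add_mul,
    div_mul_cancel₀ _ hn.ne', one_mul] at hd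
  rw [ht_def] at hd
  linarith

/-- The midrange of f works, and saves a factor 2 over taking a value of f. -/
theorem exists_forall_abs_sub_le_half {ι : Type*} {S : Set ι} (hS : S.Nonempty) {f : ι → ℝ} {B : ℝ}
    (hB : ∀ x ∈ S, ∀ y ∈ S, |f x - f y| ≤ B) : ∃ m, ∀ x ∈ S, |f x - m| ≤ B / 2 := by
  obtain ⟨x0, hx0⟩ := hS
  have hne : (f '' S).Nonempty := ⟨_, mem_image_of_mem f hx0⟩
  have hup : BddAbove (f '' S) := ⟨f x0 + B, by
    rintro _ ⟨y, hy, rfl⟩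
    linarith [(abs_le.1 (hB y hy x0 hx0)).2]⟩
  have hlo : BddBelow (f '' S) := ⟨f x0 - B, by
    rintro _ ⟨y, hy, rfl⟩
    linarith [(abs_le.1 (hB y hy x0 hx0)).1]⟩
  have hgap : sSup (f '' S) ≤ sInf (f '' S) + B := by
    refine csSup_le hne ?_
    rintro _ ⟨y, hy, rfl⟩
    rw [← sub_le_iff_le_add]
    refine le_csInf hne ?_
    rintro _ ⟨z, hz, rfl⟩
    linarith [(abs_le.1 (hB y hy z hz)).2]
  refine ⟨(sSup (f '' S) + sInf (f '' S)) / 2, fun x hx => ?_⟩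
  have h1 := le_csSup hup (mem_image_of_mem f hx)
  have h2 := csInf_le hlo (mem_image_of_mem f hx)
  exact abs_le.2 ⟨by linarith, by linarith⟩

theorem sq_integral_mul_le {Ω : Type*} [MeasurableSpace Ω] {μ : Measure Ω} {f g : Ω → ℝ}
    (hf : MemLp f 2 μ) (hg : MemLp g 2 μ) :
    (∫ x, f x * g x ∂μ) ^ 2 ≤ (∫ x, f x ^ 2 ∂μ) * ∫ x, g x ^ 2 ∂μ := by
  have ifg : Integrable (fun x => f x * g x) μ := hf.integrable_mul hg
  have := discrim_le_zero (a := ∫ x, g x ^ 2 ∂μ) (b := 2 * ∫ x, f x * g x ∂μ)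
    (c := ∫ x, f x ^ 2 ∂μ) fun s => by
      have h0 : 0 ≤ ∫ x, (f x + s * g x) ^ 2 ∂μ := integral_nonneg fun x => sq_nonneg _
      have e : ∀ x, (f x + s * g x) ^ 2 = f x ^ 2 + 2 * s * (f x * g x) + s ^ 2 * g x ^ 2 :=
        fun x => by ring
      simp only [e] at h0
      rw [integral_add (hf.integrable_sq.fun_add (ifg.const_mul _)) (hg.integrable_sq.const_mul _),
        integral_add hf.integrable_sq (ifg.const_mul _), integral_const_mul, integral_const_mul] at h0
      linarith
  rw [discrim] at this
  linarith

theorem abs_sub_le_of_norm_gradient_le {d : ℕ} {τ : Set (Rd d)} (hconv : Convex ℝ τ)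
    {η : Rd d → ℝ} (hη : ContDiff ℝ ∞ η) {M : ℝ} (hM : ∀ z ∈ τ, ‖gradient η z‖ ≤ M) {x y : Rd d}
    (hx : x ∈ τ) (hy : y ∈ τ) : |η x - η y| ≤ M * dist x y := by
  have := hconv.norm_image_sub_le_of_norm_fderiv_le (𝕜 := ℝ) (f := η) (C := M)
    (fun z _ => (hη.differentiable (by norm_cast)).differentiableAt) (fun z hz => by
      have := hM z hz
      rwa [gradient, LinearIsometryEquiv.norm_map] at this) hy hx
  rwa [Real.norm_eq_abs, ← dist_eq_norm] at this

/-- The constant of the error estimate on one element. -/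
noncomputable def elementConst (s δ amin amax : ℝ) : ℝ :=
  √(amax / amin) * (√(Real.exp 1 / 2) * (1 - δ / 2)) * (1 + s / δ)

/-- Commuting a cut-off function with the energy form costs little on each element. -/
theorem element_error_le {d : ℕ} {D τ : Set (Rd d)}
    {a : Rd d → Matrix (Fin d) (Fin d) ℝ} {c : Rd d → ℝ} {amin amax cmax : ℝ} {ψ : Rd d → ℝ}
    {G : Rd d → Rd d} (hcoeff : IsEllipticCoeff D a c amin amax cmax) (hamin : 0 < amin)
    (hamax : 0 ≤ amax) (hψ : MemH10 D ψ G)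
    (hτD : τ ⊆ D) (hopen : IsOpen τ) (hconv : Convex ℝ τ) (hb : Bornology.IsBounded τ)
    {y : Rd d} {δ : ℝ} (hδ : 0 < δ) (hδ1 : δ ≤ 1) (hdiam : 0 < Metric.diam τ)
    (hball : Metric.ball y (δ * Metric.diam τ / 2) ⊆ τ) (h0 : ∫ x in τ, ψ x = 0) {b s : ℝ}
    (hs : 0 ≤ s)
    (hbs : b ^ 2 * volume.real τ * (δ * Metric.diam τ / 2) ^ 2 ≤ s ^ 2 * amax * energySq a c τ ψ G)
    {η : Rd d → ℝ} (hη : ContDiff ℝ ∞ η) {M : ℝ} (hM0 : 0 ≤ M)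
    (hM : ∀ z ∈ τ, ‖gradient η z‖ ≤ M) :
    |∫ x in τ, energyDensity a c ψ G (fun _ => 0) (fun x => ψ x • gradient η x) x| +
      |b * ∫ x in τ, η x * ψ x| ≤
    M * Metric.diam τ * elementConst s δ amin amax * energySq a c τ ψ G := by
  set L := Metric.diam τ
  set e := energySq a c τ ψ G
  set V := volume.real τ
  have he : 0 ≤ e := hcoeff.energySq_nonneg hamin.le hτD ψ G
  have hfin : volume τ < ⊤ := hb.measure_lt_top
  have : IsFiniteMeasure (volume.restrict τ) := ⟨by simpa using hfin⟩
  have hV : 0 ≤ V := measureReal_nonneg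
  have hle : volume.restrict τ ≤ volume.restrict D := Measure.restrict_mono_set _ hτD
  have ψL : MemLp ψ 2 (volume.restrict τ) := hψ.memLp.mono_measure hle
  have memG : MemLp G 2 (volume.restrict τ) := hψ.memLp_grad.mono_measure hle
  have gη := continuous_gradient hη
  have cη := hη.continuous
  have hρ : 0 < δ * L / 2 := by positivity
  have hρL : δ * L / 2 ≤ L := by nlinarith
  have hR : 0 < L - δ * L / 2 := by nlinarith
  set P := ∫ x in τ, ψ x ^ 2
  have hP0 : 0 ≤ P := integral_nonneg fun x => sq_nonneg _
  have hPG : P ≤ Real.exp 1 / 2 * (L - δ * L / 2) ^ 2 * ∫ x in τ, ‖G x‖ ^ 2 :=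
    hψ.poincare hτD hopen.measurableSet hconv hR
      (subset_closedBall_of_inscribed hb hρ hρL hball) h0
  have iG : Integrable (fun x => ‖G x‖ ^ 2) (volume.restrict τ) :=
    MemLp.integrable_norm_pow (p := 2) (by exact_mod_cast memG) two_ne_zero
  have hGe : amin * ∫ x in τ, ‖G x‖ ^ 2 ≤ e := by
    rw [← integral_const_mul]
    simp only [e, energySq_eq_integral]
    exact integral_mono_ae (iG.const_mul _)
      ((hcoeff.integrable_energyDensity hamin.le hψ.memLp hψ.memLp hψ.memLp_grad
        hψ.memLp_grad).mono_measure hle)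
      (ae_restrict_of_ae_restrict_of_subset hτD (hcoeff.energyDensity_self_ge ψ G))
  have hP : amax * P ≤ (√(amax / amin) * (√(Real.exp 1 / 2) * (1 - δ / 2)) * L) ^ 2 * e := by
    have h1 : ∫ x in τ, ‖G x‖ ^ 2 ≤ e / amin := by
      rw [le_div_iff₀ hamin, mul_comm]
      exact hGe
    calc amax * P ≤ amax * (Real.exp 1 / 2 * (L - δ * L / 2) ^ 2 * (e / amin)) := by
          refine mul_le_mul_of_nonneg_left (hPG.trans ?_) hamax
          exact mul_le_mul_of_nonneg_left h1 (by positivity)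
      _ = _ := by
          rw [mul_pow, mul_pow, mul_pow, Real.sq_sqrt (by positivity), Real.sq_sqrt (by positivity)]
          ring
  set Q := √(amax / amin) * (√(Real.exp 1 / 2) * (1 - δ / 2)) * L
  have hQ : 0 ≤ Q := by
    have : 0 ≤ 1 - δ / 2 := by linarith
    positivity
  have b1 : |∫ x in τ, energyDensity a c ψ G (fun _ => 0) (fun x => ψ x • gradient η x) x| ≤
      M * Q * e := by
    have gψ : MemLp (fun x => ψ x • gradient η x) 2 (volume.restrict τ) :=
      ψL.of_le_mul (c := M) (ψL.1.smul gη.aestronglyMeasurable)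
        ((ae_restrict_mem hopen.measurableSet).mono fun x hx => by
          rw [norm_smul, mul_comm]
          exact mul_le_mul_of_nonneg_right (hM x hx) (norm_nonneg _))
    -- The bound on ∇η is known only on τ, so Cauchy–Schwarz is applied with τ in the role of the
    -- domain.
    have hcτ : IsEllipticCoeff τ a c amin amax cmax :=
      ⟨fun p q => (hcoeff.measurable_a p q).mono_measure hle, hcoeff.measurable_c.mono_measure hle,
        ae_restrict_of_ae_restrict_of_subset hτD hcoeff.symm,
        ae_restrict_of_ae_restrict_of_subset hτD hcoeff.lower,
        ae_restrict_of_ae_restrict_of_subset hτD hcoeff.upper,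
        ae_restrict_of_ae_restrict_of_subset hτD hcoeff.bound_c⟩
    have z0 : MemLp (fun _ : Rd d => (0 : ℝ)) 2 (volume.restrict τ) := memLp_const 0
    have hcs := hcτ.sq_integral_energyDensity_le hamin.le subset_rfl ψL z0 memG gψ
    have hE : energySq a c τ (fun _ => 0) (fun x => ψ x • gradient η x) ≤ amax * (M ^ 2 * P) := by
      rw [energySq_eq_integral, ← integral_const_mul, ← integral_const_mul]
      refine integral_mono_ae (hcτ.integrable_energyDensity hamin.le z0 z0 gψ gψ)
        ((ψL.integrable_sq.const_mul _).const_mul _) ?_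
      filter_upwards [hcτ.energyDensity_self_le (fun _ => 0) (fun x => ψ x • gradient η x),
        ae_restrict_mem hopen.measurableSet] with x hx hxτ
      refine hx.trans ?_
      have := pow_le_pow_left₀ (norm_nonneg _) (hM x hxτ) 2
      simp only [norm_smul, mul_pow, Real.norm_eq_abs, sq_abs, ne_eq, OfNat.ofNat_ne_zero,
        not_false_eq_true, zero_pow, mul_zero, add_zero]
      refine mul_le_mul_of_nonneg_left ?_ hamax
      rw [mul_comm]
      exact mul_le_mul_of_nonneg_right this (sq_nonneg _)
    refine abs_le_of_sq_le_sq (hcs.trans ?_) (by positivity)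
    calc e * energySq a c τ (fun _ => 0) (fun x => ψ x • gradient η x)
        ≤ e * (amax * (M ^ 2 * P)) := mul_le_mul_of_nonneg_left hE he
      _ = e * M ^ 2 * (amax * P) := by ring
      _ ≤ e * M ^ 2 * (Q ^ 2 * e) := mul_le_mul_of_nonneg_left hP (by positivity)
      _ = _ := by ring
  have b2 : |b * ∫ x in τ, η x * ψ x| ≤ s / δ * (M * Q * e) := by
    have hne : τ.Nonempty := ⟨y, hball (Metric.mem_ball_self hρ)⟩
    -- As ψ has mean zero, η may be replaced by η - m. The half in M L / 2 cancels the one in the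
    -- radius δL/2, which leaves the factor s/δ.
    obtain ⟨m, hm⟩ := exists_forall_abs_sub_le_half hne (f := η) (B := M * L) fun x hx z hz =>
      (abs_sub_le_of_norm_gradient_le hconv hη hM hx hz).trans
        (mul_le_mul_of_nonneg_left (Metric.dist_le_diam_of_mem hb hx hz) hM0)
    have ηL : MemLp (fun x => η x - m) 2 (volume.restrict τ) :=
      MemLp.of_bound (by fun_prop : Continuous fun x => η x - m).aestronglyMeasurable (M * L / 2)
        ((ae_restrict_mem hopen.measurableSet).mono fun x hx => hm x hx)
    have i1 : Integrable (fun x => (η x - m) * ψ x) (volume.restrict τ) := ηL.integrable_mul ψL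
    have i2 : Integrable ψ (volume.restrict τ) := ψL.integrable (by norm_num)
    have e1 : ∫ x in τ, η x * ψ x = ∫ x in τ, (η x - m) * ψ x := by
      have : ∀ x, η x * ψ x = (η x - m) * ψ x + m * ψ x := fun x => by ring
      simp only [this]
      rw [integral_add i1 (i2.const_mul _), integral_const_mul, h0]
      ring
    have e2 : ∫ x in τ, (η x - m) ^ 2 ≤ (M * L / 2) ^ 2 * V := by
      calc _ ≤ ∫ x in τ, (M * L / 2) ^ 2 :=
            integral_mono_ae ηL.integrable_sq (integrable_const _)
              ((ae_restrict_mem hopen.measurableSet).mono fun x hx => by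
                simp only
                rw [← sq_abs]
                exact pow_le_pow_left₀ (abs_nonneg _) (hm x hx) 2)
        _ = _ := by rw [setIntegral_const, smul_eq_mul, mul_comm]
    have hcs := sq_integral_mul_le ηL ψL
    refine abs_le_of_sq_le_sq ?_ (by positivity)
    rw [e1, mul_pow]
    calc _ ≤ b ^ 2 * ((M * L / 2) ^ 2 * V * P) := by
          refine mul_le_mul_of_nonneg_left (hcs.trans ?_) (sq_nonneg _)
          exact mul_le_mul_of_nonneg_right e2 hP0
      _ = (b ^ 2 * V * (δ * L / 2) ^ 2) * (M ^ 2 * P / δ ^ 2) := by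
          field_simp
      _ ≤ (s ^ 2 * amax * e) * (M ^ 2 * P / δ ^ 2) :=
          mul_le_mul_of_nonneg_right hbs (by positivity)
      _ = (s ^ 2 * e * M ^ 2 / δ ^ 2) * (amax * P) := by ring
      _ ≤ (s ^ 2 * e * M ^ 2 / δ ^ 2) * (Q ^ 2 * e) :=
          mul_le_mul_of_nonneg_left hP (by positivity)
      _ = _ := by
          field_simp
  calc _ ≤ M * Q * e + s / δ * (M * Q * e) := add_le_add b1 b2
    _ = _ := by
      simp only [elementConst, Q]
      ring

/-! ### The exponential cut-off function. -/

/-- A smooth truncation of `s ↦ s - 1` to the interval `[1, T]`. -/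
theorem exists_smooth_truncation {T ε : ℝ} (hε : 0 < ε) (hT : 1 + 4 * ε ≤ T) :
    ∃ θ : ℝ → ℝ, ContDiff ℝ ∞ θ ∧ LipschitzWith 1 θ ∧ (∀ s < 1 + ε, θ s = 0) ∧
      (∃ k, ∀ s, T - ε < s → θ s = k) ∧ ∀ s, min s T - 1 - 5 * ε ≤ θ s := by
  -- The margins 2ε leave flat pieces that survive mollification at scale ε. The losses 2ε at the
  -- cap, 2ε in the shift and ε from mollifying add up to 5ε.
  set f : ℝ → ℝ := fun s => min (max s (1 + 2 * ε)) (T - 2 * ε) - (1 + 2 * ε)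
  have hf : LipschitzWith 1 f := by
    refine LipschitzWith.of_dist_le_mul fun x y => ?_
    have := ((LipschitzWith.id.max_const (1 + 2 * ε)).min_const (T - 2 * ε)).dist_le_mul x y
    simpa [f, dist_sub_right] using this
  have flo : ∀ s ≤ 1 + 2 * ε, f s = 0 := fun s hs => by
    simp only [f]
    rw [max_eq_right hs, min_eq_left (by linarith), sub_self]
  have fhi : ∀ s, T - 2 * ε ≤ s → f s = T - 2 * ε - (1 + 2 * ε) := fun s hs => by
    simp only [f]
    rw [min_eq_right (hs.trans (le_max_left _ _))]
  obtain ⟨θ, h1, h2, h3, h4⟩ := hf.exists_contDiff_approx hε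
  refine ⟨θ, h1, h2, fun s hs => ?_, ⟨T - 2 * ε - (1 + 2 * ε), fun s hs => ?_⟩, fun s => ?_⟩
  · have h := flo s (by linarith)
    rw [h4 s fun y hy => ?_, h]
    rw [h, flo y]
    rw [Metric.mem_ball, Real.dist_eq] at hy
    linarith [(abs_lt.1 hy).2]
  · have h := fhi s (by linarith)
    rw [h4 s fun y hy => ?_, h]
    rw [h, fhi y]
    rw [Metric.mem_ball, Real.dist_eq] at hy
    linarith [(abs_lt.1 hy).1]
  · have := (abs_le.1 (h3 s)).1
    rw [NNReal.coe_one, one_mul] at this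
    have hmin : min s T - 2 * ε ≤ min (max s (1 + 2 * ε)) (T - 2 * ε) := by
      refine le_min ?_ ?_
      · linarith [min_le_left s T, le_max_left s (1 + 2 * ε)]
      · linarith [min_le_right s T]
    simp only [f] at this
    linarith

/-- The exponential weight centred at `x`. -/
noncomputable def expWeight {d : ℕ} (x : Rd d) (α h : ℝ) (y : Rd d) : ℝ :=
  Real.exp (α * (dist y x / h - 1))

theorem continuous_expWeight {d : ℕ} (x : Rd d) (α h : ℝ) : Continuous (expWeight x α h) := by
  unfold expWeight
  fun_prop

theorem expWeight_le_mul {d : ℕ} {x y z : Rd d} {α h : ℝ} (hα : 0 ≤ α) (hh : 0 < h)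
    (hyz : dist z y ≤ h) : expWeight x α h z ≤ Real.exp α * expWeight x α h y := by
  rw [expWeight, expWeight, ← Real.exp_add, Real.exp_le_exp]
  have h1 : dist z x / h ≤ dist y x / h + 1 := by
    rw [div_add_one hh.ne']
    exact div_le_div_of_nonneg_right (by linarith [dist_triangle z y x]) hh.le
  nlinarith

/-- A smooth cut-off function following the truncated exponential weight. -/
theorem exists_cutoff {d : ℕ} (x : Rd d) {α h T ε : ℝ} (hα : 0 < α) (hh : 0 < h) (hε : 0 < ε)
    (hT : 1 + 4 * ε ≤ T) :
    ∃ η : Rd d → ℝ, ContDiff ℝ ∞ η ∧ (∀ y, expWeight x α h y ≤ 1 → η y = 0 ∧ gradient η y = 0) ∧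
      (∀ y, T ≤ expWeight x α h y → gradient η y = 0) ∧
      (∀ y, ‖gradient η y‖ ≤ α / h * expWeight x α h y) ∧
      ∀ y, min (expWeight x α h y) T - 1 - 5 * ε ≤ η y := by
  obtain ⟨θ, t1, t2, t3, ⟨k, t4⟩, t5⟩ := exists_smooth_truncation hε hT
  set W := expWeight x α h
  have Wc : Continuous W := continuous_expWeight x α h
  have const_grad : ∀ (η : Rd d → ℝ) (y : Rd d) (k : ℝ), η =ᶠ[nhds y] (fun _ => k) →
      gradient η y = 0 := fun η y k hk => by
    rw [gradient, hk.fderiv_eq, fderiv_fun_const]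
    simp
  have low : ∀ y, W y ≤ 1 → (fun y => θ (W y)) =ᶠ[nhds y] fun _ => 0 := fun y hy => by
    have : ∀ᶠ z in nhds y, W z < 1 + ε := Wc.continuousAt.eventually (gt_mem_nhds (by linarith))
    exact this.mono fun z hz => t3 _ hz
  have high : ∀ y, T ≤ W y → (fun y => θ (W y)) =ᶠ[nhds y] fun _ => k := fun y hy => by
    have : ∀ᶠ z in nhds y, T - ε < W z := Wc.continuousAt.eventually (lt_mem_nhds (by linarith))
    exact this.mono fun z hz => t4 _ hz
  -- The distance to x is not smooth at x, but W < 1 there, so the cut-off is constant near x.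
  have one_lt : ∀ y, 1 < W y → y - x ≠ 0 := by
    intro y hy h0
    rw [sub_eq_zero] at h0
    simp only [W, expWeight, h0, dist_self, zero_div, zero_sub, mul_neg, mul_one] at hy
    have := Real.exp_le_one_iff.2 (show -α ≤ 0 by linarith)
    linarith
  refine ⟨fun y => θ (W y), contDiff_iff_contDiffAt.2 fun y => ?_,
    fun y hy => ⟨t3 _ (by linarith), const_grad _ _ 0 (low y hy)⟩,
    fun y hy => const_grad _ _ k (high y hy), fun y => ?_, fun y => t5 _⟩
  · rcases le_or_gt (W y) 1 with hy | hy
    · exact contDiffAt_const.congr_of_eventuallyEq (low y hy)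
    · have hd : ContDiffAt ℝ ∞ (fun y => ‖y - x‖) y :=
        (contDiffAt_id.sub contDiffAt_const).norm ℝ (one_lt y hy)
      have : ContDiffAt ℝ ∞ W y := by
        simp only [W]
        exact ((contDiffAt_const.mul ((hd.div_const h).sub contDiffAt_const))).exp
      exact t1.contDiffAt.comp y this
  · rcases le_or_gt (W y) 1 with hy | hy
    · rw [const_grad _ _ 0 (low y hy), norm_zero]
      have : 0 < W y := Real.exp_pos _
      positivity
    · have hd : HasFDerivAt (fun y => dist y x) (fderiv ℝ (fun y => dist y x) y) y := by
        have : ContDiffAt ℝ 1 (fun y => ‖y - x‖) y :=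
          (contDiffAt_id.sub contDiffAt_const).norm ℝ (one_lt y hy)
        simp only [dist_eq_norm]
        exact (this.differentiableAt one_ne_zero).hasFDerivAt
      have hn : ‖fderiv ℝ (fun y => dist y x) y‖ ≤ 1 := by
        have := norm_fderiv_le_of_lipschitz ℝ (x₀ := y) (LipschitzWith.dist_left x)
        simpa using this
      have h1 : HasDerivAt (fun t : ℝ => Real.exp (α * (t / h - 1)))
          (W y * (α * (1 / h))) (dist y x) :=
        ((((hasDerivAt_id _).div_const h).sub_const 1).const_mul α).exp
      have h2 := (t1.differentiable (by norm_cast) (W y)).hasDerivAt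
      have h3 := (h2.comp (dist y x) h1).comp_hasFDerivAt y hd
      have h4 : ‖deriv θ (W y)‖ ≤ 1 := by simpa using norm_deriv_le_of_lipschitz t2 (x₀ := W y)
      have hW : 0 < W y := Real.exp_pos _
      rw [gradient, LinearIsometryEquiv.norm_map]
      change ‖fderiv ℝ ((θ ∘ fun t : ℝ => Real.exp (α * (t / h - 1))) ∘ fun y => dist y x) y‖ ≤ _
      rw [h3.fderiv, norm_smul, norm_mul, Real.norm_of_nonneg (by positivity : 0 ≤ W y * (α * (1 / h)))]
      calc _ ≤ 1 * (W y * (α * (1 / h))) * 1 := by gcongr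
        _ = _ := by ring

/-! ### The weighted energy argument. -/

section Decay

variable {d m : ℕ} {D : Set (Rd d)} {a : Rd d → Matrix (Fin d) (Fin d) ℝ} {c : Rd d → ℝ}
  {amin amax cmax : ℝ} {τ : Fin m → Set (Rd d)} {δ : ℝ} {i : Fin m} {ψ : Rd d → ℝ}
  {G : Rd d → Rd d}

theorem energyDensity_mul_cutoff {η : Rd d → ℝ} (x : Rd d) :
    energyDensity a c ψ G (fun x => η x * ψ x) (fun x => η x • G x + ψ x • gradient η x) x =
      η x * energyDensity a c ψ G ψ G x +
      energyDensity a c ψ G (fun _ => 0) (fun x => ψ x • gradient η x) x := by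
  simp only [energyDensity, WithLp.ofLp_add, WithLp.ofLp_smul, Matrix.mulVec_add,
    Matrix.mulVec_smul, dotProduct_add, dotProduct_smul, smul_eq_mul]
  ring

/-- The energy weighted by a cut-off function is bounded by the elementwise errors. -/
theorem integral_cutoff_mul_energyDensity_le (hcoeff : IsEllipticCoeff D a c amin amax cmax)
    (hamin : 0 ≤ amin) (hD : MeasurableSet D) (hDb : Bornology.IsBounded D)
    (hτ : IsRegularPartition D τ δ) (hψ : MemH10 D ψ G) {b : Fin m → ℝ}
    (hb : ∀ (v : Rd d → ℝ) (H : Rd d → Rd d), MemH10 D v H →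
      ∫ x in D, energyDensity a c ψ G v H x = ∑ j, b j * ∫ x in τ j, v x)
    {η : Rd d → ℝ} (hη : ContDiff ℝ ∞ η) :
    Integrable (fun x => η x * energyDensity a c ψ G ψ G x) (volume.restrict D) ∧
    ∫ x in D, η x * energyDensity a c ψ G ψ G x ≤
      ∑ j, (|∫ x in τ j, energyDensity a c ψ G (fun _ => 0) (fun x => ψ x • gradient η x) x| +
        |b j * ∫ x in τ j, η x * ψ x|) := by
  have hprod := hψ.smooth_mul hD hDb hη
  have ie := hcoeff.integrable_energyDensity hamin hψ.memLp hψ.memLp hψ.memLp_grad hψ.memLp_grad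
  have ip := hcoeff.integrable_energyDensity hamin hψ.memLp hprod.memLp hψ.memLp_grad
    hprod.memLp_grad
  have i1 : Integrable (fun x => η x * energyDensity a c ψ G ψ G x) (volume.restrict D) := by
    obtain ⟨C, hC⟩ := hDb.isCompact_closure.exists_bound_of_continuousOn hη.continuous.continuousOn
    exact ie.bdd_mul (c := C) hη.continuous.aestronglyMeasurable
      ((ae_restrict_mem hD).mono fun x hx => hC x (subset_closure hx))
  have i2 : Integrable (energyDensity a c ψ G (fun _ => 0) (fun x => ψ x • gradient η x))
      (volume.restrict D) := by
    refine (ip.sub i1).congr (.of_forall fun x => ?_)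
    simp only [Pi.sub_apply]
    rw [energyDensity_mul_cutoff]
    ring
  refine ⟨i1, ?_⟩
  have h1 := hb _ _ hprod
  simp only [energyDensity_mul_cutoff] at h1
  rw [integral_add i1 i2, hτ.integral_eq_sum i2] at h1
  have h2 : ∫ x in D, η x * energyDensity a c ψ G ψ G x = ∑ j, (b j * (∫ x in τ j, η x * ψ x) -
      ∫ x in τ j, energyDensity a c ψ G (fun _ => 0) (fun x => ψ x • gradient η x) x) := by
    rw [Finset.sum_sub_distrib]
    linarith
  rw [h2]
  refine Finset.sum_le_sum fun j _ => ?_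
  have := neg_abs_le (∫ x in τ j, energyDensity a c ψ G (fun _ => 0)
    (fun x => ψ x • gradient η x) x)
  have := le_abs_self (b j * ∫ x in τ j, η x * ψ x)
  linarith

/-- Exponential decay of the energy, given the elementwise estimate. -/
theorem energySq_decay (hcoeff : IsEllipticCoeff D a c amin amax cmax)
    (hamin : 0 ≤ amin) (hD : MeasurableSet D) (hDb : Bornology.IsBounded D)
    (hτ : IsRegularPartition D τ δ) (hψ : MemH10 D ψ G) {b : Fin m → ℝ}
    (hb : ∀ (v : Rd d → ℝ) (H : Rd d → Rd d), MemH10 D v H →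
      ∫ x in D, energyDensity a c ψ G v H x = ∑ j, b j * ∫ x in τ j, v x)
    {x : Rd d} (hx : x ∈ τ i) {h A α : ℝ} (hh : 0 < h) (hdiam : ∀ j, Metric.diam (τ j) ≤ h)
    (hA : 0 ≤ A) (hα : 0 < α) (hAα : α * A * Real.exp α ≤ 1)
    (helem : ∀ j, j ≠ i → ∀ (η : Rd d → ℝ) (M : ℝ), ContDiff ℝ ∞ η → 0 ≤ M →
      (∀ z ∈ τ j, ‖gradient η z‖ ≤ M) →
      |∫ x in τ j, energyDensity a c ψ G (fun _ => 0) (fun x => ψ x • gradient η x) x| +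
        |b j * ∫ x in τ j, η x * ψ x| ≤ M * Metric.diam (τ j) * A * energySq a c (τ j) ψ G)
    {r : ℝ} (hr : 2 * h < r) :
    energySq a c (D \ Metric.ball x r) ψ G ≤
      Real.exp (-(α * (r / h - 2))) * energySq a c D ψ G := by
  -- The value of W at distance r - h from x: an element that meets {W < T} stays inside B(x, r).
  set T := Real.exp (α * (r / h - 2)) with hT_def
  set W := expWeight x α h
  have Wc : Continuous W := continuous_expWeight x α h
  have hW : ∀ y, 0 < W y := fun y => Real.exp_pos _
  have hrh : 2 < r / h := by rwa [lt_div_iff₀ hh]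
  have hT : 1 < T := Real.one_lt_exp_iff.2 (mul_pos hα (by linarith))
  have hT0 : 0 < T := by linarith
  set e := energyDensity a c ψ G ψ G
  set E := energySq a c D ψ G
  have ie : Integrable e (volume.restrict D) :=
    hcoeff.integrable_energyDensity hamin hψ.memLp hψ.memLp hψ.memLp_grad hψ.memLp_grad
  have epos : ∀ᵐ y ∂volume.restrict D, 0 ≤ e y := hcoeff.energyDensity_self_nonneg hamin ψ G
  have hbdd : ∀ j, Bornology.IsBounded (τ j) := fun j => hDb.subset (hτ.subset j)
  set w : Rd d → ℝ := fun y => min (W y) T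
  have wc : Continuous w := Wc.min continuous_const
  have w0 : ∀ y, 0 < w y := fun y => lt_min (hW y) hT0
  have wT : ∀ y, w y ≤ T := fun y => min_le_right _ _
  set k : Rd d → ℝ := (Metric.ball x r).indicator w
  have k0 : ∀ y, 0 ≤ k y := fun y => indicator_nonneg (fun z _ => (w0 z).le) y
  have kw : ∀ y, k y ≤ w y := fun y => indicator_le_self' (fun z _ => (w0 z).le) y
  have km : Measurable k := wc.measurable.indicator Metric.isOpen_ball.measurableSet
  have ik : Integrable (fun y => k y * e y) (volume.restrict D) :=
    ie.bdd_mul (c := T) km.aestronglyMeasurable (.of_forall fun y => by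
      rw [Real.norm_of_nonneg (k0 y)]; exact (kw y).trans (wT y))
  have iw : Integrable (fun y => w y * e y) (volume.restrict D) :=
    ie.bdd_mul (c := T) wc.aestronglyMeasurable (.of_forall fun y => by
      rw [Real.norm_of_nonneg (w0 y).le]; exact wT y)
  have far : ∀ y, y ∉ Metric.ball x r → w y = T := fun y hy => by
    refine min_eq_right (Real.exp_le_exp.2 (mul_le_mul_of_nonneg_left ?_ hα.le))
    have : r ≤ dist y x := not_lt.1 hy
    have := div_le_div_of_nonneg_right this hh.le
    linarith
  have near : ∀ y z, dist y z ≤ h → W z < T → y ∈ Metric.ball x r := fun y z hyz hz => by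
    have h1 := lt_of_mul_lt_mul_left (Real.exp_lt_exp.1 hz) hα.le
    have h2 : dist z x / h < (r - h) / h := by
      rw [sub_div, div_self hh.ne']
      linarith
    have h3 := (div_lt_div_iff_of_pos_right hh).1 h2
    rw [Metric.mem_ball]
    linarith [dist_triangle y z x]
  have main : ∀ ε > 0, 1 + 4 * ε ≤ T →
      T * energySq a c (D \ Metric.ball x r) ψ G ≤ (1 + 5 * ε) * E := by
    intro ε hε hεT
    obtain ⟨η, c1, c2, c3, c4, c5⟩ := exists_cutoff x hα hh hε hεT
    obtain ⟨iη, hsum⟩ := integral_cutoff_mul_energyDensity_le hcoeff hamin hD hDb hτ hψ hb c1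
    have elem : ∀ j, |∫ x in τ j, energyDensity a c ψ G (fun _ => 0)
        (fun x => ψ x • gradient η x) x| + |b j * ∫ x in τ j, η x * ψ x| ≤
        ∫ y in τ j, k y * e y := by
      intro j
      have hle : volume.restrict (τ j) ≤ volume.restrict D := Measure.restrict_mono_set _ (hτ.subset j)
      have eposj := ae_restrict_of_ae_restrict_of_subset (hτ.subset j) epos
      have rhs0 : 0 ≤ ∫ y in τ j, k y * e y :=
        integral_nonneg_of_ae (eposj.mono fun y hy => mul_nonneg (k0 y) hy)
      have hm := (hτ.isOpen j).measurableSet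
      rcases eq_or_ne j i with rfl | hji
      -- The element τ_i lies within distance h of x, where W ≤ 1. So the one element on which ψ has
      -- nonzero mean contributes nothing.
      · have hz : ∀ y ∈ τ j, η y = 0 ∧ gradient η y = 0 := fun y hy => c2 y (by
          refine Real.exp_le_one_iff.2 (mul_nonpos_of_nonneg_of_nonpos hα.le ?_)
          have : dist y x ≤ h := (Metric.dist_le_diam_of_mem (hbdd j) hy hx).trans (hdiam j)
          rw [sub_nonpos]
          exact (div_le_one hh).2 this)
        rw [setIntegral_eq_zero_of_forall_eq_zero fun y hy => by
            simp [energyDensity, (hz y hy).2],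
          setIntegral_eq_zero_of_forall_eq_zero fun y hy => by simp [(hz y hy).1]]
        simpa using rhs0
      · by_cases hact : ∃ z ∈ τ j, W z < T
        · obtain ⟨z₀, hz₀, hz₀T⟩ := hact
          -- Comparing the gradient at z with the weight at every y of the element lets its supremum
          -- M be moved inside the energy integral.
          have hgb : ∀ z ∈ τ j, ∀ y ∈ τ j, ‖gradient η z‖ ≤ α / h * (Real.exp α * w y) := by
            intro z hz y hy
            have hαh : 0 < α / h := div_pos hα hh
            rcases le_or_gt T (W z) with hzT | hzT
            · rw [c3 z hzT, norm_zero]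
              have := w0 y
              positivity
            · refine (c4 z).trans (mul_le_mul_of_nonneg_left ?_ hαh.le)
              rw [mul_min_of_nonneg _ _ (Real.exp_pos α).le]
              refine le_min (expWeight_le_mul hα.le hh ?_) ?_
              · exact (Metric.dist_le_diam_of_mem (hbdd j) hz hy).trans (hdiam j)
              · have := Real.one_le_exp hα.le
                nlinarith
          set M := sSup ((fun z => ‖gradient η z‖) '' τ j)
          have hne : ((fun z => ‖gradient η z‖) '' τ j).Nonempty := (hτ.nonempty j).image _
          have hMle : ∀ y ∈ τ j, M ≤ α / h * (Real.exp α * w y) := fun y hy => csSup_le hne (by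
            rintro _ ⟨z, hz, rfl⟩
            exact hgb z hz y hy)
          have hMge : ∀ z ∈ τ j, ‖gradient η z‖ ≤ M := fun z hz =>
            le_csSup ⟨_, by rintro _ ⟨z, hz, rfl⟩; exact hgb z hz z₀ hz₀⟩ (mem_image_of_mem _ hz)
          have hM0 : 0 ≤ M := (norm_nonneg _).trans (hMge z₀ hz₀)
          refine (helem j hji η M c1 hM0 hMge).trans ?_
          rw [energySq_eq_integral, ← integral_const_mul]
          refine integral_mono_ae ((ie.mono_measure hle).const_mul _) (ik.mono_measure hle) ?_
          filter_upwards [eposj, ae_restrict_mem hm] with y hy hyτ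
          refine mul_le_mul_of_nonneg_right ?_ hy
          have hyb : y ∈ Metric.ball x r :=
            near y z₀ ((Metric.dist_le_diam_of_mem (hbdd j) hyτ hz₀).trans (hdiam j)) hz₀T
          have hk : k y = w y := indicator_of_mem hyb w
          rw [hk]
          calc M * Metric.diam (τ j) * A ≤ (α / h * (Real.exp α * w y)) * h * A := by
                refine mul_le_mul_of_nonneg_right ?_ hA
                exact mul_le_mul (hMle y hyτ) (hdiam j) Metric.diam_nonneg
                  (hM0.trans (hMle y hyτ))
            _ = (α * A * Real.exp α) * w y := by field_simp
            _ ≤ 1 * w y := mul_le_mul_of_nonneg_right hAα (w0 y).le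
            _ = w y := one_mul _
        -- The element lies in {W ≥ T}, where the cut-off has zero gradient, so the estimate applies
        -- with M = 0.
        · push Not at hact
          refine (helem j hji η 0 c1 le_rfl fun z hz => ?_).trans (by simpa using rhs0)
          rw [c3 z (hact z hz), norm_zero]
    have h1 : ∫ y in D, η y * e y ≤ ∫ y in D, k y * e y := by
      rw [hτ.integral_eq_sum ik]
      exact hsum.trans (Finset.sum_le_sum fun j _ => elem j)
    have h2 : ∫ y in D, (w y * e y - (1 + 5 * ε) * e y) ≤ ∫ y in D, η y * e y := by
      refine integral_mono_ae (iw.sub (ie.const_mul _)) iη (epos.mono fun y hy => ?_)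
      have := mul_le_mul_of_nonneg_right (c5 y) hy
      simp only
      change (w y - 1 - 5 * ε) * e y ≤ _ at this
      linarith
    rw [integral_sub iw (ie.const_mul _), integral_const_mul] at h2
    have hE : ∫ y in D, e y = E := (energySq_eq_integral a c D ψ G).symm
    rw [hE] at h2
    -- The weights w and k agree in the ball and differ by T outside, so what remains is T times the
    -- energy outside.
    have h3 : T * energySq a c (D \ Metric.ball x r) ψ G =
        ∫ y in D, (w y * e y - k y * e y) := by
      have e1 : ∀ y, w y * e y - k y * e y = ((Metric.ball x r)ᶜ).indicator (fun y => T * e y) y := by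
        intro y
        by_cases hy : y ∈ Metric.ball x r
        · simp [k, hy]
        · have : y ∈ (Metric.ball x r)ᶜ := hy
          simp only [k, indicator_of_notMem hy, indicator_of_mem this, far y hy]
          ring
      simp only [e1]
      rw [setIntegral_indicator Metric.isOpen_ball.measurableSet.compl, integral_const_mul,
        energySq_eq_integral, sdiff_eq]
    rw [integral_sub iw ik] at h3
    linarith
  have lim : T * energySq a c (D \ Metric.ball x r) ψ G ≤ E := by
    have cont : ContinuousAt (fun ε : ℝ => (1 + 5 * ε) * E) 0 := by fun_prop
    have ct : ContinuousAt (fun ε : ℝ => 1 + 4 * ε) 0 := by fun_prop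
    have ev := (ct.tendsto.mono_left (nhdsWithin_le_nhds (s := Ioi 0))).eventually
      (ge_mem_nhds (show 1 + 4 * 0 < T by linarith))
    have := ge_of_tendsto (cont.tendsto.mono_left (nhdsWithin_le_nhds (s := Ioi 0)))
      (by filter_upwards [ev, self_mem_nhdsWithin] with ε h1 h2 using main ε h2 h1)
    simpa using this
  rw [Real.exp_neg, ← hT_def, ← div_eq_inv_mul, le_div_iff₀ hT0, mul_comm]
  exact lim

end Decay

/-! ### Numerical comparison with the decay length. -/

/-- The tangent to exp(-y) at 0.41, slightly lowered. The point 0.41 is close to the largest 1/l₁ in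
`decayLength_bounds`, reached near s = √3 and δ = 1. -/
theorem exp_neg_ge_tangent (y : ℝ) (hy : y ≤ 1.41) : 0.6636 * (1.41 - y) ≤ Real.exp (-y) := by
  have h1 : Real.exp 0.41 ≤ 1.5069 := by
    have := Real.exp_bound' (x := 0.41) (by norm_num) (by norm_num) (n := 6) (by norm_num)
    refine this.trans ?_
    norm_num [Finset.sum_range_succ, Nat.factorial]
  have h2 : 0.6636 ≤ Real.exp (-0.41) := by
    rw [Real.exp_neg, le_inv_comm₀ (by norm_num) (Real.exp_pos _)]
    refine h1.trans (by norm_num)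
  have h3 : Real.exp (-y) = Real.exp (-0.41) * Real.exp (-(y - 0.41)) := by
    rw [← Real.exp_add]
    ring_nf
  have h4 := Real.add_one_le_exp (-(y - 0.41))
  rw [h3]
  refine mul_le_mul h2 (by linarith) (by linarith) (Real.exp_pos _).le

theorem sqrt_exp_one_div_two_le : √(Real.exp 1 / 2) ≤ 1.16583 := by
  rw [Real.sqrt_le_left (by norm_num)]
  have := Real.exp_one_lt_d9
  norm_num at this ⊢
  linarith

theorem le_exp_one_sub_one_div_pi : 0.5469 ≤ (Real.exp 1 - 1) / Real.pi := by
  rw [le_div_iff₀ Real.pi_pos]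
  have := Real.exp_one_gt_d9
  have := Real.pi_lt_d6
  norm_num at *
  linarith

/-- The numerical comparison between the elementwise constant and the decay length. -/
theorem decayLength_bounds {s δ amin amax C : ℝ} (hs : 3 ≤ s ^ 2) (hs0 : 0 ≤ s) (hδ : 0 < δ)
    (hδ1 : δ ≤ 1) (hamin : 0 < amin) (hamax : amin ≤ amax) (hC : s * (3 * δ⁻¹ - 1) ≤ C) :
    2 ≤ decayLength C amin amax ∧
      (decayLength C amin amax)⁻¹ * elementConst s δ amin amax *
        Real.exp (decayLength C amin amax)⁻¹ ≤ 1 := by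
  have hs1 : 1.732 ≤ s := by nlinarith
  set t := δ⁻¹ with ht_def
  have ht : 1 ≤ t := (one_le_inv₀ hδ).2 hδ1
  set κ := √(amax / amin)
  have hκ : 1 ≤ κ := by
    rw [Real.one_le_sqrt, one_le_div hamin]
    exact hamax
  set p := (Real.exp 1 - 1) / Real.pi
  have hp : 0.5469 ≤ p := le_exp_one_sub_one_div_pi
  set l₁ := p * (1 + C)
  have hCs : s * 2 ≤ C := by
    refine le_trans ?_ hC
    exact mul_le_mul_of_nonneg_left (by linarith) hs0
  have hC0 : 0 ≤ C := by linarith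
  have hl₁' : 0.5469 * (1 + s * (3 * t - 1)) ≤ l₁ :=
    mul_le_mul hp (by linarith) (by nlinarith) (by linarith)
  have hl₁ : 2 ≤ l₁ := by nlinarith
  set l := decayLength C amin amax
  have hl : l = l₁ * κ := rfl
  have hll : l₁ ≤ l := by rw [hl]; nlinarith
  have hl2 : 2 ≤ l := hl₁.trans hll
  refine ⟨hl2, ?_⟩
  have hinv : l⁻¹ ≤ l₁⁻¹ := inv_anti₀ (by linarith) hll
  have hinv2 : l₁⁻¹ ≤ 1 / 2 := by
    rw [one_div]
    exact inv_anti₀ two_pos hl₁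
  set q := √(Real.exp 1 / 2)
  have hq : q ≤ 1.16583 := sqrt_exp_one_div_two_le
  -- The leading term on the left is about 1.17 s/δ; on the right the factor 3 in `hC` gives about
  -- 1.53 s/δ. The lower-order terms need the gain 1 - δ/2 from the smaller Poincaré radius.
  have hA : q * (1 - δ / 2) * (1 + s / δ) ≤ 0.6636 * (1.41 * l₁ - 1) := by
    have hd2 : 0 ≤ 1 - δ / 2 := by linarith
    have hsδ : s / δ = s * t := div_eq_mul_inv s δ
    have hδt : δ * t = 1 := mul_inv_cancel₀ hδ.ne'
    have h1 : q * (1 - δ / 2) * (1 + s / δ) ≤ 1.16583 * ((1 - δ / 2) * (1 + s * t)) := by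
      rw [hsδ, mul_assoc]
      exact mul_le_mul_of_nonneg_right hq (by positivity)
    have h2 : (1 - δ / 2) * (1 + s * t) = 1 + s * t - δ / 2 - s / 2 := by
      linear_combination (-s / 2) * hδt
    have h3 : 2 - t ≤ δ := by nlinarith [sq_nonneg (t - 1), mul_nonneg (sub_nonneg.2 ht) hδ.le]
    rw [h2] at h1
    have h4 : 0 ≤ (s - 1.732) * (t - 1) := mul_nonneg (by linarith) (by linarith)
    nlinarith
  have hexp : 0.6636 * (1.41 * l₁ - 1) ≤ l₁ * Real.exp (-l⁻¹) := by
    have h1 := exp_neg_ge_tangent l₁⁻¹ (by linarith)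
    have h2 : Real.exp (-l₁⁻¹) ≤ Real.exp (-l⁻¹) := Real.exp_le_exp.2 (neg_le_neg hinv)
    calc 0.6636 * (1.41 * l₁ - 1) = l₁ * (0.6636 * (1.41 - l₁⁻¹)) := by
          field_simp
      _ ≤ _ := mul_le_mul_of_nonneg_left (h1.trans h2) (by linarith)
  have hfin : elementConst s δ amin amax ≤ l * Real.exp (-l⁻¹) := by
    calc elementConst s δ amin amax = κ * (q * (1 - δ / 2) * (1 + s / δ)) := by
          simp only [elementConst]
          ring
      _ ≤ κ * (l₁ * Real.exp (-l⁻¹)) :=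
          mul_le_mul_of_nonneg_left (hA.trans hexp) (by linarith)
      _ = _ := by rw [hl]; ring
  calc l⁻¹ * elementConst s δ amin amax * Real.exp l⁻¹
      ≤ l⁻¹ * (l * Real.exp (-l⁻¹)) * Real.exp l⁻¹ := by
        gcongr
    _ = 1 := by
        rw [← mul_assoc, inv_mul_cancel₀ (by linarith), one_mul, ← Real.exp_add, neg_add_cancel,
          Real.exp_zero]

/-- Bernoulli's inequality with exponent 3/2, the smallest value of d/2 + 1. -/
theorem three_mul_inv_sub_one_le_rpow {d : ℕ} (hd : 0 < d) {δ : ℝ} (hδ : 0 < δ) (hδ1 : δ ≤ 1) :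
    3 * δ⁻¹ - 1 ≤ 2 * (1 / δ) ^ ((d : ℝ) / 2 + 1) := by
  have ht : 1 ≤ δ⁻¹ := (one_le_inv₀ hδ).2 hδ1
  have h1 := one_add_mul_self_le_rpow_one_add (s := δ⁻¹ - 1) (by linarith) (p := 3 / 2) (by norm_num)
  have hd' : (1 : ℝ) ≤ d := by exact_mod_cast hd
  have h2 : δ⁻¹ ^ (3 / 2 : ℝ) ≤ δ⁻¹ ^ ((d : ℝ) / 2 + 1) :=
    Real.rpow_le_rpow_of_exponent_le ht (by linarith)
  rw [add_sub_cancel] at h1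
  rw [one_div]
  linarith

/-! ### Regular partitions and the decay estimate. -/

section Regular

variable {d m : ℕ} {D : Set (Rd d)} {τ : Fin m → Set (Rd d)} {δ : ℝ}

theorem IsRegularPartition.diam_pos (hd : 0 < d) (hDb : Bornology.IsBounded D)
    (hτ : IsRegularPartition D τ δ) (j : Fin m) : 0 < Metric.diam (τ j) := by
  have : Nonempty (Fin d) := ⟨⟨0, hd⟩⟩
  have hb : Bornology.IsBounded (τ j) := hDb.subset (hτ.subset j)
  refine Metric.diam_pos ?_ hb
  by_contra hn
  rw [not_nontrivial_iff] at hn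
  exact ((hτ.isOpen j).measure_pos volume (hτ.nonempty j)).ne' (hn.measure_zero _)

/-- Otherwise two opposite points of the inscribed ball would be farther apart than the diameter. -/
theorem IsRegularPartition.le_one (hd : 0 < d) (hDb : Bornology.IsBounded D)
    (hτ : IsRegularPartition D τ δ) (j : Fin m) : δ ≤ 1 := by
  have hL := hτ.diam_pos hd hDb j
  have hb : Bornology.IsBounded (τ j) := hDb.subset (hτ.subset j)
  obtain ⟨y, hy⟩ := hτ.inscribed j
  by_contra! hδ
  set L := Metric.diam (τ j)
  set u : Rd d := EuclideanSpace.single ⟨0, hd⟩ 1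
  have hu : ‖u‖ = 1 := by simp [u]
  set t := (1 + δ) * L / 4
  have ht : t < δ * L / 2 := by
    simp only [t]
    nlinarith
  have ht0 : 0 < t := by positivity
  have h1 : y + t • u ∈ τ j := hy (by
    rw [mem_ball_iff_norm, add_sub_cancel_left, norm_smul, hu, Real.norm_of_nonneg ht0.le, mul_one]
    exact ht)
  have h2 : y - t • u ∈ τ j := hy (by
    rw [mem_ball_iff_norm, sub_sub_cancel_left, norm_neg, norm_smul, hu,
      Real.norm_of_nonneg ht0.le, mul_one]
    exact ht)
  have h3 := Metric.dist_le_diam_of_mem hb h1 h2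
  have e : y + t • u - (y - t • u) = (2 * t) • u := by module
  rw [dist_eq_norm, e, norm_smul, hu, Real.norm_of_nonneg (by positivity), mul_one] at h3
  change 2 * t ≤ L at h3
  simp only [t] at h3
  nlinarith

theorem diam_le_meshSize (τ : Fin m → Set (Rd d)) (j : Fin m) :
    Metric.diam (τ j) ≤ meshSize τ :=
  le_ciSup (f := fun j => Metric.diam (τ j)) (finite_range _).bddAbove j

/-- The bounds hold only almost everywhere; D has positive measure, so they can be read off at some
point, with a unit vector. -/
theorem IsEllipticCoeff.constants {a : Rd d → Matrix (Fin d) (Fin d) ℝ} {c : Rd d → ℝ}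
    {amin amax cmax : ℝ} (h : IsEllipticCoeff D a c amin amax cmax) (hd : 0 < d) (hD : IsOpen D)
    (hne : D.Nonempty) : amin ≤ amax ∧ 0 ≤ cmax := by
  have hv : volume D ≠ 0 := (hD.measure_pos volume hne).ne'
  have : Filter.NeBot (ae (volume.restrict D)) := by
    rw [ae_neBot]
    simpa using hv
  obtain ⟨x, h1, h2, h3⟩ := (h.lower.and (h.upper.and h.bound_c)).exists
  have := (h1 (Pi.single ⟨0, hd⟩ 1)).trans (h2 (Pi.single ⟨0, hd⟩ 1))
  refine ⟨by simpa using this, h3.1.trans h3.2⟩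

/-- Exponential decay of the basis functions, given a bound for the inverse estimate. -/
theorem IsEnergyMinimizer.decay {a : Rd d → Matrix (Fin d) (Fin d) ℝ} {c : Rd d → ℝ}
    {amin amax cmax : ℝ} {i : Fin m} {ψ : Rd d → ℝ} {G : Rd d → Rd d} (hd : 0 < d)
    (hD : IsOpen D) (hDb : Bornology.IsBounded D) (hamin : 0 < amin)
    (hcoeff : IsEllipticCoeff D a c amin amax cmax) (hδ : 0 < δ) (hτ : IsRegularPartition D τ δ)
    (hψ : IsEnergyMinimizer D a c (piecewiseConst τ) i ψ G) {x : Rd d} (hx : x ∈ τ i)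
    {s C : ℝ} (hs0 : 0 ≤ s) (hs3 : 3 ≤ s ^ 2)
    (hs : ∀ ρ, 0 ≤ ρ → ρ ≤ meshSize τ / 2 →
      amax * (d * (d + 2)) + cmax * ρ ^ 2 * (d + 2) ^ 2 / 4 ≤ s ^ 2 * amax)
    (hC : 2 * s * (1 / δ) ^ ((d : ℝ) / 2 + 1) = C) (r : ℝ) :
    energySq a c (D \ Metric.ball x r) ψ G ≤
      Real.exp (1 - r / (decayLength C amin amax * meshSize τ)) * energySq a c D ψ G := by
  have hne : D.Nonempty := ⟨x, hτ.subset i hx⟩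
  obtain ⟨haa, hcmax⟩ := hcoeff.constants hd hD hne
  have hamax : 0 ≤ amax := hamin.le.trans haa
  have hδ1 := hτ.le_one hd hDb i
  set h := meshSize τ
  have hh : 0 < h := (hτ.diam_pos hd hDb i).trans_le (diam_le_meshSize τ i)
  have hC' : s * (3 * δ⁻¹ - 1) ≤ C := by
    rw [← hC, mul_comm 2 s, mul_assoc]
    exact mul_le_mul_of_nonneg_left (three_mul_inv_sub_one_le_rpow hd hδ hδ1) hs0
  obtain ⟨hl2, hlA⟩ := decayLength_bounds hs3 hs0 hδ hδ1 hamin haa hC'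
  set l := decayLength C amin amax
  have hl0 : 0 < l := by linarith
  have hE : 0 ≤ energySq a c D ψ G := hcoeff.energySq_nonneg hamin.le subset_rfl ψ G
  have hψH := hψ.1.1
  -- For r ≤ 2h the exponent is nonnegative because l ≥ 2, and the estimate is trivial.
  rcases le_or_gt r (2 * h) with hr | hr
  · have h1 : energySq a c (D \ Metric.ball x r) ψ G ≤ energySq a c D ψ G := by
      simp only [energySq_eq_integral]
      exact setIntegral_mono_set (hcoeff.integrable_energyDensity hamin.le hψH.memLp hψH.memLp
        hψH.memLp_grad hψH.memLp_grad) (hcoeff.energyDensity_self_nonneg hamin.le ψ G)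
        sdiff_subset.eventuallyLE
    have h2 : 1 ≤ Real.exp (1 - r / (l * h)) := by
      refine Real.one_le_exp (sub_nonneg.2 ((div_le_one (by positivity)).2 (hr.trans ?_)))
      exact mul_le_mul_of_nonneg_right hl2 hh.le
    nlinarith
  · obtain ⟨b, hb⟩ := hψ.exists_multipliers hcoeff hamin.le hDb.measure_lt_top.ne hτ
    have hbdd : ∀ j, Bornology.IsBounded (τ j) := fun j => hDb.subset (hτ.subset j)
    have hmul : ∀ j (v : Rd d → ℝ), IsTestFun (τ j) v →
        ∫ x in D, energyDensity a c ψ G v (gradient v) x = b j * ∫ x in τ j, v x := by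
      intro j v hv
      rw [hb v _ (MemH10.of_isTestFun (hv.mono (hτ.subset j)))]
      refine Finset.sum_eq_single j (fun k _ hk => ?_) (by simp)
      rw [hτ.integral_testFun_of_ne hk.symm hv, mul_zero]
    have hA : 0 ≤ elementConst s δ amin amax := by
      have : 0 ≤ 1 - δ / 2 := by linarith
      unfold elementConst
      positivity
    have key := energySq_decay hcoeff hamin.le hD.measurableSet hDb hτ hψH hb hx hh
      (diam_le_meshSize τ) hA (inv_pos.2 hl0) hlA (fun j hj η M hη hM0 hM => by
        obtain ⟨y, hy⟩ := hτ.inscribed j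
        have hL := hτ.diam_pos hd hDb j
        have hρ : 0 < δ * Metric.diam (τ j) / 2 := by positivity
        have hinv := sq_multiplier_le hcoeff hamin.le hamax hcmax hψH hD.measurableSet (hτ.subset j)
          (hτ.isOpen j) (hτ.convex j) (hbdd j) (nonempty_compl_of_isBounded hd (hbdd j)) hρ hy
          (hmul j)
        refine element_error_le hcoeff hamin hamax hψH (hτ.subset j) (hτ.isOpen j) (hτ.convex j)
          (hbdd j) hδ hδ1 hL hy (by rw [hψ.integral_self hτ, if_neg hj.symm]) hs0 ?_ hη hM0 hM
        refine hinv.trans ?_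
        rw [mul_comm (s ^ 2 * amax)]
        refine mul_le_mul_of_nonneg_left (hs _ hρ.le ?_)
          (hcoeff.energySq_nonneg hamin.le (hτ.subset j) ψ G)
        have := diam_le_meshSize τ j
        have : δ * Metric.diam (τ j) ≤ 1 * h := mul_le_mul hδ1 this Metric.diam_nonneg zero_le_one
        linarith) hr
    -- With α = 1/l the loss 2α is at most 1, the constant term of the exponent.
    refine key.trans (mul_le_mul_of_nonneg_right (Real.exp_le_exp.2 ?_) hE)
    have h1 : l⁻¹ ≤ 1 / 2 := by
      rw [one_div]
      exact inv_anti₀ two_pos hl2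
    have h2 : l⁻¹ * (r / h) = r / (l * h) := by
      field_simp
    rw [mul_sub, h2]
    linarith

end Regular

theorem mainTheorem12 {d m : ℕ} (hd : 0 < d)
    (D : Set (Rd d)) (hD : IsOpen D) (hDb : Bornology.IsBounded D)
    (a : Rd d → Matrix (Fin d) (Fin d) ℝ) (c : Rd d → ℝ) (amin amax cmax : ℝ)
    (hamin : 0 < amin) (hcoeff : IsEllipticCoeff D a c amin amax cmax)
    (τ : Fin m → Set (Rd d)) (δ : ℝ) (hδ : 0 < δ) (hτ : IsRegularPartition D τ δ)
    (i : Fin m) (ψ : Rd d → ℝ) (G : Rd d → Rd d)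
    (hψ : IsEnergyMinimizer D a c (piecewiseConst τ) i ψ G)
    (x : Rd d) (hx : x ∈ τ i) (r : ℝ) (hr : 0 < r) :
    (0 < cmax → meshSize τ ≤ Real.pi * √(amax / (2 * cmax)) →
      energySq a c (D \ Metric.ball x r) ψ G ≤
        Real.exp (1 - r / (decayLength (√(8 * d * (d + 2)) * (1 / δ) ^ ((d : ℝ) / 2 + 1))
          amin amax * meshSize τ)) * energySq a c D ψ G) ∧
    ((∀ᵐ y ∂(volume.restrict D), c y = 0) →
      energySq a c (D \ Metric.ball x r) ψ G ≤
        Real.exp (1 - r / (decayLength (√(4 * d * (d + 2)) * (1 / δ) ^ ((d : ℝ) / 2 + 1))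
          amin amax * meshSize τ)) * energySq a c D ψ G) := by
  have hd1 : (1 : ℝ) ≤ d := by exact_mod_cast hd
  have hamax : 0 ≤ amax := hamin.le.trans (hcoeff.constants hd hD ⟨x, hτ.subset i hx⟩).1
  have hsqrt : ∀ p : ℝ, √(4 * p) = 2 * √p := fun p => by
    rw [Real.sqrt_mul (by norm_num), show (4 : ℝ) = 2 ^ 2 by norm_num, Real.sqrt_sq zero_le_two]
  refine ⟨fun hcmax hmesh => ?_, fun hc => ?_⟩
  -- Here s² is twice the gradient part d(d + 2) of the multiplier bound; the second half absorbs
  -- the zeroth-order term.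
  · refine hψ.decay hd hD hDb hamin hcoeff hδ hτ hx (s := √(2 * d * (d + 2)))
      (Real.sqrt_nonneg _) ?_ (fun ρ hρ0 hρ => ?_) ?_ r
    · rw [Real.sq_sqrt (by positivity)]
      nlinarith
    · rw [Real.sq_sqrt (by positivity)]
      -- From ρ ≤ h/2, the mesh restriction and π² ≤ 10. The rounding is affordable: what remains is
      -- (10/32)(d + 2) ≤ d, true for d ≥ 1.
      have h1 : cmax * ρ ^ 2 ≤ 10 * amax / 8 := by
        have h2 : ρ ^ 2 ≤ (Real.pi * √(amax / (2 * cmax)) / 2) ^ 2 :=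
          pow_le_pow_left₀ hρ0 (by linarith) 2
        rw [div_pow, mul_pow, Real.sq_sqrt (by positivity)] at h2
        have hpi : Real.pi ^ 2 ≤ 10 := by
          have := Real.pi_lt_d2
          norm_num at this
          nlinarith [Real.pi_pos]
        calc cmax * ρ ^ 2 ≤ cmax * (Real.pi ^ 2 * (amax / (2 * cmax)) / 2 ^ 2) :=
              mul_le_mul_of_nonneg_left h2 hcmax.le
          _ = Real.pi ^ 2 * amax / 8 := by
              field_simp
              norm_num
          _ ≤ _ := by
              have := mul_le_mul_of_nonneg_right hpi hamax
              linarith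
      have h3 : cmax * ρ ^ 2 * ((d : ℝ) + 2) ^ 2 / 4 ≤ 10 * amax / 8 * (d + 2) ^ 2 / 4 := by
        gcongr
      have h4 : 0 ≤ amax * ((d + 2) * (d - 1)) := mul_nonneg hamax (by nlinarith)
      have h5 : 0 ≤ amax * ((d : ℝ) + 2) := by positivity
      nlinarith
    · rw [show (8 * d * (d + 2) : ℝ) = 4 * (2 * d * (d + 2)) by ring, hsqrt]
  -- With 0 as the bound on c the zeroth-order term disappears for every h, and s² = d(d + 2)
  -- suffices.
  · have hcoeff0 : IsEllipticCoeff D a c amin amax 0 :=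
      { hcoeff with bound_c := hc.mono fun y hy => by simp [hy] }
    refine hψ.decay hd hD hDb hamin hcoeff0 hδ hτ hx (s := √(d * (d + 2)))
      (Real.sqrt_nonneg _) ?_ (fun ρ hρ0 hρ => ?_) ?_ r
    · rw [Real.sq_sqrt (by positivity)]
      nlinarith
    · rw [Real.sq_sqrt (by positivity)]
      linarith
    · rw [show (4 * d * (d + 2) : ℝ) = 4 * (d * (d + 2)) by ring, hsqrt]
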